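/- Definitions. Let $U\subset\mathbb{C}^n$ be open and $X\subset U$ a real-analytic subvariety. $X_{\mathrm{reg}}$ is the set of $p\in X$ near which $X$ is a real-analytic submanifold, and $X_{\mathrm{sing}}=X\setminus X_{\mathrm{reg}}$; $\dim X$ is the maximal dimension of $X$ at a regular point, and $\dim_pX$ is the minimum of $\dim (X\cap V)$ over neighborhoods $V$ of $p$ (the same for complex-analytic sets, with complex dimension). $I_p(X)$ is the ideal of germs at $p$ of real-analytic functions vanishing on the germ $(X,p)$; $X$ is coherent if near every point finitely many real-analytic functions generate $I_q(X)$ at all nearby $q$. Let $\iota(z)=(z,\bar z)$ and $U^{\mathrm{conj}}=\{z:\bar z\in U\}$. Let $\mathcal{X}^U$ be the smallest complex-analytic subvariety of $U\times U^{\mathrm{conj}}$ containing $\iota(X)$, and $\mathcal{X}_p$ the smallest germ at $(p,\bar p)$ of a complex-analytic subvariety containing the germ of $\iota(X)$. If $\dim X=d$, the set $U$ is called good for $X$ at $p\in X$ if: $U$ is connected; $\dim_p X=\dim\mathcal{X}_p=\dim\mathcal{X}^U=d$; there is a real-analytic $\psi\colon U\to\mathbb{R}^k$ with zero set $X$, whose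 complexification converges in $U\times U^{\mathrm{conj}}$ and whose components generate $I_p(X)$; $\mathcal{X}^U\cap\iota(\mathbb{C}^n)=\iota(X)$; the germ of $\mathcal{X}^U$ at $(p,\bar p)$ is $\mathcal{X}_p$; and taking germs at $(p,\bar p)$ is a bijection from the irreducible components of $\mathcal{X}^U$ to those of $\mathcal{X}_p$. An open $U'\subset U$ is good for $X$ at $p$ if it is good for $X\cap U'$ at $p$. Put $\Sigma^U_pX=\{z\in U:(z,\bar p)\in\mathcal{X}^U\}$ and $\Sigma^{U'}_pX=\Sigma^{U'}_p(X\cap U')$ for open $U'\subset U$, and let $\Sigma_pX$ be the germ of $\Sigma^{U'}_pX$ at $p$ for any $U'$ good for $X$ at $p$ (it does not depend on $U'$). Let $X_{[k]}$ be the set of $p\in X$ with $\dim\Sigma_pX\ge k$ (for a hypersurface $X\subset\mathbb{C}^n$, $X_{[n]}$ is the set of Segre-degenerate points), and $X_{U[k]}=\{p\in U:\dim_p\Sigma^U_p(X\cap U)\ge k\}$. Statement. Let $X\subset\mathbb{C}^3$, in coordinates $(z,w,\xi)$, be given by $\psi=0$, where $$\psi = w^2\bar w^2\,\mathrm{Re}\,\xi+4(\mathrm{Re}\,z)(\mathrm{Re}\,\xi)^2w\bar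 w+4(\mathrm{Re}\,z)^3z\bar z .$$ Then $X$ is a noncoherent real-analytic subvariety of $\mathbb{C}^3$ of real dimension $5$, its germ at the origin is irreducible, and $I_0(X)$ is generated by $\psi$. Moreover: (i) $X_{\mathrm{sing}}=\{\mathrm{Re}\,z=0,\ w=0,\ \mathrm{Re}\,\xi=0\}$, so $\dim X_{\mathrm{sing}}=2$. (ii) $\{d\psi=0\}=\{\mathrm{Re}\,z=0,\ w=0\}\subset X$, which has real dimension $3$. For every germ at $0$ of a real-analytic function $f$ vanishing on $X$, the germ at $0$ of $\{df=0\}\cap X$ contains the germ of the real $3$-plane $\{\mathrm{Re}\,z=0,\ w=0\}$; and $\dim_0(\{df=0\}\cap X)=3$ if $f$ generates $I_0(X)$. (iii) $X_{[3]}=\{z=0,\ w=0,\ \mathrm{Re}\,\xi=0\}$, a real line, so $\dim X_{[3]}=1$; in particular $X_{[3]}$ is not a complex-analytic subvariety of $\mathbb{C}^3$. (iv) For every open $U\subset\mathbb{C}^3$ that is good for $X$ at the origin, $X_{U[3]}$ coincides near the origin with the complex line $\{z=0,\ w=0\}$, and $X_{U[3]}\cap X_{\mathrm{reg}}\neq\emptyset$.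 Thus the set of Segre-degenerate points of a hypersurface need not be complex or even-dimensional. -/

import Mathlib

open Set Filter Topology

namespace SegreExample

section Subvarieties

variable (𝕜 : Type*) [NontriviallyNormedField 𝕜]
  {E : Type*} [NormedAddCommGroup E] [NormedSpace 𝕜 E]

/-- `X` is an analytic subvariety of the open set `U`: locally at every point of `U` it is the
common zero set of a family of `𝕜`-analytic functions.  For `𝕜 = ℝ` these are the real-analytic
subvarieties, for `𝕜 = ℂ` the complex-analytic ones. -/
def IsSubvariety (U X : Set E) : Prop :=
  IsOpen U ∧ X ⊆ U ∧ ∀ p ∈ U, ∃ V : Set E, IsOpen V ∧ p ∈ V ∧ V ⊆ U ∧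
    ∃ F : Set (E → 𝕜), (∀ f ∈ F, AnalyticOnNhd 𝕜 f V) ∧
      X ∩ V = {q | q ∈ V ∧ ∀ f ∈ F, f q = 0}

/-- Near `p ∈ X`, the set `X` is a `𝕜`-analytic submanifold of `𝕜`-dimension `d`: it is the zero
set of an analytic submersion onto `𝕜 ^ k`, where `d + k = dim E`. -/
def IsRegularAt (X : Set E) (d : ℕ) (p : E) : Prop :=
  p ∈ X ∧ ∃ (k : ℕ) (V : Set E) (f : E → Fin k → 𝕜),
    d + k = Module.finrank 𝕜 E ∧ IsOpen V ∧ p ∈ V ∧ AnalyticOnNhd 𝕜 f V ∧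
      (∀ q ∈ V, Function.Surjective (fderiv 𝕜 f q)) ∧ X ∩ V = {q | q ∈ V ∧ f q = 0}

/-- The set `X_reg` of regular points. -/
def regularSet (X : Set E) : Set E := {p | ∃ d : ℕ, IsRegularAt 𝕜 X d p}

/-- The set `X_sing` of singular points. -/
def singularSet (X : Set E) : Set E := X \ regularSet 𝕜 X

/-- The dimension of `X`: the maximal dimension at a regular point (`⊥` for the empty set). -/
noncomputable def dim (X : Set E) : WithBot ℕ∞ :=
  ⨆ d ∈ {d : ℕ | ∃ p, IsRegularAt 𝕜 X d p}, (d : WithBot ℕ∞)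

/-- The dimension of `X` at `p`, which is the dimension of the germ `(X, p)`: the minimal
dimension of `X ∩ V` over all neighborhoods `V` of `p`. -/
noncomputable def dimAt (X : Set E) (p : E) : WithBot ℕ∞ :=
  ⨅ V ∈ 𝓝 p, dim 𝕜 (X ∩ V)

/-- The subvariety `A` of `W` is irreducible: it is not the union of two proper subvarieties. -/
def IsIrreducibleSubvariety (W A : Set E) : Prop :=
  IsSubvariety 𝕜 W A ∧ A.Nonempty ∧
    ∀ B C : Set E, IsSubvariety 𝕜 W B → IsSubvariety 𝕜 W C → A = B ∪ C → A = B ∨ A = C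

/-- `C` is an irreducible component of the subvariety `A` of `W`. -/
def IsIrreducibleComponent (W A C : Set E) : Prop :=
  IsIrreducibleSubvariety 𝕜 W C ∧ C ⊆ A ∧
    ∀ C' : Set E, IsIrreducibleSubvariety 𝕜 W C' → C ⊆ C' → C' ⊆ A → C' = C

/-! Germs of sets at `p` are represented by sets; equality and inclusion of germs are
`A =ᶠ[𝓝 p] B` and `A ≤ᶠ[𝓝 p] B`. -/

/-- `A` represents a germ at `p` of an analytic subvariety. -/
def IsSubvarietyGerm (A : Set E) (p : E) : Prop :=
  ∃ V : Set E, p ∈ V ∧ IsSubvariety 𝕜 V (A ∩ V)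

/-- The germ `(A, p)` of a subvariety is (nonempty and) irreducible. -/
def IsIrreducibleGerm (A : Set E) (p : E) : Prop :=
  IsSubvarietyGerm 𝕜 A p ∧ p ∈ A ∧
    ∀ B C : Set E, IsSubvarietyGerm 𝕜 B p → IsSubvarietyGerm 𝕜 C p →
      A =ᶠ[𝓝 p] (B ∪ C : Set E) → A =ᶠ[𝓝 p] B ∨ A =ᶠ[𝓝 p] C

/-- The germ `(C, p)` is an irreducible component of the germ `(A, p)`. -/
def IsGermComponent (A : Set E) (p : E) (C : Set E) : Prop :=
  IsIrreducibleGerm 𝕜 C p ∧ C ≤ᶠ[𝓝 p] A ∧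
    ∀ C' : Set E, IsIrreducibleGerm 𝕜 C' p → C ≤ᶠ[𝓝 p] C' → C' ≤ᶠ[𝓝 p] A → C' =ᶠ[𝓝 p] C

end Subvarieties

section Ideals

variable {E : Type*} [NormedAddCommGroup E] [NormedSpace ℝ E]

/-- The germ at `p` of the real-valued function `g` belongs to the ideal `I_p(X)` of germs of
real-analytic functions that vanish on the germ `(X, p)`. -/
def MemIdealAt (X : Set E) (p : E) (g : E → ℝ) : Prop :=
  AnalyticAt ℝ g p ∧ ∀ᶠ q in 𝓝 p, q ∈ X → g q = 0

/-- The germs at `p` of the components of `f` generate the ideal `I_p(X)`. -/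
def GeneratesIdealAt {k : ℕ} (f : E → Fin k → ℝ) (X : Set E) (p : E) : Prop :=
  (∀ i, MemIdealAt X p (fun q => f q i)) ∧
    ∀ g : E → ℝ, MemIdealAt X p g →
      ∃ a : Fin k → E → ℝ, (∀ i, AnalyticAt ℝ (a i) p) ∧
        ∀ᶠ q in 𝓝 p, g q = ∑ i, a i q * f q i

/-- The real-analytic subvariety `X` of `U` is coherent: near every point finitely many
real-analytic functions generate the ideals `I_q(X)` at all nearby points `q`. -/
def IsCoherent (U X : Set E) : Prop :=
  ∀ p ∈ U, ∃ V : Set E, IsOpen V ∧ p ∈ V ∧ V ⊆ U ∧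
    ∃ (k : ℕ) (f : E → Fin k → ℝ), AnalyticOnNhd ℝ f V ∧ ∀ q ∈ V, GeneratesIdealAt f X q

end Ideals

section Segre

variable {n : ℕ}

/-- The embedding `ι(z) = (z, z̄)`; `star` is coordinatewise complex conjugation. -/
def iota (z : Fin n → ℂ) : (Fin n → ℂ) × (Fin n → ℂ) := (z, star z)

/-- The set `U × U^conj`, where `U^conj = {z | z̄ ∈ U}`. -/
def doubled (U : Set (Fin n → ℂ)) : Set ((Fin n → ℂ) × (Fin n → ℂ)) :=
  U ×ˢ {z | star z ∈ U}

/-- The set `𝒳^U`: the smallest complex-analytic subvariety of `U × U^conj` containing `ι(X)`,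
i.e. the intersection of all such subvarieties. -/
def complexification (U X : Set (Fin n → ℂ)) : Set ((Fin n → ℂ) × (Fin n → ℂ)) :=
  ⋂₀ {A | IsSubvariety ℂ (doubled U) A ∧ iota '' X ⊆ A}

/-- `A` represents the complexification `𝒳_p` of the germ `(X, p)`: the smallest germ at
`(p, p̄)` of a complex-analytic subvariety which contains the image of `(X, p)` under `ι`. -/
def IsGermComplexification (X : Set (Fin n → ℂ)) (p : Fin n → ℂ)
    (A : Set ((Fin n → ℂ) × (Fin n → ℂ))) : Prop :=
  IsSubvarietyGerm ℂ A (iota p) ∧ iota '' X ≤ᶠ[𝓝 (iota p)] A ∧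
    ∀ B, IsSubvarietyGerm ℂ B (iota p) → iota '' X ≤ᶠ[𝓝 (iota p)] B → A ≤ᶠ[𝓝 (iota p)] B

/-- The open set `U` is good for the real-analytic subvariety `X` of `U` at `p ∈ X`. -/
structure IsGood (U X : Set (Fin n → ℂ)) (p : Fin n → ℂ) : Prop where
  subvariety : IsSubvariety ℝ U X
  mem : p ∈ X
  connected : IsConnected U
  dim_germ : dimAt ℝ X p = dim ℝ X
  dim_complexification_germ : dimAt ℂ (complexification U X) (iota p) = dim ℝ X
  dim_complexification : dim ℂ (complexification U X) = dim ℝ X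
  /-- There is a real-analytic `ψ : U → ℝ ^ k` whose complexification `Ψ` converges in
  `U × U^conj`, whose zero set is `X`, and whose germ at `p` generates `I_p(X)`. -/
  exists_defining : ∃ (k : ℕ) (ψ : (Fin n → ℂ) → Fin k → ℝ)
      (Ψ : (Fin n → ℂ) × (Fin n → ℂ) → Fin k → ℂ),
    AnalyticOnNhd ℝ ψ U ∧ AnalyticOnNhd ℂ Ψ (doubled U) ∧
      (∀ z ∈ U, ∀ i, Ψ (iota z) i = (ψ z i : ℂ)) ∧
      X = {z | z ∈ U ∧ ψ z = 0} ∧ GeneratesIdealAt ψ X p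
  inter_diagonal : complexification U X ∩ range iota = iota '' X
  germ_eq : IsGermComplexification X p (complexification U X)
  /-- Taking germs at `(p, p̄)` is a bijection from the irreducible components of `𝒳^U` to those
  of the germ of `𝒳^U` (which is `𝒳_p`). -/
  component_germ : ∀ C, IsIrreducibleComponent ℂ (doubled U) (complexification U X) C →
    IsGermComponent ℂ (complexification U X) (iota p) C
  component_inj : ∀ C C', IsIrreducibleComponent ℂ (doubled U) (complexification U X) C →
    IsIrreducibleComponent ℂ (doubled U) (complexification U X) C' →
    C =ᶠ[𝓝 (iota p)] C' → C = C'
  component_surj : ∀ D, IsGermComponent ℂ (complexification U X) (iota p) D →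
    ∃ C, IsIrreducibleComponent ℂ (doubled U) (complexification U X) C ∧ C =ᶠ[𝓝 (iota p)] D

/-- The Segre variety `Σ_p^U X = {z ∈ U | (z, p̄) ∈ 𝒳^U}` of `X` at `p` relative to `U`. -/
def segreVariety (U X : Set (Fin n → ℂ)) (p : Fin n → ℂ) : Set (Fin n → ℂ) :=
  {z | z ∈ U ∧ (z, star p) ∈ complexification U X}

/-- The set `X_{U[k]}` of points `p ∈ U` with `dim_p Σ_p^U X ≥ k`. -/
def relSegreDegenerate (U X : Set (Fin n → ℂ)) (k : ℕ) : Set (Fin n → ℂ) :=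
  {p | p ∈ U ∧ (k : WithBot ℕ∞) ≤ dimAt ℂ (segreVariety U X p) p}

/-- The set `X_{[k]}` of points `p ∈ U` with `dim Σ_p X ≥ k`, where `Σ_p X` is the germ at `p` of
`Σ_p^{U'} (X ∩ U')` for a neighborhood `U' ⊆ U` that is good for `X` at `p` (this germ does not
depend on the choice of `U'`, and it is empty for `p ∉ X`). -/
def segreDegenerate (U X : Set (Fin n → ℂ)) (k : ℕ) : Set (Fin n → ℂ) :=
  {p | p ∈ U ∧ ∃ U' : Set (Fin n → ℂ), U' ⊆ U ∧ IsGood U' (X ∩ U') p ∧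
    (k : WithBot ℕ∞) ≤ dimAt ℂ (segreVariety U' (X ∩ U') p) p}

end Segre

/-- The function `ψ = w² w̄² Re ξ + 4 (Re z) (Re ξ)² w w̄ + 4 (Re z)³ z z̄` on `ℂ³`, with
coordinates `z = p 0`, `w = p 1`, `ξ = p 2`. -/
def psi (p : Fin 3 → ℂ) : ℝ :=
  Complex.normSq (p 1) ^ 2 * (p 2).re + 4 * (p 0).re * (p 2).re ^ 2 * Complex.normSq (p 1)
    + 4 * (p 0).re ^ 3 * Complex.normSq (p 0)

theorem ofReal_psi (p : Fin 3 → ℂ) :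
    (psi p : ℂ) = p 1 ^ 2 * star (p 1) ^ 2 * ((p 2).re : ℂ)
      + 4 * ((p 0).re : ℂ) * ((p 2).re : ℂ) ^ 2 * (p 1 * star (p 1))
      + 4 * ((p 0).re : ℂ) ^ 3 * (p 0 * star (p 0)) := by
  have h : ∀ z : ℂ, ((Complex.normSq z : ℝ) : ℂ) = z * star z := fun z =>
    (Complex.mul_conj z).symm
  simp only [psi, Complex.ofReal_add, Complex.ofReal_mul, Complex.ofReal_pow, h,
    Complex.ofReal_ofNat]
  ring

/-- The hypersurface `X = {ψ = 0}` in `ℂ³`. -/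
def hypersurface : Set (Fin 3 → ℂ) := {p | psi p = 0}

end SegreExample

namespace SegreExample

/-! ### Regular points, dimension, and linear subspaces -/

section Dimension

variable {𝕜 : Type*} [RCLike 𝕜] {E : Type*} [NormedAddCommGroup E] [NormedSpace 𝕜 E]

/-! Write `x = Re z`, `y = Im z`, `W = |w|²`, `s = Re ξ`. Then `ψ = 4 (x⁵ + y² x³ + s² W x + s W² /
4)`: a quintic monic in `x`, homogeneous of degree 5 under real scaling of ℂ³ and independent of `Im
ξ`. Hence X is a cone with vertex at every point of the line `z = w = 0`, `s = 0`. A power series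
vanishes on such a cone near a vertex iff each of its homogeneous terms does, so questions about
germs there become questions about forms.

The complexified cone `{complexPsi = 0}` has a polynomial parametrization by ℂ⁴ that is dense up to
scaling (`param`), so the forms vanishing on it form a prime ideal. Even the forms vanishing on
`iota '' X` pull back to zero under `param` (`eq_zero_of_real_vanishing`). Thus the complexification
of X at a vertex is the full cone and is irreducible, X itself is irreducible at 0, and the whole
space is good at every vertex (`isGood_univ`). Weierstrass division by the quintic shows that ψ
generates the ideal at 0 (`exists_eq_mul_psi`), so every germ vanishing on X has differential zero
on `x = 0`, `w = 0`, where `dψ = 0`.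

At points with `x = 0`, `w = 0`, `s ≠ 0` the picture changes. There `s ψ = s² (W + 2xs(1 + S)) (W +
2xs(1 - S))` with `S = √(1 - x|z|²/s³)`. The last factor is nonnegative and vanishes only for `x = W
= 0`, so X is locally the zero set of the middle factor, whose differential is nonzero
(`exists_branch`). Hence these points are regular, X is not coherent, and the Segre variety for a
good neighbourhood of such a point lies in the zero set of the middle factor, which is
nondegenerate. Relative to a fixed good neighbourhood of 0 the full cone is used instead, and all
points of `z = w = 0` near 0 are degenerate.

At points with `x = 0`, `w = 0`, `s = 0`, a function vanishing on X with nonzero differential would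
force `x = O(s²)` on the points of X with `w = ±s`, contradicting the equation `ψ = 0` there
(`not_isRegularAt`). -/

theorem isRegularAt_of_fderiv_ne_zero {X : Set E} {p : E} {n : ℕ} {f : E → 𝕜}
    (hn : n + 1 = Module.finrank 𝕜 E) (hf : AnalyticAt 𝕜 f p) (h0 : f p = 0)
    (hd : fderiv 𝕜 f p ≠ 0) (hX : ∀ᶠ q in 𝓝 p, q ∈ X ↔ f q = 0) : IsRegularAt 𝕜 X n p := by
  refine ⟨hX.self_of_nhds.2 h0, 1, ?_⟩
  have hd' : ∀ᶠ q in 𝓝 p, fderiv 𝕜 f q ≠ 0 := hf.fderiv.continuousAt.eventually_ne hd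
  obtain ⟨V, hV, hVo, hpV⟩ := eventually_nhds_iff.1
    (hX.and (hd'.and hf.eventually_analyticAt))
  refine ⟨V, fun q _ => f q, hn, hVo, hpV, ?_, ?_, ?_⟩
  · exact fun q hq => analyticAt_pi_iff.2 fun _ => (hV q hq).2.2
  · intro q hq
    have hdf := (hV q hq).2.2.differentiableAt
    have h1 : fderiv 𝕜 (fun q (_ : Fin 1) => f q) q
        = ContinuousLinearMap.pi fun _ => fderiv 𝕜 f q :=
      (hasFDerivAt_pi.2 fun _ => hdf.hasFDerivAt).fderiv
    rw [h1]
    intro y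
    obtain ⟨v, hv⟩ := ContinuousLinearMap.exists_ne_zero (hV q hq).2.1
    refine ⟨(y 0 / fderiv 𝕜 f q v) • v, ?_⟩
    ext i
    fin_cases i
    simp [hv]
  · ext q
    constructor
    · exact fun ⟨h1, h2⟩ => ⟨h2, funext fun _ => (hV q h2).1.1 h1⟩
    · exact fun ⟨h1, h2⟩ => ⟨(hV q h1).1.2 (congrFun h2 0), h1⟩

theorem IsRegularAt.congr {X Y : Set E} {p : E} {d : ℕ} (h : IsRegularAt 𝕜 X d p)
    (hXY : X =ᶠ[𝓝 p] Y) : IsRegularAt 𝕜 Y d p := by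
  obtain ⟨hp, k, V, f, hk, hV, hpV, hf, hs, hX⟩ := h
  obtain ⟨W, hW, hWo, hpW⟩ := eventually_nhds_iff.1 hXY
  refine ⟨(iff_of_eq (hW p hpW)).1 hp, k, V ∩ W, f, hk, hV.inter hWo, ⟨hpV, hpW⟩,
    hf.mono inter_subset_left, fun q hq => hs q hq.1, ?_⟩
  ext q
  constructor
  · rintro ⟨h1, h2, h3⟩
    have : q ∈ X ∩ V := ⟨(iff_of_eq (hW q h3)).2 h1, h2⟩
    rw [hX] at this
    exact ⟨⟨h2, h3⟩, this.2⟩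
  · rintro ⟨⟨h2, h3⟩, h1⟩
    have : q ∈ X ∩ V := by rw [hX]; exact ⟨h2, h1⟩
    exact ⟨(iff_of_eq (hW q h3)).1 this.1, h2, h3⟩

theorem inter_eventuallyEq {X V : Set E} {p : E} (hV : V ∈ 𝓝 p) :
    (X ∩ V : Set E) =ᶠ[𝓝 p] X := by
  filter_upwards [hV] with q hq
  exact propext ⟨fun h => h.1, fun h => ⟨h, hq⟩⟩

theorem le_dim {X : Set E} {p : E} {d : ℕ} (h : IsRegularAt 𝕜 X d p) : (d : WithBot ℕ∞) ≤ dim 𝕜 X :=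
  le_iSup₂_of_le (f := fun (d : ℕ) (_ : d ∈ {d : ℕ | ∃ p, IsRegularAt 𝕜 X d p}) =>
    (d : WithBot ℕ∞)) d ⟨p, h⟩ le_rfl

theorem dim_le {X : Set E} {n : ℕ} (h : ∀ d p, IsRegularAt 𝕜 X d p → d ≤ n) :
    dim 𝕜 X ≤ n :=
  iSup₂_le fun d ⟨p, hp⟩ => by exact_mod_cast h d p hp

theorem exists_isRegularAt_of_le_dim {X : Set E} {n : ℕ} (h : (n : WithBot ℕ∞) ≤ dim 𝕜 X) :
    ∃ d p, n ≤ d ∧ IsRegularAt 𝕜 X d p := by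
  by_contra! hc
  rcases n with _ | n
  · have : dim 𝕜 X = ⊥ := by
      refine le_bot_iff.1 (iSup₂_le fun d ⟨p, hp⟩ => ?_)
      exact absurd hp (hc d p (Nat.zero_le _))
    rw [this] at h
    simp at h
  · have h1 : dim 𝕜 X ≤ (n : ℕ) := dim_le fun d p hp => by
      by_contra hlt
      exact hc d p (by omega) hp
    have := h.trans h1
    have : n + 1 ≤ n := by exact_mod_cast this
    omega

theorem dimAt_le_dim (X : Set E) (p : E) : dimAt 𝕜 X p ≤ dim 𝕜 X :=
  (iInf₂_le univ univ_mem).trans (by rw [inter_univ])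

theorem le_dimAt {X : Set E} {p : E} {d : ℕ}
    (h : ∃ᶠ q in 𝓝 p, IsRegularAt 𝕜 X d q) : (d : WithBot ℕ∞) ≤ dimAt 𝕜 X p := by
  refine le_iInf₂ fun V hV => ?_
  obtain ⟨q, hq, hqV⟩ := (h.and_eventually (eventually_mem_nhds_iff.2 hV)).exists
  exact le_dim (hq.congr (inter_eventuallyEq hqV).symm)

theorem dimAt_mono_germ {X Y : Set E} {p : E} (h : X =ᶠ[𝓝 p] Y) :
    dimAt 𝕜 X p ≤ dimAt 𝕜 Y p := by
  refine le_iInf₂ fun V hV => ?_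
  obtain ⟨W, hW, hWo, hpW⟩ := eventually_nhds_iff.1 h
  refine iInf₂_le_of_le _ (inter_mem hV (hWo.mem_nhds hpW)) ?_
  refine iSup₂_le fun d ⟨q, hq⟩ => le_dim (hq.congr ?_)
  filter_upwards [hWo.mem_nhds hq.1.2.2] with r hr
  have := iff_of_eq (hW r hr)
  exact propext ⟨fun h => ⟨this.1 h.1, h.2.1⟩, fun h => ⟨this.2 h.1, h.2, hr⟩⟩

theorem dimAt_congr {X Y : Set E} {p : E} (h : X =ᶠ[𝓝 p] Y) : dimAt 𝕜 X p = dimAt 𝕜 Y p :=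
  le_antisymm (dimAt_mono_germ h) (dimAt_mono_germ h.symm)

theorem IsRegularAt.interior_nonempty {X : Set E} {p : E} {d : ℕ} (h : IsRegularAt 𝕜 X d p)
    (hd : Module.finrank 𝕜 E ≤ d) : (interior X).Nonempty := by
  obtain ⟨hp, k, V, f, hk, hV, hpV, -, -, hX⟩ := h
  obtain rfl : k = 0 := by omega
  refine ⟨p, mem_interior.2 ⟨V, fun q hq => ?_, hV, hpV⟩⟩
  have : q ∈ X ∩ V := by rw [hX]; exact ⟨hq, Subsingleton.elim _ _⟩
  exact this.1

theorem dim_le_of_interior_eq_empty {X : Set E} {n : ℕ} (hn : Module.finrank 𝕜 E = n + 1)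
    (hX : interior X = ∅) : dim 𝕜 X ≤ n :=
  dim_le fun d p h => by
    by_contra hlt
    exact (h.interior_nonempty (by omega)).ne_empty hX

theorem isRegularAt_ker {d k : ℕ} (T : E →L[𝕜] Fin k → 𝕜) (hT : Function.Surjective T)
    (hd : d + k = Module.finrank 𝕜 E) {p : E} (hp : T p = 0) :
    IsRegularAt 𝕜 {q | T q = 0} d p :=
  ⟨hp, k, univ, T, hd, isOpen_univ, mem_univ p, fun q _ => T.analyticAt q,
    fun q _ => by rw [T.fderiv]; exact hT, by ext q; simp⟩

variable [FiniteDimensional 𝕜 E]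

/-- By the implicit function theorem every vector in the kernel of the differential is the velocity
of a curve in `X`. The curve stays in the closed subspace `L`, so this kernel, which has dimension
`d`, lies in `L`. -/
theorem IsRegularAt.le_finrank {X : Set E} {p : E} {d : ℕ} (h : IsRegularAt 𝕜 X d p)
    (L : Submodule 𝕜 E) (hL : X ⊆ L) : d ≤ Module.finrank 𝕜 L := by
  have : CompleteSpace E := FiniteDimensional.complete 𝕜 E
  obtain ⟨hp, k, V, f, hk, hV, hpV, hf, hs, hX⟩ := h
  have hst := (hf p hpV).hasStrictFDerivAt
  have hr : (fderiv 𝕜 f p).range = ⊤ := LinearMap.range_eq_top.2 (hs p hpV)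
  have hker : (fderiv 𝕜 f p).ker ≤ L := by
    intro v hv
    have hfp : f p = 0 := by
      have : p ∈ X ∩ V := ⟨hp, hpV⟩
      rw [hX] at this
      exact this.2
    set g := hst.implicitFunction f (fderiv 𝕜 f p) hr (f p) with hg
    have hg0 : g 0 = p := hst.implicitFunction_apply_image hr
    have hgd : HasFDerivAt g (fderiv 𝕜 f p).ker.subtypeL 0 :=
      (hst.to_implicitFunction hr).hasFDerivAt
    let c : 𝕜 → (fderiv 𝕜 f p).ker := fun t => t • ⟨v, hv⟩
    have hc : HasDerivAt c ⟨v, hv⟩ 0 := by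
      simpa [c] using (hasDerivAt_id (0 : 𝕜)).smul_const (⟨v, hv⟩ : (fderiv 𝕜 f p).ker)
    have hc0 : c 0 = 0 := by simp [c]
    have hgc : HasDerivAt (g ∘ c) v 0 := by
      have := HasFDerivAt.comp_hasDerivAt (0 : 𝕜) (by rw [hc0]; exact hgd) hc
      simpa using this
    have hgX : ∀ᶠ t in 𝓝 (0 : 𝕜), g (c t) ∈ X := by
      have ht : Tendsto (fun t => (f p, c t)) (𝓝 0) (𝓝 (f p, 0)) := by
        have := hc.continuousAt.tendsto
        rw [hc0] at this
        exact tendsto_const_nhds.prodMk_nhds this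
      have h3 : ∀ᶠ t in 𝓝 (0 : 𝕜), g (c t) ∈ V := by
        refine hgc.continuousAt.eventually_mem (hV.mem_nhds ?_)
        simpa [hc0, hg0] using hpV
      filter_upwards [ht.eventually (hst.map_implicitFunction_eq hr), h3] with t h1 h2
      have : g (c t) ∈ X ∩ V := by
        rw [hX]
        exact ⟨h2, h1.trans hfp⟩
      exact this.1
    refine L.closed_of_finiteDimensional.mem_of_tendsto hgc.tendsto_slope ?_
    filter_upwards [nhdsWithin_le_nhds hgX] with t ht
    rw [slope_def_module]
    refine L.smul_mem _ (L.sub_mem (hL ht) ?_)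
    simpa [hc0, hg0] using hL hp
  have h1 := LinearMap.finrank_range_add_finrank_ker (fderiv 𝕜 f p : E →ₗ[𝕜] Fin k → 𝕜)
  have h2 : Module.finrank 𝕜 (LinearMap.range (fderiv 𝕜 f p : E →ₗ[𝕜] Fin k → 𝕜)) = k := by
    rw [LinearMap.range_eq_top.2 (hs p hpV), finrank_top, Module.finrank_fin_fun]
  have h3 := Submodule.finrank_mono hker
  have h4 : Module.finrank 𝕜 (fderiv 𝕜 f p).ker
    = Module.finrank 𝕜 (LinearMap.ker (fderiv 𝕜 f p : E →ₗ[𝕜] Fin k → 𝕜)) := rfl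
  omega

theorem dim_ker {d k : ℕ} (T : E →L[𝕜] Fin k → 𝕜) (hT : Function.Surjective T)
    (hd : d + k = Module.finrank 𝕜 E) : dim 𝕜 {q | T q = 0} = d ∧
      dimAt 𝕜 {q | T q = 0} 0 = d := by
  have hle : dim 𝕜 {q | T q = 0} ≤ d := dim_le fun d' p h => by
    have h1 := h.le_finrank (LinearMap.ker (T : E →ₗ[𝕜] Fin k → 𝕜)) (fun q hq => hq)
    have h2 := LinearMap.finrank_range_add_finrank_ker (T : E →ₗ[𝕜] Fin k → 𝕜)
    rw [LinearMap.range_eq_top.2 hT, finrank_top, Module.finrank_fin_fun] at h2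
    omega
  have hreg : IsRegularAt 𝕜 {q | T q = 0} d 0 := isRegularAt_ker T hT hd (map_zero T)
  have hge : (d : WithBot ℕ∞) ≤ dimAt 𝕜 {q | T q = 0} 0 :=
    le_iInf₂ fun V hV => le_dim (hreg.congr (inter_eventuallyEq hV).symm)
  exact ⟨hle.antisymm (hge.trans (dimAt_le_dim _ _)), ((dimAt_le_dim _ _).trans hle).antisymm hge⟩

end Dimension

/-! ### Analytic germs at the vertex of a cone -/

section Cones

variable {𝕜 : Type*} [RCLike 𝕜] {E : Type*} [NormedAddCommGroup E] [NormedSpace 𝕜 E]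

theorem hasFPowerSeriesAt_line {F : Type*} [NormedAddCommGroup F] [NormedSpace 𝕜 F]
    {f : E → F} {p : FormalMultilinearSeries 𝕜 E F} {c : E}
    (hf : HasFPowerSeriesAt f p c) (v : E) :
    HasFPowerSeriesAt (fun t : 𝕜 => f (c + t • v))
      (p.compContinuousLinearMap (ContinuousLinearMap.toSpanSingleton 𝕜 v)) 0 := by
  have h1 : HasFPowerSeriesAt (fun q => f (q + c)) p 0 := by
    have := hf.comp_sub (-c)
    simpa using this
  have h2 := HasFPowerSeriesAt.compContinuousLinearMap
    (u := ContinuousLinearMap.toSpanSingleton 𝕜 v) (x := (0 : 𝕜)) (by simpa using h1)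
  convert h2 using 2 with t
  simp [add_comm]

theorem eventually_line_eq_zero_iff {f : E → 𝕜} {p : FormalMultilinearSeries 𝕜 E 𝕜} {c : E}
    (hf : HasFPowerSeriesAt f p c) (v : E) :
    (∀ᶠ t in 𝓝 (0 : 𝕜), f (c + t • v) = 0) ↔ ∀ k, p k (fun _ => v) = 0 := by
  rw [(hasFPowerSeriesAt_line hf v).locally_zero_iff]
  constructor
  · intro h k
    have := congrArg (fun m => m (fun _ => (1 : 𝕜))) (congrFun h k)
    simpa [FormalMultilinearSeries.compContinuousLinearMap, Function.comp_def] using this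
  · intro h
    funext k
    refine ContinuousMultilinearMap.ext fun m => ?_
    have h3 : (p.compContinuousLinearMap (ContinuousLinearMap.toSpanSingleton 𝕜 v)) k m
        = p k (fun i => m i • v) := by
      simp [FormalMultilinearSeries.compContinuousLinearMap]
    rw [h3, (p k).map_smul_univ, h k]
    simp

theorem frequently_ofReal {P : 𝕜 → Prop} {a : ℝ} (h : ∃ᶠ t : ℝ in 𝓝[≠] a, P (t : 𝕜)) :
    ∃ᶠ t in 𝓝[≠] (a : 𝕜), P t := by
  have ht : Tendsto (fun t : ℝ => (t : 𝕜)) (𝓝[≠] a) (𝓝[≠] (a : 𝕜)) := by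
    refine tendsto_nhdsWithin_iff.2 ⟨?_, ?_⟩
    · exact (RCLike.continuous_ofReal.tendsto a).mono_left nhdsWithin_le_nhds
    · filter_upwards [self_mem_nhdsWithin] with t ht
      simpa using ht
  exact ht.frequently h

/-- Restricted to the line, `f` is analytic in one variable with Taylor coefficients `p k (v, …,
v)`; zeros at real parameters accumulating at 0 already kill all of them. -/
theorem coeff_eq_zero_of_frequently {f : E → 𝕜} {p : FormalMultilinearSeries 𝕜 E 𝕜} {c : E}
    (hf : HasFPowerSeriesAt f p c) (v : E) (h : ∃ᶠ t : ℝ in 𝓝[≠] (0 : ℝ), f (c + (t : 𝕜) • v) = 0)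
    (k : ℕ) : p k (fun _ => v) = 0 := by
  refine (eventually_line_eq_zero_iff hf v).1 ?_ k
  exact (hasFPowerSeriesAt_line hf v).analyticAt.frequently_zero_iff_eventually_zero.1
    (by simpa using frequently_ofReal (P := fun t : 𝕜 => f (c + t • v) = 0) h)

/-- The series may fail to converge at `v`; analyticity on the ball suffices, by the identity
theorem along the line through `c` and `c + v`. -/
theorem eq_zero_of_coeff_eq_zero {f : E → 𝕜} {p : FormalMultilinearSeries 𝕜 E 𝕜} {c : E} {r : ℝ}
    (hf : HasFPowerSeriesAt f p c) (hfa : AnalyticOnNhd 𝕜 f (Metric.ball c r)) {v : E}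
    (hv : ‖v‖ < r) (h : ∀ k, p k (fun _ => v) = 0) : f (c + v) = 0 := by
  -- Since `R > 1`, the open disc of parameters contains 1 while the line stays in the ball.
  obtain ⟨R, hR1, hR⟩ : ∃ R : ℝ, 1 < R ∧ R * ‖v‖ < r := by
    have : ContinuousAt (fun R : ℝ => R * ‖v‖) 1 := by fun_prop
    have h1 : ∀ᶠ R in 𝓝 (1 : ℝ), R * ‖v‖ < r := this.eventually_lt continuousAt_const (by simpa)
    obtain ⟨R, h2, h3⟩ := ((h1.filter_mono nhdsWithin_le_nhds).and
      (self_mem_nhdsWithin : Ioi (1 : ℝ) ∈ 𝓝[>] 1)).exists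
    exact ⟨R, h3, h2⟩
  have han : AnalyticOnNhd 𝕜 (fun t : 𝕜 => f (c + t • v)) (Metric.ball 0 R) := by
    intro t ht
    have h1 : AnalyticAt 𝕜 (fun t : 𝕜 => c + t • v) t := by fun_prop
    refine AnalyticAt.comp (g := f) (f := fun t : 𝕜 => c + t • v) (hfa _ ?_) h1
    rw [mem_ball_zero_iff] at ht
    rw [mem_ball_iff_norm, add_sub_cancel_left, norm_smul]
    exact lt_of_le_of_lt (mul_le_mul_of_nonneg_right ht.le (norm_nonneg _)) hR
  have := han.eqOn_zero_of_preconnected_of_eventuallyEq_zero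
    (convex_ball (0 : 𝕜) R).isPreconnected (Metric.mem_ball_self (by linarith))
    ((eventually_line_eq_zero_iff hf v).2 h)
  simpa using this (x := 1) (by simpa using hR1)

theorem IsSubvarietyGerm.exists_ball {B : Set E} {c : E} (hB : IsSubvarietyGerm 𝕜 B c) :
    ∃ r > 0, ∃ F : Set (E → 𝕜), (∀ f ∈ F, AnalyticOnNhd 𝕜 f (Metric.ball c r)) ∧
      ∀ q ∈ Metric.ball c r, q ∈ B ↔ ∀ f ∈ F, f q = 0 := by
  obtain ⟨V, hcV, hV, -, h⟩ := hB
  obtain ⟨W, hW, hcW, hWV, F, hF, hB⟩ := h c hcV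
  obtain ⟨r, hr, hrW⟩ := Metric.isOpen_iff.1 hW c hcW
  refine ⟨r, hr, F, fun f hf => (hF f hf).mono hrW, fun q hq => ?_⟩
  have hqW := hrW hq
  have h1 : q ∈ B ∩ V ∩ W ↔ q ∈ {q | q ∈ W ∧ ∀ f ∈ F, f q = 0} := by rw [hB]
  constructor
  · exact fun h => (h1.1 ⟨⟨h, hWV hqW⟩, hqW⟩).2
  · exact fun h => (h1.2 ⟨hqW, h⟩).1.1

/-- A cone with vertex `0`, translated to have its vertex at `c`. -/
structure IsConeAt (𝕜 : Type*) [RCLike 𝕜] {E : Type*} [NormedAddCommGroup E] [NormedSpace 𝕜 E]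
    (S X : Set E) (c : E) : Prop where
  smul_mem : ∀ v ∈ S, ∀ t : ℝ, (t : 𝕜) • v ∈ S
  add_mem_iff : ∀ v, c + v ∈ X ↔ v ∈ S

theorem tendsto_line (c v : E) : Tendsto (fun t : ℝ => c + (t : 𝕜) • v) (𝓝 0) (𝓝 c) := by
  have : Continuous (fun t : ℝ => c + (t : 𝕜) • v) :=
    continuous_const.add (RCLike.continuous_ofReal.smul continuous_const)
  simpa using this.tendsto 0

theorem IsConeAt.coeff_eq_zero {S X : Set E} {c : E} (hS : IsConeAt 𝕜 S X c) {f : E → 𝕜}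
    {p : FormalMultilinearSeries 𝕜 E 𝕜} (hf : HasFPowerSeriesAt f p c)
    (h : ∀ᶠ q in 𝓝 c, q ∈ X → f q = 0) (k : ℕ) {v : E} (hv : v ∈ S) : p k (fun _ => v) = 0 := by
  refine coeff_eq_zero_of_frequently hf v (Eventually.frequently ?_) k
  have ht := (tendsto_line (𝕜 := 𝕜) c v).mono_left (nhdsWithin_le_nhds : 𝓝[≠] (0 : ℝ) ≤ 𝓝 0)
  filter_upwards [ht.eventually h] with t h3
  exact h3 ((hS.add_mem_iff _).2 (hS.smul_mem v hv t))

theorem IsConeAt.eq_zero {S X : Set E} {c : E} (hS : IsConeAt 𝕜 S X c) {f : E → 𝕜} {r : ℝ}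
    {p : FormalMultilinearSeries 𝕜 E 𝕜} (hf : HasFPowerSeriesAt f p c)
    (hfa : AnalyticOnNhd 𝕜 f (Metric.ball c r))
    (h : ∀ k, ∀ v ∈ S, p k (fun _ => v) = 0) {q : E} (hq : q ∈ Metric.ball c r) (hqX : q ∈ X) :
    f q = 0 := by
  have h1 : c + (q - c) = q := by abel
  rw [← h1]
  refine eq_zero_of_coeff_eq_zero hf hfa (by rwa [← mem_ball_iff_norm]) fun k => h k _ ?_
  rw [← hS.add_mem_iff, h1]
  exact hqX

theorem IsConeAt.eq_zero_on_ball {S X : Set E} {c : E} (hS : IsConeAt 𝕜 S X c) {f : E → 𝕜} {r : ℝ}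
    (hr : 0 < r) (hfa : AnalyticOnNhd 𝕜 f (Metric.ball c r))
    (h : ∀ᶠ q in 𝓝 c, q ∈ X → f q = 0) {q : E} (hq : q ∈ Metric.ball c r) (hqX : q ∈ X) :
    f q = 0 := by
  obtain ⟨p, hp⟩ := hfa c (Metric.mem_ball_self hr)
  exact hS.eq_zero hp hfa (fun k v hv => hS.coeff_eq_zero hp h k hv) hq hqX

/-- The forms vanishing on the cone `S` form a prime ideal. -/
def IsPrimeCone (𝕜 : Type*) [RCLike 𝕜] {E : Type*} [NormedAddCommGroup E] [NormedSpace 𝕜 E]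
    (S : Set E) : Prop :=
  ∀ (i j : ℕ) (p : E [×i]→L[𝕜] 𝕜) (q : E [×j]→L[𝕜] 𝕜),
    (∀ v ∈ S, p (fun _ => v) * q (fun _ => v) = 0) →
      (∀ v ∈ S, p (fun _ => v) = 0) ∨ ∀ v ∈ S, q (fun _ => v) = 0

/-- If some equation `f` of `B` is not zero on `X`, one of its homogeneous terms is nonzero on `S`.
On each line in the cone, `f` or a given equation `g` of `C` vanishes at parameters accumulating at
0, so the product of any terms of `f` and `g` vanishes on `S`. Primality then kills every term of
`g`. -/
theorem IsConeAt.subset_or_subset {S X : Set E} {c : E} (hS : IsConeAt 𝕜 S X c)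
    (hP : IsPrimeCone 𝕜 S) {B C : Set E} (hB : IsSubvarietyGerm 𝕜 B c)
    (hC : IsSubvarietyGerm 𝕜 C c) (h : X ≤ᶠ[𝓝 c] (B ∪ C : Set E)) :
    X ≤ᶠ[𝓝 c] B ∨ X ≤ᶠ[𝓝 c] C := by
  obtain ⟨r, hr, F, hF, hBF⟩ := hB.exists_ball
  obtain ⟨s, hs, G, hG, hCG⟩ := hC.exists_ball
  by_cases hall : ∀ f ∈ F, ∀ᶠ q in 𝓝 c, q ∈ X → f q = 0
  · left
    filter_upwards [Metric.ball_mem_nhds c hr] with q hq hqX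
    exact (hBF q hq).2 fun f hf => hS.eq_zero_on_ball hr (hF f hf) (hall f hf) hq hqX
  right
  push Not at hall
  obtain ⟨f, hf, hfX⟩ := hall
  obtain ⟨p, hp⟩ := hF f hf c (Metric.mem_ball_self hr)
  obtain ⟨k, v, hv, hkv⟩ : ∃ k, ∃ v ∈ S, p k (fun _ => v) ≠ 0 := by
    by_contra! hc
    refine hfX ?_
    filter_upwards [Metric.ball_mem_nhds c hr] with q hq
    exact fun h => h.2 (hS.eq_zero hp (hF f hf) hc hq h.1)
  filter_upwards [Metric.ball_mem_nhds c hs] with q hq hqX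
  refine (hCG q hq).2 fun g hg => ?_
  obtain ⟨p', hp'⟩ := hG g hg c (Metric.mem_ball_self hs)
  refine hS.eq_zero hp' (hG g hg) (fun j => ?_) hq hqX
  refine (hP k j (p k) (p' j) fun u hu => ?_).resolve_left fun h => hkv (h v hv)
  have ht := (tendsto_line (𝕜 := 𝕜) c u).mono_left (nhdsWithin_le_nhds : 𝓝[≠] (0 : ℝ) ≤ 𝓝 0)
  have h1 : ∀ᶠ t : ℝ in 𝓝[≠] (0 : ℝ), f (c + (t : 𝕜) • u) = 0 ∨ g (c + (t : 𝕜) • u) = 0 := by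
    filter_upwards [ht.eventually h, ht.eventually (Metric.ball_mem_nhds c hr),
      ht.eventually (Metric.ball_mem_nhds c hs)] with t h2 h3 h4
    exact (h2 ((hS.add_mem_iff _).2 (hS.smul_mem u hu t))).imp
      (fun h5 => (hBF _ h3).1 h5 f hf) fun h5 => (hCG _ h4).1 h5 g hg
  rcases frequently_or_distrib.1 h1.frequently with h2 | h2
  · rw [coeff_eq_zero_of_frequently hp u h2, zero_mul]
  · rw [coeff_eq_zero_of_frequently hp' u h2, mul_zero]

theorem IsConeAt.isIrreducibleGerm {S X : Set E} {c : E} (hS : IsConeAt 𝕜 S X c)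
    (hP : IsPrimeCone 𝕜 S) (hX : IsSubvarietyGerm 𝕜 X c) (hc : c ∈ X) :
    IsIrreducibleGerm 𝕜 X c := by
  refine ⟨hX, hc, fun B C hB hC h => ?_⟩
  refine (hS.subset_or_subset hP hB hC h.le).imp (fun h1 => h1.antisymm ?_)
    fun h1 => h1.antisymm ?_
  · have h2 : B ≤ᶠ[𝓝 c] (B ∪ C : Set E) := Eventually.of_forall fun q hq => Or.inl hq
    exact h2.trans h.symm.le
  · have h2 : C ≤ᶠ[𝓝 c] (B ∪ C : Set E) := Eventually.of_forall fun q hq => Or.inr hq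
    exact h2.trans h.symm.le

/-- A subvariety of the whole space containing the germ of a cone contains the cone. -/
theorem IsConeAt.subset_of_germ {S X : Set E} {c : E} (hS : IsConeAt 𝕜 S X c) {B : Set E}
    (hB : IsSubvariety 𝕜 univ B) (h : X ≤ᶠ[𝓝 c] B) : X ⊆ B := by
  intro q hqX
  obtain ⟨v, rfl⟩ : ∃ v, q = c + v := ⟨q - c, by abel⟩
  have hv := (hS.add_mem_iff v).1 hqX
  set γ : ℝ → E := fun t => c + (t : 𝕜) • v with hγ
  have hγc : Continuous γ := continuous_const.add (RCLike.continuous_ofReal.smul continuous_const)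
  -- Continuity method along the line: the parameters near which `X` lies in `B` form a clopen set
  -- containing 0.
  set I : Set ℝ := {t | ∀ᶠ q in 𝓝 (γ t), q ∈ X → q ∈ B} with hI
  have hopen : IsOpen I := by
    rw [isOpen_iff_mem_nhds]
    intro t ht
    exact (hγc.tendsto t).eventually (eventually_eventually_nhds.2 ht)
  have h0 : (0 : ℝ) ∈ I := by
    have : γ 0 = c := by simp [hγ]
    change ∀ᶠ q in 𝓝 (γ 0), q ∈ X → q ∈ B
    rwa [this]
  have hclosed : IsClosed I := by
    refine isClosed_of_closure_subset fun t ht => ?_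
    by_cases ht0 : t = 0
    · rwa [ht0]
    have hBg : IsSubvarietyGerm 𝕜 B (γ t) := ⟨univ, mem_univ _, by rwa [inter_univ]⟩
    obtain ⟨r, hr, F, hF, hBF⟩ := hBg.exists_ball
    set w : E := (t : 𝕜) • v with hw
    obtain ⟨ρ, hρ, hρr⟩ : ∃ ρ > 0, ρ * (‖w‖ + 1) < r / 2 := by
      refine ⟨r / 4 / (‖w‖ + 1), by positivity, ?_⟩
      rw [div_mul_cancel₀ _ (by positivity)]
      linarith
    obtain ⟨t₁, ht₁I, ht₁⟩ := Metric.mem_closure_iff.1 ht (ρ * |t|)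
      (mul_pos hρ (abs_pos.2 ht0))
    have hratio : ‖(((t₁ / t : ℝ) : 𝕜)) - 1‖ < ρ := by
      have h1 : (((t₁ / t : ℝ) : 𝕜)) - 1 = (((t₁ - t) / t : ℝ) : 𝕜) := by
        rw [sub_div, div_self ht0]
        push_cast
        rfl
      rw [h1, RCLike.norm_ofReal, abs_div, div_lt_iff₀ (abs_pos.2 ht0), abs_sub_comm]
      exact ht₁
    obtain ⟨O, hO, hOo, hOt⟩ := eventually_nhds_iff.1 ht₁I
    have hnear : ∀ᶠ u in 𝓝 w, c + (((t₁ / t : ℝ) : 𝕜)) • u ∈ O := by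
      have h1 : Continuous fun u : E => c + (((t₁ / t : ℝ) : 𝕜)) • u := by fun_prop
      refine h1.continuousAt.eventually_mem (hOo.mem_nhds ?_)
      rw [hw, smul_smul, ← RCLike.ofReal_mul, div_mul_cancel₀ _ ht0]
      exact hOt
    have hsub : Tendsto (fun q => q - c) (𝓝 (γ t)) (𝓝 w) := by
      have : Continuous fun q : E => q - c := by fun_prop
      simpa [hγ, hw] using this.tendsto (γ t)
    have hsmall : ∀ᶠ u in 𝓝 w, ‖u - w‖ < min 1 (r / 2) := by
      have : Metric.ball w (min 1 (r / 2)) ∈ 𝓝 w := Metric.ball_mem_nhds _ (by positivity)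
      filter_upwards [this] with u hu
      rwa [← mem_ball_iff_norm]
    filter_upwards [hsub.eventually hnear, hsub.eventually hsmall] with q hqO hqs hqX
    set u := q - c with hu
    have hqu : q = c + u := by rw [hu]; abel
    have huS : u ∈ S := by rwa [← hS.add_mem_iff, ← hqu]
    have hdom : ∀ s ∈ Metric.ball (1 : 𝕜) ρ, c + s • u ∈ Metric.ball (γ t) r := by
      intro s hs
      rw [mem_ball_iff_norm] at hs ⊢
      have h1 : c + s • u - γ t = (s - 1) • u + (u - w) := by
        simp only [hγ, hw, sub_smul, one_smul]
        abel
      have h2 : ‖u‖ ≤ ‖w‖ + 1 := by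
        have h3 : u = w + (u - w) := by abel
        calc ‖u‖ = ‖w + (u - w)‖ := by rw [← h3]
          _ ≤ ‖w‖ + ‖u - w‖ := norm_add_le _ _
          _ ≤ ‖w‖ + 1 := by linarith [hqs.trans_le (min_le_left _ _)]
      calc ‖c + s • u - γ t‖ ≤ ‖s - 1‖ * ‖u‖ + ‖u - w‖ := by
            rw [h1, ← norm_smul]
            exact norm_add_le _ _
        _ ≤ ρ * (‖w‖ + 1) + ‖u - w‖ := by gcongr
        _ < r := by linarith [hqs.trans_le (min_le_right _ _)]
    have hone : (1 : 𝕜) ∈ Metric.ball (1 : 𝕜) ρ := Metric.mem_ball_self hρ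
    have hqball : q ∈ Metric.ball (γ t) r := by simpa [← hqu] using hdom 1 hone
    refine (hBF q hqball).2 fun f hf => ?_
    -- Rescaling `q` about the vertex by `t₁ / t` moves it to where `X ⊆ B` is known; the identity
    -- theorem in the scale carries the vanishing of `f` back to scale 1.
    have han : AnalyticOnNhd 𝕜 (fun s : 𝕜 => f (c + s • u)) (Metric.ball 1 ρ) := by
      intro s hs
      have h1 : AnalyticAt 𝕜 (fun s : 𝕜 => c + s • u) s := by fun_prop
      exact AnalyticAt.comp (g := f) (f := fun s : 𝕜 => c + s • u) (hF f hf _ (hdom s hs)) h1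
    have hmem : (((t₁ / t : ℝ) : 𝕜)) ∈ Metric.ball (1 : 𝕜) ρ := by rwa [mem_ball_iff_norm]
    have hfreq : ∃ᶠ s in 𝓝[≠] (((t₁ / t : ℝ) : 𝕜)), f (c + s • u) = 0 := by
      refine frequently_ofReal (P := fun s : 𝕜 => f (c + s • u) = 0) (Eventually.frequently ?_)
      have h1 : Continuous fun s : ℝ => c + (s : 𝕜) • u :=
        continuous_const.add (RCLike.continuous_ofReal.smul continuous_const)
      have h2 : ∀ᶠ s : ℝ in 𝓝 (t₁ / t), (s : 𝕜) ∈ Metric.ball (1 : 𝕜) ρ :=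
        RCLike.continuous_ofReal.continuousAt.eventually_mem (Metric.isOpen_ball.mem_nhds hmem)
      filter_upwards [nhdsWithin_le_nhds (h1.continuousAt.eventually_mem (hOo.mem_nhds hqO)),
        nhdsWithin_le_nhds h2] with s hs1 hs2
      exact (hBF _ (hdom _ hs2)).1
        (hO _ hs1 ((hS.add_mem_iff _).2 (hS.smul_mem u huS s))) f hf
    have := han.eqOn_zero_of_preconnected_of_frequently_eq_zero
      (convex_ball (1 : 𝕜) ρ).isPreconnected hmem hfreq hone
    simpa [← hqu] using this
  have huniv : I = univ := IsClopen.eq_univ ⟨hclosed, hopen⟩ ⟨0, h0⟩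
  have h1 : (1 : ℝ) ∈ I := huniv ▸ mem_univ 1
  have h2 := h1.self_of_nhds
  simp only [hγ, RCLike.ofReal_one, one_smul] at h2
  exact h2 hqX

end Cones

/-! ### The complexified cone and its generic points -/

section Complexified

open Complex Polynomial

/-- The complexification of `psi` as a polynomial function of `(p, p̄)`. -/
noncomputable def complexPsi (q : (Fin 3 → ℂ) × (Fin 3 → ℂ)) : ℂ :=
  (q.1 1 * q.2 1) ^ 2 * ((q.1 2 + q.2 2) / 2)
    + 4 * ((q.1 0 + q.2 0) / 2) * ((q.1 2 + q.2 2) / 2) ^ 2 * (q.1 1 * q.2 1)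
    + 4 * ((q.1 0 + q.2 0) / 2) ^ 3 * (q.1 0 * q.2 0)

/-- The complex hypersurface `{complexPsi = 0}`. -/
def complexHypersurface : Set ((Fin 3 → ℂ) × (Fin 3 → ℂ)) := {q | complexPsi q = 0}

theorem complexPsi_iota (p : Fin 3 → ℂ) : complexPsi (iota p) = psi p := by
  have h : ∀ z : ℂ, (z + star z) / 2 = (z.re : ℂ) := fun z => by
    rw [show star z = (starRingEnd ℂ) z from rfl, Complex.add_conj]
    push_cast
    ring
  rw [ofReal_psi]
  simp only [complexPsi, iota, Pi.star_apply, h]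
  ring

theorem complexPsi_smul (a : ℂ) (q : (Fin 3 → ℂ) × (Fin 3 → ℂ)) :
    complexPsi (a • q) = a ^ 5 * complexPsi q := by
  simp only [complexPsi, Prod.smul_fst, Prod.smul_snd, Pi.smul_apply, smul_eq_mul]
  ring

theorem analyticOnNhd_complexPsi (U : Set ((Fin 3 → ℂ) × (Fin 3 → ℂ))) :
    AnalyticOnNhd ℂ complexPsi U := by
  intro q _
  have h1 : ∀ i, AnalyticAt ℂ (fun q : (Fin 3 → ℂ) × (Fin 3 → ℂ) => q.1 i) q := fun i =>
    ((ContinuousLinearMap.proj i).comp (ContinuousLinearMap.fst ℂ (Fin 3 → ℂ) (Fin 3 → ℂ))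
      ).analyticAt q
  have h2 : ∀ i, AnalyticAt ℂ (fun q : (Fin 3 → ℂ) × (Fin 3 → ℂ) => q.2 i) q := fun i =>
    ((ContinuousLinearMap.proj i).comp (ContinuousLinearMap.snd ℂ (Fin 3 → ℂ) (Fin 3 → ℂ))
      ).analyticAt q
  have h3 := h1 0
  have h4 := h1 1
  have h5 := h1 2
  have h6 := h2 0
  have h7 := h2 1
  have h8 := h2 2
  unfold complexPsi
  fun_prop

/-- The point of the complexified space with the complexified real coordinates `x`, `y`, `s`, `t`
(so that `z = x + i y` and `ξ = s + i t`) and with `w`, `w̄` replaced by `w`, `w'`. -/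
noncomputable def ofCoords (x y w w' s t : ℂ) : (Fin 3 → ℂ) × (Fin 3 → ℂ) :=
  (![x + I * y, w, s + I * t], ![x - I * y, w', s - I * t])

theorem exists_ofCoords (q : (Fin 3 → ℂ) × (Fin 3 → ℂ)) :
    ∃ x y w w' s t, q = ofCoords x y w w' s t := by
  refine ⟨(q.1 0 + q.2 0) / 2, -I * (q.1 0 - q.2 0) / 2, q.1 1, q.2 1, (q.1 2 + q.2 2) / 2,
    -I * (q.1 2 - q.2 2) / 2, ?_⟩
  refine Prod.ext ?_ ?_ <;> ext i <;> fin_cases i <;> simp [ofCoords]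
  · linear_combination (q.1 0 - q.2 0) / 2 * I_sq
  · linear_combination (q.1 2 - q.2 2) / 2 * I_sq
  · linear_combination -(q.1 0 - q.2 0) / 2 * I_sq
  · linear_combination -(q.1 2 - q.2 2) / 2 * I_sq

/-- One quarter of `complexPsi` as a monic polynomial in `x`. -/
noncomputable def quintic (y W s : ℂ) : ℂ[X] :=
  X ^ 5 + (C (y ^ 2) * X ^ 3 + C (s ^ 2 * W) * X + C (s * W ^ 2 / 4))

theorem eval_quintic (x y W s : ℂ) : (quintic y W s).eval x
    = x ^ 5 + y ^ 2 * x ^ 3 + s ^ 2 * W * x + s * W ^ 2 / 4 := by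
  simp [quintic]
  ring

theorem complexPsi_ofCoords (x y w w' s t : ℂ) :
    complexPsi (ofCoords x y w w' s t) = 4 * (quintic y (w * w') s).eval x := by
  rw [eval_quintic]
  simp [complexPsi, ofCoords]
  linear_combination (-4 * x ^ 3 * y ^ 2) * I_sq

theorem degree_quintic_tail (y W s : ℂ) :
    (C (y ^ 2) * X ^ 3 + C (s ^ 2 * W) * X + C (s * W ^ 2 / 4)).degree < ((5 : ℕ) : WithBot ℕ) := by
  have : (C (y ^ 2) * X ^ 3 + C (s ^ 2 * W) * X + C (s * W ^ 2 / 4)).degree ≤ ((3 : ℕ) : WithBot ℕ) := by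
    compute_degree
    exact le_rfl
  exact this.trans_lt (by norm_num)

theorem monic_quintic (y W s : ℂ) : (quintic y W s).Monic :=
  monic_X_pow_add (degree_quintic_tail y W s)

theorem natDegree_quintic (y W s : ℂ) : (quintic y W s).natDegree = 5 := by
  unfold quintic
  compute_degree!

/-- `|p(x₀)|` is the product of the distances from `x₀` to the roots, hence at least a power of the
smallest one. This serves as continuity of roots. -/
theorem exists_root_near {p : ℂ[X]} (hp : p.Monic) (hd : 0 < p.natDegree) (x₀ : ℂ) :
    ∃ r, p.eval r = 0 ∧ ‖x₀ - r‖ ^ p.natDegree ≤ ‖p.eval x₀‖ := by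
  have hs := IsAlgClosed.splits p
  have hcard : p.roots.card = p.natDegree := hs.natDegree_eq_card_roots.symm
  have heval : p.eval x₀ = (p.roots.map fun r => x₀ - r).prod := by
    conv_lhs => rw [hs.eq_prod_roots_of_monic hp]
    rw [eval_multiset_prod]
    simp
  obtain ⟨r, hr, hmin⟩ : ∃ r ∈ p.roots, ∀ r' ∈ p.roots, ‖x₀ - r‖ ≤ ‖x₀ - r'‖ := by
    have hne : p.roots.toFinset.Nonempty := by
      rw [Multiset.toFinset_nonempty, ← Multiset.card_pos, hcard]
      exact hd
    obtain ⟨r, hr, h⟩ := p.roots.toFinset.exists_min_image (fun r => ‖x₀ - r‖) hne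
    exact ⟨r, by simpa using hr, fun r' hr' => h r' (Multiset.mem_toFinset.2 hr')⟩
  refine ⟨r, (mem_roots'.1 hr).2, ?_⟩
  rw [heval, ← hcard]
  have key : ∀ m : Multiset ℂ, (∀ r' ∈ m, ‖x₀ - r‖ ≤ ‖x₀ - r'‖) →
      ‖x₀ - r‖ ^ m.card ≤ ‖(m.map fun r => x₀ - r).prod‖ := by
    intro m
    induction m using Multiset.induction with
    | empty => simp
    | cons a m ih =>
      intro h
      rw [Multiset.card_cons, Multiset.map_cons, Multiset.prod_cons, norm_mul, pow_succ']
      exact mul_le_mul (h a (Multiset.mem_cons_self a m))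
        (ih fun r' hr' => h r' (Multiset.mem_cons_of_mem hr')) (by positivity) (norm_nonneg _)
  exact key _ hmin

/-- Each kind of bad root `x` satisfies a nonzero polynomial equation free of `y`, and a given `x ≠
0` is a root for at most two values of `y`. The condition `W³ = 64 x⁶` is the degenerate locus of
the parametrization. -/
theorem finite_bad {W s : ℂ} (hW : W ≠ 0) (hs : s ≠ 0) :
    {y : ℂ | ∃ x, (quintic y W s).eval x = 0 ∧
      (x = 0 ∨ W ^ 3 = 64 * x ^ 6 ∨ (derivative (quintic y W s)).eval x = 0)}.Finite := by
  have hder : ∀ x y, (derivative (quintic y W s)).eval x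
      = 5 * x ^ 4 + 3 * y ^ 2 * x ^ 2 + s ^ 2 * W := fun x y => by
    simp only [quintic, derivative_add, derivative_mul, derivative_C, derivative_X_pow,
      derivative_X, eval_add, eval_mul, eval_C, eval_pow, eval_X, eval_zero, eval_one]
    norm_num
    ring
  have hne : ∀ (n : ℕ) (a b c : ℂ), 1 < n → a ≠ 0 → C a * X ^ n + C b * X + C c ≠ 0 := by
    intro n a b c hn ha h
    have := congrArg (fun p => p.coeff n) h
    simp [coeff_X, coeff_C, hn.ne, (zero_lt_one.trans hn).ne'] at this
    exact ha this
  set P₁ : ℂ[X] := C 64 * X ^ 6 + C 0 * X + C (-W ^ 3) with hP₁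
  -- `P₂ = q - (x / 3) q'` for the quintic `q`: the combination that eliminates `y²`.
  set P₂ : ℂ[X] := C (-2 / 3) * X ^ 5 + C (2 / 3 * s ^ 2 * W) * X + C (s * W ^ 2 / 4) with hP₂
  have h1 : P₁ ≠ 0 := hne _ _ _ _ (by norm_num) (by norm_num)
  have h2 : P₂ ≠ 0 := hne _ _ _ _ (by norm_num) (by norm_num)
  have hfin : {x : ℂ | x ≠ 0 ∧ (P₁.IsRoot x ∨ P₂.IsRoot x)}.Finite :=
    ((finite_setOfPred_isRoot h1).union (finite_setOfPred_isRoot h2)).subset fun x hx => hx.2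
  refine (hfin.biUnion (t := fun x => {y : ℂ | (quintic y W s).eval x = 0}) fun x hx => ?_).subset ?_
  · set P₃ : ℂ[X] := C (x ^ 3) * X ^ 2 + C 0 * X + C (x ^ 5 + s ^ 2 * W * x + s * W ^ 2 / 4) with hP₃
    have h3 : P₃ ≠ 0 := hne _ _ _ _ (by norm_num) (pow_ne_zero 3 hx.1)
    refine (finite_setOfPred_isRoot h3).subset fun y hy => ?_
    rw [mem_ofPred_eq, eval_quintic] at hy
    simp only [hP₃, mem_ofPred_eq, IsRoot.def, eval_add, eval_mul, eval_C, eval_pow, eval_X]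
    linear_combination hy
  · rintro y ⟨x, hx, hbad⟩
    have hx0 : x ≠ 0 := by
      rintro rfl
      rw [eval_quintic] at hx
      simp [hs, hW] at hx
    simp only [mem_iUnion]
    refine ⟨x, ⟨hx0, ?_⟩, hx⟩
    rcases hbad with h | h | h
    · exact absurd h hx0
    · left
      simp only [hP₁, IsRoot.def, eval_add, eval_mul, eval_C, eval_pow, eval_X]
      linear_combination -h
    · right
      rw [hder] at h
      rw [eval_quintic] at hx
      simp only [hP₂, IsRoot.def, eval_add, eval_mul, eval_C, eval_pow, eval_X]
      linear_combination hx - x / 3 * h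

/-- Perturb `w`, `w'`, `s` to be nonzero, then `y` outside the finite bad set they determine, and
finally take for `x` the root nearest to the old one. -/
theorem exists_good_near {q : (Fin 3 → ℂ) × (Fin 3 → ℂ)} (hq : q ∈ complexHypersurface)
    {N : Set ((Fin 3 → ℂ) × (Fin 3 → ℂ))} (hN : N ∈ 𝓝 q) :
    ∃ x y w w' s t, ofCoords x y w w' s t ∈ N ∩ complexHypersurface ∧
      x ≠ 0 ∧ w ≠ 0 ∧ w' ≠ 0 ∧ (w * w') ^ 3 ≠ 64 * x ^ 6 := by
  obtain ⟨x₀, y₀, w₀, w₀', s₀, t₀, rfl⟩ := exists_ofCoords q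
  have hcont : Continuous fun a : ℂ × ℂ × ℂ × ℂ × ℂ =>
      ofCoords a.1 a.2.1 a.2.2.1 a.2.2.2.1 a.2.2.2.2 t₀ := by
    refine Continuous.prodMk (continuous_pi fun i => ?_) (continuous_pi fun i => ?_) <;>
      fin_cases i <;> simp <;> fun_prop
  obtain ⟨ε, hε, hεN⟩ := Metric.mem_nhds_iff.1
    (hcont.continuousAt.preimage_mem_nhds (x := (x₀, y₀, w₀, w₀', s₀)) hN)
  have hval : Continuous fun a : ℂ × ℂ × ℂ × ℂ =>
      ‖(quintic a.1 (a.2.1 * a.2.2.1) a.2.2.2).eval x₀‖ := by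
    simp only [eval_quintic]
    fun_prop
  have h0 : ‖(quintic y₀ (w₀ * w₀') s₀).eval x₀‖ < ε ^ 5 := by
    have : complexPsi (ofCoords x₀ y₀ w₀ w₀' s₀ t₀) = 0 := hq
    rw [complexPsi_ofCoords] at this
    have h1 := (mul_eq_zero.1 this).resolve_left (by norm_num)
    rw [h1, norm_zero]
    positivity
  obtain ⟨δ, hδ, hδv⟩ := Metric.eventually_nhds_iff_ball.1
    (hval.continuousAt.eventually_lt continuousAt_const
      (show (fun a : ℂ × ℂ × ℂ × ℂ =>
        ‖(quintic a.1 (a.2.1 * a.2.2.1) a.2.2.2).eval x₀‖) (y₀, w₀, w₀', s₀) < ε ^ 5 from h0))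
  have hdense : ∀ (T : Set ℂ), T.Finite → ∀ z₀ : ℂ, ∃ z, z ∉ T ∧ dist z z₀ < min ε δ :=
    fun T hT z₀ => by
      obtain ⟨z, hz, hzT⟩ := (hT.countable.dense_compl ℂ).inter_open_nonempty _
        (Metric.isOpen_ball (x := z₀) (ε := min ε δ)) ⟨z₀, Metric.mem_ball_self (lt_min hε hδ)⟩
      exact ⟨z, hzT, hz⟩
  obtain ⟨w, hw, hwd⟩ := hdense {0} (finite_singleton 0) w₀
  obtain ⟨w', hw', hwd'⟩ := hdense {0} (finite_singleton 0) w₀'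
  obtain ⟨s, hs, hsd⟩ := hdense {0} (finite_singleton 0) s₀
  rw [mem_singleton_iff] at hw hw' hs
  obtain ⟨y, hy, hyd⟩ := hdense _ (finite_bad (mul_ne_zero hw hw') hs) y₀
  rw [lt_min_iff] at hwd hwd' hsd hyd
  have hsmall := hδv (y, w, w', s) (by simp [Prod.dist_eq, hwd.2, hwd'.2, hsd.2, hyd.2])
  obtain ⟨x, hx, hxd⟩ := exists_root_near (monic_quintic y (w * w') s)
    (by rw [natDegree_quintic]; norm_num) x₀
  rw [natDegree_quintic] at hxd
  have hxε : dist x x₀ < ε := by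
    rw [dist_comm, dist_eq_norm]
    exact lt_of_pow_lt_pow_left₀ 5 hε.le (hxd.trans_lt hsmall)
  have hgood : ¬(x = 0 ∨ (w * w') ^ 3 = 64 * x ^ 6 ∨
      (derivative (quintic y (w * w') s)).eval x = 0) := fun h => hy ⟨x, hx, h⟩
  push Not at hgood
  refine ⟨x, y, w, w', s, t₀, ⟨?_, ?_⟩, hgood.1, hw, hw', hgood.2.1⟩
  · exact hεN (show (x, y, w, w', s) ∈ Metric.ball (x₀, y₀, w₀, w₀', s₀) ε by
      simp [Prod.dist_eq, hwd.1, hwd'.1, hsd.1, hyd.1, hxε])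
  · change complexPsi _ = 0
    rw [complexPsi_ofCoords, hx, mul_zero]

end Complexified

/-! ### Rational parametrization, primality, and density of the real points -/

section Parametrization

open Complex

/-- A polynomial map from `ℂ⁴` to the cone `complexHypersurface`, whose image contains all
generic points of the cone up to scaling. -/
noncomputable def param (v : ℂ × ℂ × ℂ × ℂ) : (Fin 3 → ℂ) × (Fin 3 → ℂ) :=
  (![2 * v.1 * v.2.1 * ((v.2.2.1 + 1) ^ 2 - v.1 ^ 6), 8 * v.1 ^ 2 * v.2.2.1,
      v.2.1 * ((v.2.2.1 - v.1 ^ 3) ^ 2 - 1) + 4 * v.1 * v.2.1 * v.2.2.1 * (I * v.2.2.2)],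
    ![-2 * v.1 * v.2.1 * ((v.2.2.1 - 1) ^ 2 - v.1 ^ 6), 8 * v.1 ^ 2 * v.2.2.1 * v.2.1 ^ 2,
      v.2.1 * ((v.2.2.1 - v.1 ^ 3) ^ 2 - 1) - 4 * v.1 * v.2.1 * v.2.2.1 * (I * v.2.2.2)])

theorem param_mem (v : ℂ × ℂ × ℂ × ℂ) : param v ∈ complexHypersurface := by
  change complexPsi (param v) = 0
  simp only [complexPsi, param, Matrix.cons_val_zero, Matrix.cons_val_one, Matrix.cons_val]
  ring

theorem analyticAt_param (v : ℂ × ℂ × ℂ × ℂ) : AnalyticAt ℂ param v := by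
  have h1 : AnalyticAt ℂ (fun v : ℂ × ℂ × ℂ × ℂ => v.1) v := analyticAt_fst
  have h2 : AnalyticAt ℂ (fun v : ℂ × ℂ × ℂ × ℂ => v.2.1) v := analyticAt_fst.comp analyticAt_snd
  have h3 : AnalyticAt ℂ (fun v : ℂ × ℂ × ℂ × ℂ => v.2.2.1) v :=
    analyticAt_fst.comp (analyticAt_snd.comp analyticAt_snd)
  have h4 : AnalyticAt ℂ (fun v : ℂ × ℂ × ℂ × ℂ => v.2.2.2) v :=
    analyticAt_snd.comp (analyticAt_snd.comp analyticAt_snd)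
  refine AnalyticAt.prod (analyticAt_pi_iff.2 fun i => ?_) (analyticAt_pi_iff.2 fun i => ?_) <;>
    fin_cases i <;> simp <;> fun_prop

/-- Put `ρ² = w w'`, `ρ = 2 x g`, and divide `y`, `s`, `t` by `x`. The equation becomes `(2gs + g³)²
+ y² = g⁶ - 1`, a conic over the `g`-line that factors as `m (2(2gs + g³) - m) = g⁶ - 1` with `m =
2gs + g³ + iy`. Solving for `s` and `y` in terms of `g` and `m`, with `ω = ρ / w` recording how `w
w'` splits, and clearing denominators gives `param`. -/
theorem param_eq_smul_ofCoords {x y w w' s t : ℂ} (hx : x ≠ 0) (hw : w ≠ 0) (hw' : w' ≠ 0)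
    (hW : (w * w') ^ 3 ≠ 64 * x ^ 6) (h : complexPsi (ofCoords x y w w' s t) = 0) :
    ∃ v, ∃ a : ℂ, a ≠ 0 ∧ param v = a • ofCoords x y w w' s t := by
  rw [complexPsi_ofCoords, eval_quintic] at h
  obtain ⟨ρ, hρ⟩ := IsAlgClosed.exists_pow_nat_eq (w * w') (n := 2) (by norm_num)
  have hρ0 : ρ ≠ 0 := by
    rintro rfl
    exact mul_ne_zero hw hw' (by rw [← hρ]; norm_num)
  obtain ⟨g, hρg⟩ : ∃ g, ρ = 2 * x * g := ⟨ρ / (2 * x), by field_simp⟩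
  obtain ⟨ω, hwω⟩ : ∃ ω, w * ω = ρ := ⟨ρ / w, by field_simp⟩
  obtain ⟨y, rfl⟩ : ∃ y', y = x * y' := ⟨y / x, by field_simp⟩
  obtain ⟨s, rfl⟩ : ∃ s', s = x * s' := ⟨s / x, by field_simp⟩
  obtain ⟨t, rfl⟩ : ∃ t', t = x * t' := ⟨t / x, by field_simp⟩
  have hg0 : g ≠ 0 := by
    rintro rfl
    exact hρ0 (by rw [hρg, mul_zero])
  have hω0 : ω ≠ 0 := by
    rintro rfl
    exact hρ0 (by rw [← hwω, mul_zero])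
  have hw'ω : w' = ρ * ω := by
    refine mul_left_cancel₀ hw ?_
    rw [← hρ]
    linear_combination (-ρ) * hwω
  have hcirc : (2 * g * s + g ^ 3) ^ 2 + y ^ 2 = g ^ 6 - 1 := by
    rw [← hρ, hρg] at h
    have h5 : x ^ 5 * ((2 * g * s + g ^ 3) ^ 2 + y ^ 2 - (g ^ 6 - 1)) = 0 := by
      linear_combination h / 4
    linear_combination (mul_eq_zero.1 h5).resolve_left (pow_ne_zero 5 hx)
  obtain ⟨m, hm⟩ : ∃ m, m = (2 * g * s + g ^ 3) + I * y := ⟨_, rfl⟩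
  have hm2 : g ^ 6 - 1 = m * (2 * (2 * g * s + g ^ 3) - m) := by
    rw [← hcirc, hm]
    linear_combination y ^ 2 * I_sq
  -- `m = 0` would give `g⁶ = 1`, that is `(w w')³ = 64 x⁶`, which `hW` excludes.
  have hm0 : m ≠ 0 := by
    intro h0
    apply hW
    rw [h0, zero_mul] at hm2
    rw [← hρ, hρg]
    linear_combination 64 * x ^ 6 * hm2
  obtain ⟨a, ha⟩ : ∃ a, a * x = 4 * g * ω * m := ⟨4 * g * ω * m / x, by field_simp⟩
  have ha0 : a ≠ 0 := by
    rintro rfl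
    rw [zero_mul] at ha
    exact mul_ne_zero (mul_ne_zero (mul_ne_zero (by norm_num) hg0) hω0) hm0 ha.symm
  refine ⟨(g, ω, m, t), a, ha0, ?_⟩
  refine Prod.ext ?_ ?_ <;> ext i <;> fin_cases i <;> simp [param, ofCoords]
  · linear_combination (-2 * g * ω) * hm2 + 4 * g * ω * m * hm - (1 + I * y) * ha
  · refine mul_right_cancel₀ hω0 ?_
    linear_combination -2 * g * ha - a * hwω - a * hρg
  · linear_combination ω * hm2 - (s + I * t) * ha
  · linear_combination (2 * g * ω) * hm2 - 4 * g * ω * m * hm - (1 - I * y) * ha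
  · rw [hw'ω, hρg]
    linear_combination -2 * g * ω * ha
  · linear_combination ω * hm2 - (s - I * t) * ha

theorem eq_zero_of_param {P : (Fin 3 → ℂ) × (Fin 3 → ℂ) → ℂ} (hP : AnalyticOnNhd ℂ P univ) {k : ℕ}
    (hk : ∀ (a : ℂ) v, P (a • v) = a ^ k * P v) (h : ∀ v, P (param v) = 0)
    {q : (Fin 3 → ℂ) × (Fin 3 → ℂ)} (hq : q ∈ complexHypersurface) : P q = 0 := by
  by_contra hne
  obtain ⟨x, y, w, w', s, t, ⟨hN, hA⟩, hx, hw, hw', hW⟩ :=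
    exists_good_near hq ((hP q (mem_univ q)).continuousAt.eventually_ne hne)
  obtain ⟨v, a, ha, hv⟩ := param_eq_smul_ofCoords hx hw hw' hW hA
  have := h v
  rw [hv, hk] at this
  exact hN ((mul_eq_zero.1 this).resolve_left (pow_ne_zero k ha))

theorem analyticOnNhd_diag {𝕜 E : Type*} [NontriviallyNormedField 𝕜] [NormedAddCommGroup E]
    [NormedSpace 𝕜 E] {k : ℕ} (p : E [×k]→L[𝕜] 𝕜) :
    AnalyticOnNhd 𝕜 (fun v => p (fun _ => v)) univ := fun _ _ =>
  (p.analyticAt).fun_comp (g := p) (f := fun v (_ : Fin k) => v) (analyticAt_pi_iff.2 fun _ => analyticAt_id)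

theorem map_smul_diag {𝕜 E : Type*} [NontriviallyNormedField 𝕜] [NormedAddCommGroup E]
    [NormedSpace 𝕜 E] {k : ℕ} (p : E [×k]→L[𝕜] 𝕜) (a : 𝕜) (v : E) :
    p (fun _ => a • v) = a ^ k * p (fun _ => v) := by
  simpa using p.map_smul_univ (fun _ => a) (fun _ => v)

/-- Both forms pull back under `param` to analytic functions on the connected space ℂ⁴, where a zero
product forces a zero factor. -/
theorem isPrimeCone_complexHypersurface : IsPrimeCone ℂ complexHypersurface := by
  intro i j p q h
  have hp : AnalyticOnNhd ℂ (fun v => p (fun _ => param v)) univ := fun v _ =>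
    (analyticOnNhd_diag p _ (mem_univ _)).fun_comp (g := fun v => p fun _ => v) (analyticAt_param v)
  have hq : AnalyticOnNhd ℂ (fun v => q (fun _ => param v)) univ := fun v _ =>
    (analyticOnNhd_diag q _ (mem_univ _)).fun_comp (g := fun v => q fun _ => v) (analyticAt_param v)
  by_cases h0 : ∀ v, p (fun _ => param v) = 0
  · exact Or.inl fun v hv => eq_zero_of_param
      (analyticOnNhd_diag p) (map_smul_diag p) h0 hv
  · push Not at h0
    obtain ⟨v₀, hv₀⟩ := h0
    have h1 : (fun v => q (fun _ => param v)) =ᶠ[𝓝 v₀] fun _ => 0 := by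
      filter_upwards [(hp v₀ (mem_univ _)).continuousAt.eventually_ne hv₀] with v hv
      exact (mul_eq_zero.1 (h _ (param_mem v))).resolve_left hv
    have h2 := hq.eq_of_eventuallyEq (fun v _ => analyticAt_const) h1
    exact Or.inr fun v hv => eq_zero_of_param
      (analyticOnNhd_diag q) (map_smul_diag q) (congrFun h2) hv

/-- A circle accumulates at its positive real point, so vanishing on it is enough for the
one-variable identity theorem. -/
theorem frequently_norm_eq {r : ℝ} (hr : 0 < r) : ∃ᶠ z in 𝓝[≠] (r : ℂ), ‖z‖ = r := by
  have hd : HasDerivAt (fun θ : ℝ => (r : ℂ) * exp (θ * I)) (r * I) 0 := by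
    have h1 : HasDerivAt (fun θ : ℂ => (r : ℂ) * exp (θ * I)) (r * I) ((0 : ℝ) : ℂ) := by
      have := (((hasDerivAt_id ((0 : ℝ) : ℂ)).mul_const I).cexp).const_mul (r : ℂ)
      simpa using this
    exact h1.comp_ofReal
  have ht : Tendsto (fun θ : ℝ => (r : ℂ) * exp (θ * I)) (𝓝[≠] 0) (𝓝[≠] (r : ℂ)) := by
    refine tendsto_nhdsWithin_iff.2 ⟨?_, ?_⟩
    · have := hd.continuousAt.tendsto
      simp only [ofReal_zero, zero_mul, exp_zero, mul_one] at this
      exact this.mono_left nhdsWithin_le_nhds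
    · exact hd.eventually_ne (by simp [hr.ne'])
  refine ht.frequently (Eventually.frequently (Eventually.of_forall fun θ => ?_))
  rw [norm_mul, norm_exp_ofReal_mul_I, mul_one, norm_real, Real.norm_of_nonneg hr.le]

theorem eq_zero_of_frequently {f : ℂ → ℂ} (hf : ∀ z, AnalyticAt ℂ f z) {a : ℂ}
    (h : ∃ᶠ z in 𝓝[≠] a, f z = 0) (z : ℂ) : f z = 0 :=
  congrFun (AnalyticOnNhd.eq_of_frequently_eq (g := fun _ => 0) (fun z _ => hf z)
    (fun _ _ => analyticAt_const) h) z

/-- For real `g > 1`, `|ω| = 1`, `|m|² = g⁶ - 1` and real `t`, the point `param (g, ω, m, t)` is a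
scalar multiple of `iota r` with `r` in X. The identity theorem, one variable at a time, spreads the
vanishing of `P ∘ param` to ℂ⁴. The radius for `m` depends on `g`, so `g` is fixed first. -/
theorem eq_zero_of_real_vanishing {P : (Fin 3 → ℂ) × (Fin 3 → ℂ) → ℂ}
    (hP : AnalyticOnNhd ℂ P univ) {k : ℕ}
    (hk : ∀ (a : ℂ) v, P (a • v) = a ^ k * P v) (h : ∀ p ∈ hypersurface, P (iota p) = 0)
    {q : (Fin 3 → ℂ) × (Fin 3 → ℂ)} (hq : q ∈ complexHypersurface) : P q = 0 := by
  refine eq_zero_of_param hP hk (fun v => ?_) hq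
  have han : ∀ v, AnalyticAt ℂ (fun v => P (param v)) v := fun v =>
    (hP _ (mem_univ _)).fun_comp (g := P) (analyticAt_param v)
  obtain ⟨g, ω, m, t⟩ := v
  revert g
  refine eq_zero_of_frequently (a := ((2 : ℝ) : ℂ)) (fun g => ?_) ?_
  · exact (han _).fun_comp (f := fun g => (g, ω, m, t)) (by fun_prop)
  refine frequently_ofReal (P := fun g : ℂ => P (param (g, ω, m, t)) = 0)
    (Eventually.frequently ?_)
  filter_upwards [nhdsWithin_le_nhds (lt_mem_nhds (show (1 : ℝ) < 2 by norm_num))] with g hg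
  change P (param ((g : ℂ), ω, m, t)) = 0
  revert ω
  refine eq_zero_of_frequently (a := ((1 : ℝ) : ℂ)) (fun ω => ?_) ?_
  · exact (han _).fun_comp (f := fun ω => ((g : ℂ), ω, m, t)) (by fun_prop)
  refine (frequently_norm_eq one_pos).mono fun ω hω => ?_
  have hg6 : 1 < g ^ 6 := one_lt_pow₀ hg (by norm_num)
  have hδ : 0 < Real.sqrt (g ^ 6 - 1) := Real.sqrt_pos.2 (by linarith)
  revert m
  refine eq_zero_of_frequently (a := ((Real.sqrt (g ^ 6 - 1) : ℝ) : ℂ)) (fun m => ?_) ?_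
  · exact (han _).fun_comp (f := fun m => ((g : ℂ), ω, m, t)) (by fun_prop)
  refine (frequently_norm_eq hδ).mono fun m hm => ?_
  revert t
  refine eq_zero_of_frequently (a := ((0 : ℝ) : ℂ)) (fun t => ?_) ?_
  · exact (han _).fun_comp (f := fun t => ((g : ℂ), ω, m, t)) (by fun_prop)
  refine frequently_ofReal (P := fun t : ℂ => P (param (g, ω, m, t)) = 0)
    (Eventually.frequently (Eventually.of_forall fun t => ?_))
  change P (param ((g : ℂ), ω, m, (t : ℂ))) = 0
  have hω2 : ω * star ω = 1 := by
    change ω * (starRingEnd ℂ) ω = 1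
    rw [mul_conj, normSq_eq_norm_sq, hω]
    norm_num
  have hm2 : m.re ^ 2 + m.im ^ 2 = g ^ 6 - 1 := by
    have h1 : ‖m‖ ^ 2 = g ^ 6 - 1 := by rw [hm, Real.sq_sqrt (by linarith)]
    rw [← h1, ← normSq_eq_norm_sq, normSq_apply]
    ring
  have hg0 : g ≠ 0 := by linarith
  -- The point `r` is normalized by `Re z = 1`; `σ` is its `Re ξ`, determined by `Re m = 2gσ + g³`.
  obtain ⟨σ, hσ⟩ : ∃ σ, 2 * g * σ = m.re - g ^ 3 := ⟨(m.re - g ^ 3) / (2 * g), by field_simp⟩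
  set r : Fin 3 → ℂ := ![1 + I * m.im, 2 * g * star ω, σ + I * t]
    with hr
  have hrX : r ∈ hypersurface := by
    have h1 : normSq (star ω) = 1 := by
      rw [show star ω = (starRingEnd ℂ) ω from rfl, normSq_conj, normSq_eq_norm_sq, hω]
      norm_num
    have h2 : normSq (2 * g : ℂ) = 4 * g ^ 2 := by
      rw [map_mul, normSq_ofReal, show normSq 2 = 4 by norm_num [normSq_apply]]
      ring
    have h3 : normSq (1 + I * m.im) = 1 + m.im ^ 2 := by
      rw [normSq_apply]
      simp
      ring
    change psi r = 0
    simp only [psi, hr, Matrix.cons_val_zero, Matrix.cons_val_one, Matrix.cons_val, map_mul, h1, h3]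
    rw [← map_mul, h2]
    simp
    linear_combination 4 * hm2 + 4 * (2 * g * σ + m.re + g ^ 3) * hσ
  have hgC : (g : ℂ) ≠ 0 := by exact_mod_cast hg0
  have hmI : m = m.re + m.im * I := (re_add_im m).symm
  have hσ' : 2 * (g : ℂ) * σ = m.re - (g : ℂ) ^ 3 := by exact_mod_cast hσ
  have hm2' : (m.re : ℂ) ^ 2 + (m.im : ℂ) ^ 2 = (g : ℂ) ^ 6 - 1 := by exact_mod_cast hm2
  have key : param (g, ω, m, t) = (4 * g * ω * m) • iota r := by
    have h4 : m * (m - 2 * I * m.im) = (g : ℂ) ^ 6 - 1 := by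
      rw [← hm2']
      generalize m.re = a at *
      generalize m.im = b at *
      rw [hmI]
      linear_combination (-(b : ℂ) ^ 2) * I_sq
    have hω2' : ω * (starRingEnd ℂ) ω = 1 := hω2
    refine Prod.ext ?_ ?_ <;> ext i <;> fin_cases i <;> simp [param, iota, hr, conj_ofReal]
    · linear_combination 2 * g * ω * h4
    · linear_combination -8 * (g : ℂ) ^ 2 * m * hω2'
    · linear_combination -ω * h4 - 2 * ω * m * hσ' + 2 * ω * m * hmI
    · linear_combination -2 * g * ω * h4
    · ring
    · linear_combination -ω * h4 - 2 * ω * m * hσ' + 2 * ω * m * hmI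
  rw [key, hk, h r hrX, mul_zero]

end Parametrization

/-! ### The complexification of X at the vertices and on the whole space -/

section Complexification

theorem psi_smul (a : ℝ) (p : Fin 3 → ℂ) : psi (a • p) = a ^ 5 * psi p := by
  simp only [psi, Pi.smul_apply, Complex.real_smul, Complex.normSq_mul, Complex.normSq_ofReal,
    Complex.re_ofReal_mul]
  ring

theorem psi_add_of_axis {c : Fin 3 → ℂ} (h0 : c 0 = 0) (h1 : c 1 = 0) (h2 : (c 2).re = 0)
    (v : Fin 3 → ℂ) : psi (c + v) = psi v := by
  simp [psi, h0, h1, h2]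

theorem complexPsi_add_of_axis {c : Fin 3 → ℂ} (h0 : c 0 = 0) (h1 : c 1 = 0) (h2 : (c 2).re = 0)
    (v : (Fin 3 → ℂ) × (Fin 3 → ℂ)) : complexPsi (iota c + v) = complexPsi v := by
  have h3 : c 2 + (starRingEnd ℂ) (c 2) = 0 := by rw [Complex.add_conj, h2]; simp
  have h4 : c 2 + v.1 2 + ((starRingEnd ℂ) (c 2) + v.2 2) = v.1 2 + v.2 2 := by
    linear_combination h3
  simp [complexPsi, iota, h0, h1, h4]

theorem isConeAt_hypersurface {c : Fin 3 → ℂ} (h0 : c 0 = 0) (h1 : c 1 = 0) (h2 : (c 2).re = 0) :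
    IsConeAt ℝ hypersurface hypersurface c where
  smul_mem v hv t := by
    have hv' : psi v = 0 := hv
    change psi (t • v) = 0
    rw [psi_smul, hv', mul_zero]
  add_mem_iff v := by
    change psi (c + v) = 0 ↔ psi v = 0
    rw [psi_add_of_axis h0 h1 h2]

theorem isConeAt_complexHypersurface {c : Fin 3 → ℂ} (h0 : c 0 = 0) (h1 : c 1 = 0)
    (h2 : (c 2).re = 0) : IsConeAt ℂ complexHypersurface complexHypersurface (iota c) where
  smul_mem v hv t := by
    have hv' : complexPsi v = 0 := hv
    change complexPsi ((t : ℂ) • v) = 0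
    rw [complexPsi_smul, hv', mul_zero]
  add_mem_iff v := by
    change complexPsi (iota c + v) = 0 ↔ complexPsi v = 0
    rw [complexPsi_add_of_axis h0 h1 h2]

theorem isSubvariety_zero_set {𝕜 E : Type*} [NontriviallyNormedField 𝕜] [NormedAddCommGroup E]
    [NormedSpace 𝕜 E] {U : Set E} (hU : IsOpen U) {f : E → 𝕜} (hf : AnalyticOnNhd 𝕜 f U) :
    IsSubvariety 𝕜 U ({q | f q = 0} ∩ U) :=
  ⟨hU, inter_subset_right, fun p hp => ⟨U, hU, hp, Subset.rfl, {f}, by simpa using hf, by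
    ext q
    simp [and_comm]⟩⟩

theorem isSubvarietyGerm_zero_set {𝕜 E : Type*} [NontriviallyNormedField 𝕜] [NormedAddCommGroup E]
    [NormedSpace 𝕜 E] {f : E → 𝕜} {U : Set E} (hU : IsOpen U) (hf : AnalyticOnNhd 𝕜 f U) {p : E}
    (hp : p ∈ U) : IsSubvarietyGerm 𝕜 {q | f q = 0} p :=
  ⟨U, hp, isSubvariety_zero_set hU hf⟩

theorem iota_mem_complexHypersurface {p : Fin 3 → ℂ} :
    iota p ∈ complexHypersurface ↔ p ∈ hypersurface := by
  change complexPsi (iota p) = 0 ↔ psi p = 0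
  rw [complexPsi_iota, Complex.ofReal_eq_zero]

theorem iota_image_subset : iota '' hypersurface ⊆ complexHypersurface :=
  image_subset_iff.2 fun _ hp => iota_mem_complexHypersurface.2 hp

theorem isOpen_doubled {n : ℕ} {U : Set (Fin n → ℂ)} (hU : IsOpen U) : IsOpen (doubled U) :=
  hU.prod (hU.preimage continuous_star)

theorem doubled_univ {n : ℕ} : doubled (univ : Set (Fin n → ℂ)) = univ := by
  simp [doubled]

theorem continuous_iota {n : ℕ} : Continuous (iota (n := n)) :=
  continuous_id.prodMk continuous_star

theorem complexification_subset {U : Set (Fin 3 → ℂ)} (hU : IsOpen U) :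
    complexification U (hypersurface ∩ U) ⊆ complexHypersurface ∩ doubled U := by
  refine sInter_subset_of_mem ⟨isSubvariety_zero_set (isOpen_doubled hU)
    (analyticOnNhd_complexPsi _), ?_⟩
  rintro _ ⟨p, hp, rfl⟩
  refine ⟨iota_mem_complexHypersurface.2 hp.1, hp.2, ?_⟩
  change star (star p) ∈ U
  rw [star_star]
  exact hp.2

/-- Lines through `c` in X show that each homogeneous term of `f` vanishes on `iota ''
hypersurface`, hence on the whole complex cone; the cone argument then returns to `f` on the ball.
-/
theorem eq_zero_of_iota_vanishing {c : Fin 3 → ℂ} (h0 : c 0 = 0) (h1 : c 1 = 0)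
    (h2 : (c 2).re = 0) {f : (Fin 3 → ℂ) × (Fin 3 → ℂ) → ℂ} {r : ℝ} (hr : 0 < r)
    (hf : AnalyticOnNhd ℂ f (Metric.ball (iota c) r))
    (h : ∀ᶠ q in 𝓝 (iota c), q ∈ iota '' hypersurface → f q = 0)
    {q : (Fin 3 → ℂ) × (Fin 3 → ℂ)} (hq : q ∈ Metric.ball (iota c) r)
    (hqA : q ∈ complexHypersurface) : f q = 0 := by
  obtain ⟨p, hp⟩ := hf _ (Metric.mem_ball_self hr)
  refine (isConeAt_complexHypersurface h0 h1 h2).eq_zero hp hf (fun k v hv => ?_) hq hqA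
  refine eq_zero_of_real_vanishing (analyticOnNhd_diag (p k)) (map_smul_diag (p k))
    (fun u hu => ?_) hv
  refine coeff_eq_zero_of_frequently hp _ (Eventually.frequently ?_) k
  have ht := (tendsto_line (𝕜 := ℂ) (iota c) (iota u)).mono_left
    (nhdsWithin_le_nhds : 𝓝[≠] (0 : ℝ) ≤ 𝓝 0)
  filter_upwards [ht.eventually h] with t h3
  refine h3 ⟨c + t • u, ?_, ?_⟩
  · have := isConeAt_hypersurface h0 h1 h2
    exact (this.add_mem_iff _).2 (this.smul_mem u hu t)
  · refine Prod.ext ?_ ?_ <;> ext i <;> simp [iota]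

theorem subset_of_germ_iota {c : Fin 3 → ℂ} (h0 : c 0 = 0) (h1 : c 1 = 0)
    (h2 : (c 2).re = 0) {B : Set ((Fin 3 → ℂ) × (Fin 3 → ℂ))}
    (hB : IsSubvarietyGerm ℂ B (iota c)) (h : iota '' hypersurface ≤ᶠ[𝓝 (iota c)] B) :
    complexHypersurface ≤ᶠ[𝓝 (iota c)] B := by
  obtain ⟨r, hr, F, hF, hBF⟩ := hB.exists_ball
  filter_upwards [Metric.ball_mem_nhds _ hr] with q hq hqA
  refine (hBF q hq).2 fun f hf => eq_zero_of_iota_vanishing h0 h1 h2 hr (hF f hf) ?_ hq hqA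
  filter_upwards [h, Metric.ball_mem_nhds _ hr] with q' h3 h4 h5
  exact (hBF q' h4).1 (h3 h5) f hf

theorem iota_image_inter_eventuallyEq {U : Set (Fin 3 → ℂ)} {c : Fin 3 → ℂ} (hU : U ∈ 𝓝 c)
    (X : Set (Fin 3 → ℂ)) : (iota '' (X ∩ U) : Set _) =ᶠ[𝓝 (iota c)] (iota '' X : Set _) := by
  have : ∀ᶠ q : (Fin 3 → ℂ) × (Fin 3 → ℂ) in 𝓝 (iota c), q.1 ∈ U :=
    continuous_fst.continuousAt.eventually_mem hU
  filter_upwards [this] with q hq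
  refine propext ⟨?_, ?_⟩
  · rintro ⟨p, hp, rfl⟩
    exact ⟨p, hp.1, rfl⟩
  · rintro ⟨p, hp, rfl⟩
    exact ⟨p, ⟨hp, hq⟩, rfl⟩

theorem isSubvarietyGerm_complexHypersurface (q : (Fin 3 → ℂ) × (Fin 3 → ℂ)) :
    IsSubvarietyGerm ℂ complexHypersurface q :=
  isSubvarietyGerm_zero_set isOpen_univ (analyticOnNhd_complexPsi univ) (mem_univ q)

theorem isGermComplexification_complexHypersurface {c : Fin 3 → ℂ} (h0 : c 0 = 0) (h1 : c 1 = 0)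
    (h2 : (c 2).re = 0) : IsGermComplexification hypersurface c complexHypersurface :=
  ⟨isSubvarietyGerm_complexHypersurface _,
    Eventually.of_forall fun _ hq => iota_image_subset hq,
    fun _ hB h => subset_of_germ_iota h0 h1 h2 hB h⟩

theorem IsGermComplexification.eventuallyEq {U : Set (Fin 3 → ℂ)} {c : Fin 3 → ℂ} (hU : U ∈ 𝓝 c)
    (h0 : c 0 = 0) (h1 : c 1 = 0) (h2 : (c 2).re = 0) {A : Set ((Fin 3 → ℂ) × (Fin 3 → ℂ))}
    (hA : IsGermComplexification (hypersurface ∩ U) c A) :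
    A =ᶠ[𝓝 (iota c)] complexHypersurface := by
  have h := iota_image_inter_eventuallyEq hU hypersurface
  refine EventuallyLE.antisymm ?_ ?_
  · refine hA.2.2 _ (isSubvarietyGerm_complexHypersurface _) (h.le.trans ?_)
    exact Eventually.of_forall fun _ hq => iota_image_subset hq
  · exact subset_of_germ_iota h0 h1 h2 hA.1 (h.symm.le.trans hA.2.1)

theorem isSubvariety_complexHypersurface : IsSubvariety ℂ univ complexHypersurface := by
  have := isSubvariety_zero_set isOpen_univ (analyticOnNhd_complexPsi univ)
  rwa [inter_univ] at this

theorem complexHypersurface_subset {B : Set ((Fin 3 → ℂ) × (Fin 3 → ℂ))}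
    (hB : IsSubvariety ℂ univ B) (h : complexHypersurface ≤ᶠ[𝓝 (iota 0)] B) :
    complexHypersurface ⊆ B :=
  (isConeAt_complexHypersurface rfl rfl rfl).subset_of_germ hB h

theorem complexification_univ : complexification univ hypersurface = complexHypersurface := by
  refine Subset.antisymm ?_ (subset_sInter ?_)
  · have := complexification_subset isOpen_univ
    rw [inter_univ, doubled_univ, inter_univ] at this
    exact this
  · rintro B ⟨hB, h⟩
    rw [doubled_univ] at hB
    refine complexHypersurface_subset hB (subset_of_germ_iota rfl rfl rfl
      ⟨univ, mem_univ _, by rwa [inter_univ]⟩ (Eventually.of_forall fun q hq => h hq))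

theorem isIrreducibleGerm_complexHypersurface {c : Fin 3 → ℂ} (h0 : c 0 = 0) (h1 : c 1 = 0)
    (h2 : (c 2).re = 0) : IsIrreducibleGerm ℂ complexHypersurface (iota c) := by
  refine (isConeAt_complexHypersurface h0 h1 h2).isIrreducibleGerm isPrimeCone_complexHypersurface
    (isSubvarietyGerm_complexHypersurface _) ?_
  rw [iota_mem_complexHypersurface]
  change psi c = 0
  simp [psi, h0, h1, h2]

theorem isIrreducibleSubvariety_complexHypersurface :
    IsIrreducibleSubvariety ℂ univ complexHypersurface := by
  refine ⟨isSubvariety_complexHypersurface, ⟨0, by simp [complexHypersurface, complexPsi]⟩,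
    fun B C hB hC h => ?_⟩
  have hg : ∀ B : Set ((Fin 3 → ℂ) × (Fin 3 → ℂ)), IsSubvariety ℂ univ B →
      IsSubvarietyGerm ℂ B (iota 0) := fun B hB => ⟨univ, mem_univ _, by rwa [inter_univ]⟩
  rcases (isConeAt_complexHypersurface (c := 0) rfl rfl rfl).subset_or_subset
    isPrimeCone_complexHypersurface (hg B hB) (hg C hC) (EventuallyEq.of_eq h).le with h1 | h1
  · exact Or.inl ((complexHypersurface_subset hB h1).antisymm (h ▸ subset_union_left))
  · exact Or.inr ((complexHypersurface_subset hC h1).antisymm (h ▸ subset_union_right))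

theorem isIrreducibleComponent_iff {C : Set ((Fin 3 → ℂ) × (Fin 3 → ℂ))} :
    IsIrreducibleComponent ℂ univ complexHypersurface C ↔ C = complexHypersurface := by
  constructor
  · exact fun h => (h.2.2 _ isIrreducibleSubvariety_complexHypersurface h.2.1 Subset.rfl).symm
  · rintro rfl
    exact ⟨isIrreducibleSubvariety_complexHypersurface, Subset.rfl,
      fun C' _ h1 h2 => h2.antisymm h1⟩

theorem isGermComponent_complexHypersurface {c : Fin 3 → ℂ} (h0 : c 0 = 0) (h1 : c 1 = 0)
    (h2 : (c 2).re = 0) : IsGermComponent ℂ complexHypersurface (iota c) complexHypersurface :=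
  ⟨isIrreducibleGerm_complexHypersurface h0 h1 h2, EventuallyLE.refl _ _,
    fun _ _ h3 h4 => h4.antisymm h3⟩

end Complexification

/-! ### Substituting elements of a Banach algebra into power series -/

section WordForms

variable (𝕜 : Type*) [NontriviallyNormedField 𝕜] (𝔸 : Type*) [NormedRing 𝔸] [NormedAlgebra 𝕜 𝔸]

/-- The form `∑ α, c α • a (α 0) * ⋯ * a (α (k - 1))` evaluated at elements of an algebra. -/
noncomputable def wordForm {k N : ℕ} (c : (Fin k → Fin N) → 𝕜) : (Fin N → 𝔸) [×k]→L[𝕜] 𝔸 :=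
  ∑ α, c α • (ContinuousMultilinearMap.mkPiAlgebraFin 𝕜 k 𝔸).compContinuousLinearMap
    fun j => ContinuousLinearMap.proj (α j)

theorem wordForm_apply' {k N : ℕ} (c : (Fin k → Fin N) → 𝕜) (m : Fin k → Fin N → 𝔸) :
    wordForm 𝕜 𝔸 c m = ∑ α, c α • (List.ofFn fun j => m j (α j)).prod := by
  simp [wordForm]

theorem wordForm_apply {k N : ℕ} (c : (Fin k → Fin N) → 𝕜) (a : Fin N → 𝔸) :
    wordForm 𝕜 𝔸 c (fun _ => a) = ∑ α, c α • (List.ofFn fun j => a (α j)).prod :=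
  wordForm_apply' 𝕜 𝔸 c _

theorem norm_wordForm_le [NormOneClass 𝔸] {k N : ℕ} {c : (Fin k → Fin N) → 𝕜} {B : ℝ}
    (hB0 : 0 ≤ B) (hB : ∀ α, ‖c α‖ ≤ B) : ‖wordForm 𝕜 𝔸 c‖ ≤ (N : ℝ) ^ k * B := by
  refine ContinuousMultilinearMap.opNorm_le_bound (by positivity) fun m => ?_
  rw [wordForm_apply']
  have h1 : ∀ α : Fin k → Fin N,
      ‖c α • (List.ofFn fun j => m j (α j)).prod‖ ≤ B * ∏ j, ‖m j‖ := by
    intro α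
    rw [norm_smul]
    refine mul_le_mul (hB α) ((List.norm_prod_le _).trans ?_) (norm_nonneg _) hB0
    rw [List.map_ofFn, List.prod_ofFn]
    exact Finset.prod_le_prod (fun _ _ => norm_nonneg _) fun j _ => norm_le_pi_norm (m j) (α j)
  calc _ ≤ ∑ α : Fin k → Fin N, B * ∏ j, ‖m j‖ := (norm_sum_le _ _).trans
        (Finset.sum_le_sum fun α _ => h1 α)
    _ = (N : ℝ) ^ k * B * ∏ j, ‖m j‖ := by
        rw [Finset.sum_const, Finset.card_univ, Fintype.card_fun, Fintype.card_fin,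
          Fintype.card_fin, nsmul_eq_mul]
        push_cast
        ring

variable {𝕜 𝔸}

/-- Since `φ` turns left multiplication by `a i` into multiplication by `z i`, the letters of each
word can be pulled out one by one. This is how evaluation at a root acts on a series with operator
arguments. -/
theorem map_wordForm {𝔹 : Type*} [NormedCommRing 𝔹] [NormedAlgebra 𝕜 𝔹] {k N : ℕ}
    (c : (Fin k → Fin N) → 𝕜) (φ : 𝔸 →ₗ[𝕜] 𝔹) {a : Fin N → 𝔸} {z : Fin N → 𝔹}
    (h : ∀ i x, φ (a i * x) = z i * φ x) :
    φ (wordForm 𝕜 𝔸 c (fun _ => a)) = wordForm 𝕜 𝔹 c (fun _ => z) * φ 1 := by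
  have key : ∀ l : List (Fin N), φ (l.map a).prod = (l.map z).prod * φ 1 := by
    intro l
    induction l with
    | nil => simp
    | cons i l ih => rw [List.map_cons, List.prod_cons, h, ih, List.map_cons, List.prod_cons,
        mul_assoc]
  rw [wordForm_apply, wordForm_apply, map_sum, Finset.sum_mul]
  refine Finset.sum_congr rfl fun α _ => ?_
  have := key (List.ofFn α)
  rw [List.map_ofFn, List.map_ofFn] at this
  rw [map_smul, smul_mul_assoc]
  exact congrArg _ this

variable {E : Type*} [NormedAddCommGroup E] [NormedSpace 𝕜 E]

theorem apply_sum_smul {k N : ℕ} (p : E [×k]→L[𝕜] 𝕜) (b : Fin N → E) (x : Fin N → 𝕜) :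
    p (fun _ => ∑ i, x i • b i) = wordForm 𝕜 𝕜 (fun α => p fun j => b (α j)) (fun _ => x) := by
  rw [wordForm_apply, p.map_sum]
  refine Finset.sum_congr rfl fun α _ => ?_
  rw [p.map_smul_univ, List.prod_ofFn, smul_eq_mul, smul_eq_mul, mul_comm]

/-- The power series obtained by substituting algebra elements for the coordinates with respect
to `b` in the power series `p`. -/
noncomputable def wordSeries (p : FormalMultilinearSeries 𝕜 E 𝕜) {N : ℕ} (b : Fin N → E)
    (𝔸 : Type*) [NormedRing 𝔸] [NormedAlgebra 𝕜 𝔸] : FormalMultilinearSeries 𝕜 (Fin N → 𝔸) 𝔸 :=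
  fun k => wordForm 𝕜 𝔸 fun α => p k fun j => b (α j)

/-- There are `N ^ k` words of length `k`, each with coefficient at most `‖p k‖ B ^ k`, so the
radius shrinks at most by the factor `N B`; the `+ 1` in `D` keeps the divisor positive. -/
theorem wordSeries_radius_pos [NormOneClass 𝔸] {p : FormalMultilinearSeries 𝕜 E 𝕜} {N : ℕ}
    (b : Fin N → E) (hp : 0 < p.radius) : 0 < (wordSeries p b 𝔸).radius := by
  obtain ⟨r, hr0, hr⟩ := ENNReal.lt_iff_exists_nnreal_btwn.1 hp
  have hr0' : 0 < r := by exact_mod_cast hr0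
  obtain ⟨C, hC, hpC⟩ := p.norm_mul_pow_le_of_lt_radius hr
  obtain ⟨B, hB⟩ : ∃ B : NNReal, ∀ i, ‖b i‖ ≤ B :=
    ⟨∑ i, ‖b i‖₊, fun i => by
      rw [← coe_nnnorm]
      exact_mod_cast Finset.single_le_sum (f := fun i => ‖b i‖₊) (fun _ _ => zero_le) (Finset.mem_univ i)⟩
  set D : NNReal := N * B + 1 with hD
  have hD0 : 0 < D := by positivity
  have hle : ((r / D : NNReal) : ENNReal) ≤ (wordSeries p b 𝔸).radius := by
    refine FormalMultilinearSeries.le_radius_of_bound _ C fun k => ?_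
    have h1 : ‖wordSeries p b 𝔸 k‖ ≤ (N : ℝ) ^ k * (‖p k‖ * (B : ℝ) ^ k) := by
      refine norm_wordForm_le 𝕜 𝔸 (by positivity) fun α => ((p k).le_opNorm _).trans ?_
      refine mul_le_mul_of_nonneg_left ?_ (norm_nonneg _)
      calc ∏ j, ‖b (α j)‖ ≤ ∏ _j : Fin k, (B : ℝ) :=
            Finset.prod_le_prod (fun _ _ => norm_nonneg _) fun j _ => hB (α j)
        _ = (B : ℝ) ^ k := by simp
    have h2 : (N : ℝ) * B ≤ D := by
      rw [hD]
      push_cast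
      linarith
    calc ‖wordSeries p b 𝔸 k‖ * ((r / D : NNReal) : ℝ) ^ k
        ≤ ((N : ℝ) ^ k * (‖p k‖ * (B : ℝ) ^ k)) * ((r / D : NNReal) : ℝ) ^ k := by gcongr
      _ = (‖p k‖ * (r : ℝ) ^ k) * (((N : ℝ) * B) / D) ^ k := by
          push_cast
          rw [div_pow, div_pow, mul_pow]
          ring
      _ ≤ C * 1 := by
          refine mul_le_mul (hpC k) (pow_le_one₀ (by positivity) ?_) (by positivity) hC.le
          rw [div_le_one (by exact_mod_cast hD0)]
          exact h2
      _ = C := mul_one C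
  refine lt_of_lt_of_le ?_ hle
  exact_mod_cast div_pos hr0' hD0

end WordForms

/-! ### Complexification of real forms -/

section RealCoordinates

/-- The standard real basis of `ℂ³`. -/
noncomputable def realBasis : Fin 6 → Fin 3 → ℂ :=
  ![![1, 0, 0], ![Complex.I, 0, 0], ![0, 1, 0], ![0, Complex.I, 0], ![0, 0, 1], ![0, 0, Complex.I]]

/-- The real coordinates on `ℂ³`. -/
noncomputable def realCoords (p : Fin 3 → ℂ) : Fin 6 → ℝ :=
  ![(p 0).re, (p 0).im, (p 1).re, (p 1).im, (p 2).re, (p 2).im]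

theorem sum_realCoords (p : Fin 3 → ℂ) : ∑ i, realCoords p i • realBasis i = p := by
  ext i
  fin_cases i <;> simp [Fin.sum_univ_succ, realCoords, realBasis]

/-- The complexification of `realCoords`. -/
noncomputable def complexCoords : (Fin 3 → ℂ) × (Fin 3 → ℂ) →L[ℂ] Fin 6 → ℂ :=
  LinearMap.toContinuousLinearMap
    { toFun := fun q => ![(q.1 0 + q.2 0) / 2, -Complex.I * (q.1 0 - q.2 0) / 2,
        (q.1 1 + q.2 1) / 2, -Complex.I * (q.1 1 - q.2 1) / 2,
        (q.1 2 + q.2 2) / 2, -Complex.I * (q.1 2 - q.2 2) / 2]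
      map_add' := fun q q' => by
        ext i
        fin_cases i <;> simp <;> ring
      map_smul' := fun a q => by
        ext i
        fin_cases i <;> simp <;> ring }

theorem complexCoords_apply (q : (Fin 3 → ℂ) × (Fin 3 → ℂ)) : complexCoords q =
    ![(q.1 0 + q.2 0) / 2, -Complex.I * (q.1 0 - q.2 0) / 2,
        (q.1 1 + q.2 1) / 2, -Complex.I * (q.1 1 - q.2 1) / 2,
        (q.1 2 + q.2 2) / 2, -Complex.I * (q.1 2 - q.2 2) / 2] := rfl

theorem add_star_div_two (z : ℂ) : (z + (starRingEnd ℂ) z) / 2 = z.re := by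
  rw [Complex.add_conj]
  push_cast
  ring

theorem sub_star_div_two (z : ℂ) : -Complex.I * (z - (starRingEnd ℂ) z) / 2 = z.im := by
  rw [Complex.sub_conj]
  push_cast
  linear_combination (-(z.im : ℂ)) * Complex.I_sq

theorem complexCoords_iota (p : Fin 3 → ℂ) (i : Fin 6) :
    complexCoords (iota p) i = realCoords p i := by
  rw [complexCoords_apply]
  fin_cases i <;> simp only [iota, Pi.star_apply, realCoords] <;>
    first
      | exact add_star_div_two _
      | exact sub_star_div_two _

/-- The complexification of a real form on `ℂ³`. -/
noncomputable def complexForm {k : ℕ} (p : (Fin 3 → ℂ) [×k]→L[ℝ] ℝ) :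
    ((Fin 3 → ℂ) × (Fin 3 → ℂ)) [×k]→L[ℂ] ℂ :=
  (wordForm ℂ ℂ fun α : Fin k → Fin 6 =>
    ((p fun j => realBasis (α j) : ℝ) : ℂ)).compContinuousLinearMap fun _ => complexCoords

theorem complexForm_apply {k : ℕ} (p : (Fin 3 → ℂ) [×k]→L[ℝ] ℝ)
    (q : (Fin 3 → ℂ) × (Fin 3 → ℂ)) : complexForm p (fun _ => q)
      = wordForm ℝ ℂ (fun α => p fun j => realBasis (α j)) (fun _ => complexCoords q) := by
  simp [complexForm, wordForm_apply]

theorem complexForm_iota {k : ℕ} (p : (Fin 3 → ℂ) [×k]→L[ℝ] ℝ) (v : Fin 3 → ℂ) :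
    complexForm p (fun _ => iota v) = ((p fun _ => v : ℝ) : ℂ) := by
  conv_rhs => rw [← sum_realCoords v, apply_sum_smul]
  rw [complexForm_apply, wordForm_apply, wordForm_apply]
  push_cast
  refine Finset.sum_congr rfl fun α _ => ?_
  simp [complexCoords_iota, List.prod_ofFn]

theorem complexForm_eq_zero {k : ℕ} {p : (Fin 3 → ℂ) [×k]→L[ℝ] ℝ}
    (h : ∀ v ∈ hypersurface, p (fun _ => v) = 0) {q : (Fin 3 → ℂ) × (Fin 3 → ℂ)}
    (hq : q ∈ complexHypersurface) : complexForm p (fun _ => q) = 0 :=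
  eq_zero_of_real_vanishing (analyticOnNhd_diag (complexForm p)) (map_smul_diag _)
    (fun v hv => by rw [complexForm_iota, h v hv, Complex.ofReal_zero]) hq

/-- Primality descends from the complex cone: the product of the complexified forms vanishes at the
real points, hence on the complex cone, and a vanishing complexified factor restricts to a vanishing
real one. -/
theorem isPrimeCone_hypersurface : IsPrimeCone ℝ hypersurface := by
  intro i j p q h
  have hA : ∀ v ∈ complexHypersurface,
      complexForm p (fun _ => v) * complexForm q (fun _ => v) = 0 := fun v hv =>
    eq_zero_of_real_vanishing (P := fun v => complexForm p (fun _ => v) * complexForm q fun _ => v)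
      ((analyticOnNhd_diag _).mul (analyticOnNhd_diag _)) (k := i + j)
      (fun a v => by rw [map_smul_diag, map_smul_diag]; ring)
      (fun v hv => by
        rw [complexForm_iota, complexForm_iota, ← Complex.ofReal_mul, h v hv, Complex.ofReal_zero])
      hv
  refine (isPrimeCone_complexHypersurface i j _ _ hA).imp (fun h1 v hv => ?_) fun h1 v hv => ?_
  · have := h1 _ (iota_mem_complexHypersurface.2 hv)
    rwa [complexForm_iota, Complex.ofReal_eq_zero] at this
  · have := h1 _ (iota_mem_complexHypersurface.2 hv)
    rwa [complexForm_iota, Complex.ofReal_eq_zero] at this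

end RealCoordinates

/-! ### Weierstrass division by the quintic -/

section Division

open Complex Polynomial

/-- The endomorphism `e_i ↦ e_{i+1}`, `e_5 ↦ 0` of `ℝ⁶`. -/
noncomputable def shiftOp : (Fin 6 → ℝ) →L[ℝ] Fin 6 → ℝ :=
  ContinuousLinearMap.pi ![0, .proj 0, .proj 1, .proj 2, .proj 3, .proj 4]

/-- The endomorphism `e_5 ↦ e_i`, `e_j ↦ 0` for `j ≠ 5`, of `ℝ⁶`. -/
noncomputable def lastOp (i : Fin 6) : (Fin 6 → ℝ) →L[ℝ] Fin 6 → ℝ :=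
  (ContinuousLinearMap.proj (R := ℝ) (φ := fun _ : Fin 6 => ℝ) 5).smulRight (Pi.single i (1 : ℝ))

/-- The coefficients of `X⁶ - (X - x) * q`, where `q` is the quintic polynomial defining the
hypersurface. -/
noncomputable def sexticCoeff (p : Fin 3 → ℂ) : Fin 6 → ℝ :=
  ![(p 2).re * normSq (p 1) ^ 2 / 4 * (p 0).re,
    (p 2).re ^ 2 * normSq (p 1) * (p 0).re - (p 2).re * normSq (p 1) ^ 2 / 4,
    -((p 2).re ^ 2 * normSq (p 1)), (p 0).im ^ 2 * (p 0).re, -(p 0).im ^ 2, (p 0).re]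

/-- Scaled companion operator of `(X - x) * q`. -/
noncomputable def companionOp (ε : ℝ) (p : Fin 3 → ℂ) : (Fin 6 → ℝ) →L[ℝ] Fin 6 → ℝ :=
  ε • shiftOp + ∑ i : Fin 6, (sexticCoeff p i * ε⁻¹ ^ (5 - i : ℕ)) • lastOp i

/-- The coordinates of `p`, with `x` replaced by `companionOp ε p`. -/
noncomputable def companionPoint (ε : ℝ) (p : Fin 3 → ℂ) :
    Fin 6 → (Fin 6 → ℝ) →L[ℝ] Fin 6 → ℝ :=
  ![companionOp ε p, (p 0).im • 1, (p 1).re • 1, (p 1).im • 1, (p 2).re • 1, (p 2).im • 1]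

/-- The functional `A ↦ ∑ i, (A e₀) i * (z / ε) ^ i`. -/
noncomputable def evalFunctional (ε : ℝ) (z : ℂ) : ((Fin 6 → ℝ) →L[ℝ] Fin 6 → ℝ) →L[ℝ] ℂ :=
  ∑ i : Fin 6, (z / ε) ^ (i : ℕ) •
    (ofRealCLM.comp ((ContinuousLinearMap.proj (R := ℝ) (φ := fun _ : Fin 6 => ℝ) i).comp
      (ContinuousLinearMap.apply ℝ (Fin 6 → ℝ) (Pi.single (0 : Fin 6) (1 : ℝ)))))

theorem evalFunctional_apply (ε : ℝ) (z : ℂ) (A : (Fin 6 → ℝ) →L[ℝ] Fin 6 → ℝ) :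
    evalFunctional ε z A
      = ∑ i : Fin 6, (z / ε) ^ (i : ℕ) * (A (Pi.single (0 : Fin 6) (1 : ℝ)) i : ℂ) := by
  simp [evalFunctional]

theorem evalFunctional_one (ε : ℝ) (z : ℂ) : evalFunctional ε z 1 = 1 := by
  rw [evalFunctional_apply, Fin.sum_univ_succ]
  simp

theorem companionOp_apply (ε : ℝ) (p : Fin 3 → ℂ) (v : Fin 6 → ℝ) (i : Fin 6) :
    companionOp ε p v i = ε * (![0, v 0, v 1, v 2, v 3, v 4] : Fin 6 → ℝ) i
      + sexticCoeff p i * ε⁻¹ ^ (5 - i : ℕ) * v 5 := by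
  have h : ∀ i, shiftOp v i = (![0, v 0, v 1, v 2, v 3, v 4] : Fin 6 → ℝ) i := by
    intro i
    fin_cases i <;> simp [shiftOp]
  simp only [companionOp, add_apply, Pi.add_apply, Pi.smul_apply, h,
    smul_eq_mul, sum_apply, Finset.sum_apply, smul_apply, lastOp,
    ContinuousLinearMap.smulRight_apply, ContinuousLinearMap.proj_apply, Pi.single_apply]
  simp

/-- Let `e_i` stand for the class of `(X / ε) ^ i` modulo `(X - x) q`. Then `companionOp` is
multiplication by `X` and `evalFunctional` is evaluation at a root `z`, which turns that
multiplication into multiplication by `z`. -/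
theorem evalFunctional_companionOp_mul {ε : ℝ} (hε : ε ≠ 0) (p : Fin 3 → ℂ) {z : ℂ}
    (hz : z ^ 6 = ∑ i : Fin 6, (sexticCoeff p i : ℂ) * z ^ (i : ℕ))
    (A : (Fin 6 → ℝ) →L[ℝ] Fin 6 → ℝ) :
    evalFunctional ε z (companionOp ε p * A) = z * evalFunctional ε z A := by
  have hεC : (ε : ℂ) ≠ 0 := by exact_mod_cast hε
  simp only [evalFunctional_apply, mul_apply_eq_comp]
  set v := A (Pi.single (0 : Fin 6) (1 : ℝ)) with hv
  simp only [companionOp_apply]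
  generalize sexticCoeff p = c at *
  obtain ⟨u, rfl⟩ : ∃ u, z = ε * u := ⟨z / ε, by field_simp⟩
  simp only [Fin.sum_univ_succ, Fin.sum_univ_zero] at hz ⊢
  simp at hz ⊢
  field_simp
  linear_combination (-(v 5 : ℂ)) * hz

theorem map_wordSeries_companionPoint {ε : ℝ} (hε : ε ≠ 0)
    (P : FormalMultilinearSeries ℝ (Fin 3 → ℂ) ℝ) (p : Fin 3 → ℂ) {z : ℂ}
    (hz : (z - (p 0).re) * (quintic (p 0).im (normSq (p 1)) (p 2).re).eval z = 0) (k : ℕ) :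
    evalFunctional ε z (wordSeries P realBasis _ k fun _ => companionPoint ε p)
      = complexForm (P k) fun _ => ofCoords z (p 0).im (p 1) (star (p 1)) (p 2).re (p 2).im := by
  have hz' : z ^ 6 = ∑ i : Fin 6, (sexticCoeff p i : ℂ) * z ^ (i : ℕ) := by
    rw [eval_quintic] at hz
    simp only [Fin.sum_univ_succ, Fin.sum_univ_zero, sexticCoeff]
    simp
    linear_combination hz
  have h := map_wordForm (𝔹 := ℂ) (fun α => P k fun j => realBasis (α j))
    (evalFunctional ε z : ((Fin 6 → ℝ) →L[ℝ] Fin 6 → ℝ) →ₗ[ℝ] ℂ) (a := companionPoint ε p)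
    (z := ![z, (p 0).im, (p 1).re, (p 1).im, (p 2).re, (p 2).im]) (fun i A => by
      fin_cases i
      · exact evalFunctional_companionOp_mul hε p hz' A
      all_goals simp [companionPoint])
  have hc : complexCoords (ofCoords z (p 0).im (p 1) (star (p 1)) (p 2).re (p 2).im)
      = ![z, (p 0).im, (p 1).re, (p 1).im, (p 2).re, (p 2).im] := by
    rw [complexCoords_apply]
    ext i
    fin_cases i <;> simp [ofCoords]
    · linear_combination (-((p 0).im : ℂ)) * I_sq
    · exact add_star_div_two _
    · simpa using sub_star_div_two (p 1)
    · linear_combination (-((p 2).im : ℂ)) * I_sq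
  rw [complexForm_apply, hc]
  refine h.trans ?_
  rw [ContinuousLinearMap.coe_coe, evalFunctional_one, mul_one]

/-- Simple roots make `q` divide `r`, and the degree bound leaves only a constant quotient, which is
the coefficient of `r` in degree `n`. -/
theorem eq_C_mul_of_roots {q r : ℂ[X]} {n : ℕ} (hq : q.Monic) (hn : q.natDegree = n)
    (hsep : ∀ z, q.eval z = 0 → (derivative q).eval z ≠ 0) (hr : r.natDegree ≤ n)
    (h : ∀ z, q.eval z = 0 → r.eval z = 0) : r = C (r.coeff n) * q := by
  rcases eq_or_ne r 0 with rfl | hr0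
  · simp
  have hnodup : q.roots.Nodup := by
    refine Multiset.nodup_iff_count_le_one.2 fun z => ?_
    rw [count_roots]
    by_contra! hc
    have := (one_lt_rootMultiplicity_iff_isRoot hq.ne_zero).1 hc
    exact hsep z this.1 this.2
  have hdvd : q ∣ r := by
    rw [(IsAlgClosed.splits q).eq_prod_roots_of_monic hq,
      Multiset.prod_X_sub_C_dvd_iff_le_roots hr0, Multiset.le_iff_subset hnodup]
    exact fun z hz => (mem_roots hr0).2 (h z (isRoot_of_mem_roots hz))
  obtain ⟨s, rfl⟩ := hdvd
  have hs0 : s ≠ 0 := right_ne_zero_of_mul hr0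
  have hs : s.natDegree = 0 := by
    have := natDegree_mul hq.ne_zero hs0
    omega
  obtain ⟨c, rfl⟩ := natDegree_eq_zero.1 hs
  have : q.coeff n = 1 := hn ▸ hq
  rw [coeff_mul_C, this, one_mul, mul_comm]

theorem ofReal_psi_eq_quintic (p : Fin 3 → ℂ) : (psi p : ℂ)
    = 4 * (quintic (p 0).im (normSq (p 1)) (p 2).re).eval ((p 0).re : ℂ) := by
  rw [eval_quintic, psi, normSq_apply (p 0)]
  push_cast
  ring

/-- The points over which the quintic has simple roots. -/
def genericSet : Set (Fin 3 → ℂ) :=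
  {p | ∀ z, (quintic (p 0).im (normSq (p 1)) (p 2).re).eval z = 0 →
    (derivative (quintic (p 0).im (normSq (p 1)) (p 2).re)).eval z ≠ 0}

theorem dense_genericSet : Dense genericSet := by
  intro p
  rw [mem_closure_iff_nhds]
  intro N hN
  have hcont : Continuous fun a : ℝ × ℂ × ℝ =>
      (![(p 0).re + I * a.1, a.2.1, a.2.2 + I * (p 2).im] : Fin 3 → ℂ) := by
    refine continuous_pi fun i => ?_
    fin_cases i <;> simp <;> fun_prop
  have hp : (![(p 0).re + I * (p 0).im, p 1, (p 2).re + I * (p 2).im] : Fin 3 → ℂ) = p := by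
    ext i
    fin_cases i <;> simp [mul_comm I, re_add_im]
  obtain ⟨ε, hε, hεN⟩ := Metric.mem_nhds_iff.1
    (hcont.continuousAt.preimage_mem_nhds (x := ((p 0).im, p 1, (p 2).re)) (by rwa [hp]))
  obtain ⟨w, hwε, hw⟩ := (dense_compl_singleton (0 : ℂ)).inter_open_nonempty _
    (Metric.isOpen_ball (x := p 1) (ε := ε)) ⟨_, Metric.mem_ball_self hε⟩
  obtain ⟨s, hsε, hs⟩ := (dense_compl_singleton (0 : ℝ)).inter_open_nonempty _
    (Metric.isOpen_ball (x := (p 2).re) (ε := ε)) ⟨_, Metric.mem_ball_self hε⟩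
  have hW : ((normSq w : ℝ) : ℂ) ≠ 0 := by
    rw [Ne, ofReal_eq_zero, normSq_eq_zero]
    exact hw
  have hs' : (s : ℂ) ≠ 0 := ofReal_ne_zero.2 hs
  have hfin := (finite_bad hW hs').preimage (f := ((↑) : ℝ → ℂ)) ofReal_injective.injOn
  obtain ⟨y, hyε, hy⟩ := (hfin.countable.dense_compl ℝ).inter_open_nonempty _
    (Metric.isOpen_ball (x := (p 0).im) (ε := ε)) ⟨_, Metric.mem_ball_self hε⟩
  refine ⟨_, hεN (show (y, w, s) ∈ Metric.ball ((p 0).im, p 1, (p 2).re) ε from ?_), ?_⟩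
  · rw [Metric.mem_ball] at *
    simp [Prod.dist_eq, hwε, hsε, hyε]
  · intro z hz hz'
    simp at hz hz'
    exact hy ⟨z, hz, Or.inr (Or.inr hz')⟩

theorem analyticAt_companionPoint (ε : ℝ) (p : Fin 3 → ℂ) :
    AnalyticAt ℝ (companionPoint ε) p := by
  have hre : ∀ i, AnalyticAt ℝ (fun p : Fin 3 → ℂ => (p i).re) p := fun i =>
    (reCLM.comp (ContinuousLinearMap.proj (R := ℝ) (φ := fun _ : Fin 3 => ℂ) i)).analyticAt p
  have him : ∀ i, AnalyticAt ℝ (fun p : Fin 3 → ℂ => (p i).im) p := fun i =>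
    (imCLM.comp (ContinuousLinearMap.proj (R := ℝ) (φ := fun _ : Fin 3 => ℂ) i)).analyticAt p
  have h0 := hre 0
  have h1 := hre 1
  have h2 := hre 2
  have h3 := him 0
  have h4 := him 1
  have h5 := him 2
  have hc : ∀ i, AnalyticAt ℝ (fun p => sexticCoeff p i) p := by
    intro i
    fin_cases i <;> simp only [sexticCoeff, normSq_apply] <;> simp <;> fun_prop
  have hop : AnalyticAt ℝ (companionOp ε) p := by
    refine analyticAt_const.add (Finset.analyticAt_fun_sum _ fun i _ => ?_)
    exact ((hc i).mul analyticAt_const).smul analyticAt_const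
  refine analyticAt_pi_iff.2 fun i => ?_
  fin_cases i
  · exact hop
  · exact h3.smul analyticAt_const
  · exact h1.smul analyticAt_const
  · exact h4.smul analyticAt_const
  · exact h2.smul analyticAt_const
  · exact h5.smul analyticAt_const

/-- At the origin the sextic is `X⁶`, so the companion operator is `ε` times the nilpotent shift.
The rescaled basis makes it small enough to lie in the ball of convergence. -/
theorem exists_norm_companionPoint_lt {r : ℝ} (hr : 0 < r) :
    ∃ ε : ℝ, 0 < ε ∧ ‖companionPoint ε 0‖ < r := by
  refine ⟨r / 2 / (‖shiftOp‖ + 1), by positivity, ?_⟩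
  set ε := r / 2 / (‖shiftOp‖ + 1) with hε
  have h0 : companionOp ε 0 = ε • shiftOp := by
    have : ∀ i, sexticCoeff 0 i = 0 := by
      intro i
      fin_cases i <;> simp [sexticCoeff]
    simp [companionOp, this]
  have h1 : ‖ε • shiftOp‖ < r := by
    have hε0 : 0 < ε := by positivity
    rw [norm_smul, Real.norm_of_nonneg hε0.le]
    calc ε * ‖shiftOp‖ ≤ ε * (‖shiftOp‖ + 1) := by gcongr; linarith
      _ = r / 2 := div_mul_cancel₀ _ (by positivity)
      _ < r := by linarith
  rw [pi_norm_lt_iff hr]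
  intro i
  fin_cases i
  · change ‖companionOp ε 0‖ < r
    rwa [h0]
  all_goals simpa [companionPoint] using hr

/-- Substituting the companion operator for `x` in the series of `f` gives the remainder `R` of
degree at most 5 modulo `(X - x) q`. At the roots of `q` the complexified terms of `f` vanish, so `R
= c q`; at `X = x` the remainder has the value `f`. Thus `f = c q(x) = c ψ / 4`, and `c` depends
analytically on the point because it is an entry of the operator series. -/
theorem exists_eq_mul_psi {f : (Fin 3 → ℂ) → ℝ} (hf : MemIdealAt hypersurface 0 f) :
    ∃ Q : (Fin 3 → ℂ) → ℝ, AnalyticAt ℝ Q 0 ∧ ∀ᶠ p in 𝓝 0, f p = Q p * psi p := by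
  obtain ⟨P, hP⟩ := hf.1
  have hvan : ∀ k, ∀ v ∈ hypersurface, P k (fun _ => v) = 0 := fun k v hv =>
    (isConeAt_hypersurface (c := 0) rfl rfl rfl).coeff_eq_zero hP hf.2 k hv
  have hF := (wordSeries P realBasis ((Fin 6 → ℝ) →L[ℝ] Fin 6 → ℝ)).hasFPowerSeriesOnBall
    (wordSeries_radius_pos _ hP.radius_pos)
  set S := wordSeries P realBasis ((Fin 6 → ℝ) →L[ℝ] Fin 6 → ℝ) with hS
  obtain ⟨r, hr0, hr⟩ := ENNReal.lt_iff_exists_nnreal_btwn.1 hF.r_pos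
  obtain ⟨ε, hε, hεr⟩ := exists_norm_companionPoint_lt (r := r) (by exact_mod_cast hr0)
  have hmem : ∀ {a : Fin 6 → (Fin 6 → ℝ) →L[ℝ] Fin 6 → ℝ}, ‖a‖ < r → a ∈ Metric.eball 0 S.radius := by
    intro a ha
    refine Metric.eball_subset_eball hr.le ?_
    rw [Metric.eball_coe]
    simpa using ha
  set G : (Fin 3 → ℂ) → (Fin 6 → ℝ) →L[ℝ] Fin 6 → ℝ := fun p => S.sum (companionPoint ε p) with hG
  have hGan : AnalyticAt ℝ G 0 :=
    (hF.analyticAt_of_mem (hmem hεr)).comp (analyticAt_companionPoint ε 0)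
  -- `ε⁻¹ ^ 5` converts the coefficient of `(X / ε)⁵` to that of `X⁵`, and `1 / 4` comes from `ψ = 4
  -- q(x)`.
  set Q : (Fin 3 → ℂ) → ℝ := fun p => G p (Pi.single 0 1) 5 * (ε⁻¹ ^ 5 / 4) with hQ
  have hQan : AnalyticAt ℝ Q 0 := by
    refine AnalyticAt.mul ?_ analyticAt_const
    exact (((ContinuousLinearMap.proj (R := ℝ) (φ := fun _ : Fin 6 => ℝ) 5).comp
      (ContinuousLinearMap.apply ℝ (Fin 6 → ℝ) (Pi.single (0 : Fin 6) (1 : ℝ)))).analyticAt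
        _).comp hGan
  refine ⟨Q, hQan, ?_⟩
  have hsum : ∀ᶠ p in 𝓝 (0 : Fin 3 → ℂ), HasSum (fun k => P k fun _ => p) (f p) := by
    simpa using hP.eventually_hasSum
  have hGsum : ∀ᶠ p in 𝓝 (0 : Fin 3 → ℂ),
      HasSum (fun k => S k fun _ => companionPoint ε p) (G p) := by
    have := (analyticAt_companionPoint ε 0).continuousAt.norm.eventually_lt continuousAt_const hεr
    filter_upwards [this] with p hp
    simpa using hF.hasSum (hmem hp)
  have hgen : ∀ᶠ p in 𝓝 (0 : Fin 3 → ℂ), p ∈ genericSet → f p = Q p * psi p := by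
    filter_upwards [hsum, hGsum] with p h1 h2 hp
    have h3 : ∀ z : ℂ, (z - (p 0).re) * (quintic (p 0).im (normSq (p 1)) (p 2).re).eval z = 0 →
        HasSum (fun k => complexForm (P k) fun _ =>
          ofCoords z (p 0).im (p 1) (star (p 1)) (p 2).re (p 2).im)
          (evalFunctional ε z (G p)) := by
      intro z hz
      have := (evalFunctional ε z).hasSum h2
      simpa only [hS, map_wordSeries_companionPoint hε.ne' P p hz] using this
    set R : ℂ[X] := ∑ i : Fin 6, C ((ε⁻¹ : ℂ) ^ (i : ℕ) * (G p (Pi.single 0 1) i : ℂ)) * X ^ (i : ℕ)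
      with hR
    have hReval : ∀ z, R.eval z = evalFunctional ε z (G p) := by
      intro z
      rw [evalFunctional_apply, hR, eval_finsetSum]
      refine Finset.sum_congr rfl fun i _ => ?_
      rw [eval_C_mul, eval_pow, eval_X, div_eq_mul_inv, mul_pow]
      ring
    have hRdeg : R.natDegree ≤ 5 := natDegree_sum_le_of_forall_le _ _ fun i _ =>
      (natDegree_C_mul_X_pow_le _ _).trans (by omega)
    have hRcoeff : R.coeff 5 = (ε⁻¹ : ℂ) ^ 5 * (G p (Pi.single 0 1) 5 : ℂ) := by
      rw [hR, finsetSum_coeff]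
      simp only [coeff_C_mul, coeff_X_pow]
      simp [Fin.sum_univ_succ]
    have hRroot : ∀ z, (quintic (p 0).im (normSq (p 1)) (p 2).re).eval z = 0 → R.eval z = 0 := by
      intro z hz
      rw [hReval]
      refine (h3 z (by rw [hz, mul_zero])).unique ?_
      have h4 : ∀ k, complexForm (P k) (fun _ =>
          ofCoords z (p 0).im (p 1) (star (p 1)) (p 2).re (p 2).im) = 0 := fun k => by
        refine complexForm_eq_zero (hvan k) ?_
        change complexPsi _ = 0
        rw [complexPsi_ofCoords, show p 1 * star (p 1) = normSq (p 1) from mul_conj (p 1), hz,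
          mul_zero]
      simp only [h4]
      exact hasSum_zero
    have h5 := eq_C_mul_of_roots (monic_quintic _ _ _) (natDegree_quintic _ _ _) hp hRdeg hRroot
    have h6 : R.eval ((p 0).re : ℂ) = f p := by
      rw [hReval]
      refine (h3 _ (by rw [sub_self, zero_mul])).unique ?_
      have h7 : ofCoords (p 0).re (p 0).im (p 1) (star (p 1)) (p 2).re (p 2).im = iota p := by
        have hz : ∀ z : ℂ, (z.re : ℂ) + I * z.im = z := fun z => by rw [mul_comm, re_add_im]
        have hz' : ∀ z : ℂ, (z.re : ℂ) - I * z.im = star z := fun z => by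
          apply Complex.ext <;> simp
        refine Prod.ext ?_ ?_ <;> ext i <;> fin_cases i <;> simp [ofCoords, iota, hz, hz']
      simp only [h7, complexForm_iota]
      exact (ofRealCLM).hasSum h1
    have h8 : (f p : ℂ) = (Q p * psi p : ℝ) := by
      rw [← h6, h5, eval_C_mul, hRcoeff, hQ]
      push_cast
      rw [ofReal_psi_eq_quintic]
      ring
    exact_mod_cast h8
  -- The identity is known where the quintic has simple roots; density of these points and
  -- continuity give it everywhere near 0.
  obtain ⟨O, hO, hOo, h0O⟩ := eventually_nhds_iff.1
    ((hgen.and hf.1.eventually_analyticAt).and hQan.eventually_analyticAt)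
  filter_upwards [hOo.mem_nhds h0O] with p hp
  by_contra hne
  have hcpsi : Continuous psi := by
    unfold psi
    fun_prop
  have hfQ : ContinuousAt (fun p => f p - Q p * psi p) p :=
    (hO p hp).1.2.continuousAt.sub ((hO p hp).2.continuousAt.mul hcpsi.continuousAt)
  have hev := (hfQ.eventually_ne (sub_ne_zero.2 hne)).and (hOo.mem_nhds hp)
  obtain ⟨q, hq, hqg⟩ := mem_closure_iff_nhds.1 (dense_genericSet p) _ hev
  exact hq.1 (sub_eq_zero.2 ((hO q hq.2).1.1 hqg))

end Division

/-! ### The differential of ψ, generation of the ideal, and dimension at the vertices -/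

section RegularPoints

theorem analyticAt_re (i : Fin 3) (p : Fin 3 → ℂ) :
    AnalyticAt ℝ (fun p : Fin 3 → ℂ => (p i).re) p :=
  (Complex.reCLM.comp (ContinuousLinearMap.proj (R := ℝ) (φ := fun _ : Fin 3 => ℂ) i)).analyticAt p

theorem analyticAt_im (i : Fin 3) (p : Fin 3 → ℂ) :
    AnalyticAt ℝ (fun p : Fin 3 → ℂ => (p i).im) p :=
  (Complex.imCLM.comp (ContinuousLinearMap.proj (R := ℝ) (φ := fun _ : Fin 3 => ℂ) i)).analyticAt p

theorem analyticAt_normSq (i : Fin 3) (p : Fin 3 → ℂ) :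
    AnalyticAt ℝ (fun p : Fin 3 → ℂ => Complex.normSq (p i)) p := by
  have h1 := analyticAt_re i p
  have h2 := analyticAt_im i p
  simp only [Complex.normSq_apply]
  fun_prop

theorem analyticAt_psi (p : Fin 3 → ℂ) : AnalyticAt ℝ psi p := by
  have h1 := analyticAt_re 0 p
  have h2 := analyticAt_re 2 p
  have h3 := analyticAt_normSq 0 p
  have h4 := analyticAt_normSq 1 p
  unfold psi
  fun_prop

theorem fderiv_psi_apply (p v : Fin 3 → ℂ) : fderiv ℝ psi p v =
    (4 * (p 2).re ^ 2 * Complex.normSq (p 1) + 12 * (p 0).re ^ 2 * Complex.normSq (p 0)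
        + 8 * (p 0).re ^ 4) * (v 0).re
      + 8 * (p 0).re ^ 3 * (p 0).im * (v 0).im
      + (4 * Complex.normSq (p 1) * (p 2).re + 8 * (p 0).re * (p 2).re ^ 2)
        * ((p 1).re * (v 1).re + (p 1).im * (v 1).im)
      + (Complex.normSq (p 1) ^ 2 + 8 * (p 0).re * (p 2).re * Complex.normSq (p 1)) * (v 2).re := by
  have hre : ∀ i, HasFDerivAt (fun p : Fin 3 → ℂ => (p i).re) (Complex.reCLM.comp
      (ContinuousLinearMap.proj (R := ℝ) (φ := fun _ : Fin 3 => ℂ) i)) p := fun i =>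
    (Complex.reCLM.comp (ContinuousLinearMap.proj (R := ℝ) (φ := fun _ : Fin 3 => ℂ) i)).hasFDerivAt
  have him : ∀ i, HasFDerivAt (fun p : Fin 3 → ℂ => (p i).im) (Complex.imCLM.comp
      (ContinuousLinearMap.proj (R := ℝ) (φ := fun _ : Fin 3 => ℂ) i)) p := fun i =>
    (Complex.imCLM.comp (ContinuousLinearMap.proj (R := ℝ) (φ := fun _ : Fin 3 => ℂ) i)).hasFDerivAt
  have hsq : ∀ i, HasFDerivAt (fun p : Fin 3 → ℂ => Complex.normSq (p i)) _ p := fun i =>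
    ((hre i).mul (hre i)).add ((him i).mul (him i))
  have h : HasFDerivAt psi _ p :=
    ((((hsq 1).pow 2).mul (hre 2)).add ((((hre 0).const_mul 4).mul ((hre 2).pow 2)).mul (hsq 1))).add
      ((((hre 0).pow 3).const_mul 4).mul (hsq 0))
  rw [h.fderiv]
  simp [Complex.normSq_apply]
  ring

/-- `∂ψ/∂x` is a sum of nonnegative terms including `8 x⁴`, so it vanishes only if `x = 0`; then
`∂ψ/∂s = W²`. -/
theorem fderiv_psi_eq_zero_iff (p : Fin 3 → ℂ) :
    fderiv ℝ psi p = 0 ↔ (p 0).re = 0 ∧ p 1 = 0 := by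
  constructor
  · intro h
    have h1 : fderiv ℝ psi p ![1, 0, 0] = 0 := by rw [h]; rfl
    have h2 : fderiv ℝ psi p ![0, 0, 1] = 0 := by rw [h]; rfl
    rw [fderiv_psi_apply] at h1 h2
    simp at h1 h2
    have hx : (p 0).re = 0 := by
      have h3 : 0 ≤ 4 * (p 2).re ^ 2 * Complex.normSq (p 1) :=
        mul_nonneg (by positivity) (Complex.normSq_nonneg _)
      have h4 : 0 ≤ 12 * (p 0).re ^ 2 * Complex.normSq (p 0) :=
        mul_nonneg (by positivity) (Complex.normSq_nonneg _)
      have h5 : 0 ≤ (p 0).re ^ 4 := by positivity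
      exact pow_eq_zero_iff (n := 4) (by norm_num) |>.1 (by linarith)
    rw [hx] at h2
    refine ⟨hx, Complex.normSq_eq_zero.1 ?_⟩
    simpa using h2
  · rintro ⟨h0, h1⟩
    ext v
    rw [fderiv_psi_apply]
    simp [h0, h1]

theorem psi_eq_zero_of_fderiv {p : Fin 3 → ℂ} (h0 : (p 0).re = 0) (h1 : p 1 = 0) : psi p = 0 := by
  simp [psi, h0, h1]

theorem generatesIdealAt_psi {c : Fin 3 → ℂ} (h0 : c 0 = 0) (h1 : c 1 = 0) (h2 : (c 2).re = 0) :
    GeneratesIdealAt (fun q (_ : Fin 1) => psi q) hypersurface c := by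
  refine ⟨fun _ => ⟨analyticAt_psi c, Eventually.of_forall fun q hq => hq⟩, fun g hg => ?_⟩
  have ht : Tendsto (fun q : Fin 3 → ℂ => c + q) (𝓝 0) (𝓝 c) := by
    have : Continuous fun q : Fin 3 → ℂ => c + q := by fun_prop
    simpa using this.tendsto 0
  have ht' : Tendsto (fun q : Fin 3 → ℂ => q - c) (𝓝 c) (𝓝 0) := by
    have : Continuous fun q : Fin 3 → ℂ => q - c := by fun_prop
    simpa using this.tendsto c
  have hmem : MemIdealAt hypersurface 0 fun q => g (c + q) := by
    refine ⟨?_, ?_⟩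
    · exact AnalyticAt.fun_comp (g := g) (f := fun q => c + q) (by simpa using hg.1) (by fun_prop)
    · filter_upwards [ht.eventually hg.2] with q h3 h4
      refine h3 ?_
      change psi (c + q) = 0
      rw [psi_add_of_axis h0 h1 h2]
      exact h4
  obtain ⟨Q, hQ, h⟩ := exists_eq_mul_psi hmem
  refine ⟨fun _ q => Q (q - c), fun _ => ?_, ?_⟩
  · exact AnalyticAt.fun_comp (g := Q) (f := fun q => q - c) (by simpa using hQ) (by fun_prop)
  · filter_upwards [ht'.eventually h] with q hq
    rw [add_sub_cancel] at hq
    rw [hq, ← psi_add_of_axis h0 h1 h2 (q - c), add_sub_cancel]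
    simp

theorem finrank_real : Module.finrank ℝ (Fin 3 → ℂ) = 6 := by
  rw [Module.finrank_pi_fintype]
  simp [Complex.finrank_real_complex]

theorem finrank_complex : Module.finrank ℂ ((Fin 3 → ℂ) × (Fin 3 → ℂ)) = 6 := by
  simp

theorem isRegularAt_of_fderiv_psi {p : Fin 3 → ℂ} (hp : p ∈ hypersurface)
    (h : ¬((p 0).re = 0 ∧ p 1 = 0)) : IsRegularAt ℝ hypersurface 5 p :=
  isRegularAt_of_fderiv_ne_zero (by rw [finrank_real]) (analyticAt_psi p) hp
    (fun hd => h ((fderiv_psi_eq_zero_iff p).1 hd)) (Eventually.of_forall fun _ => Iff.rfl)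

theorem interior_hypersurface : interior hypersurface = ∅ := by
  by_contra hne
  obtain ⟨p, hp⟩ := nonempty_iff_ne_empty.2 hne
  have h1 : psi =ᶠ[𝓝 p] fun _ => 0 := by
    filter_upwards [isOpen_interior.mem_nhds hp] with q hq
    have : q ∈ hypersurface := interior_subset hq
    exact this
  have h2 := AnalyticOnNhd.eq_of_eventuallyEq (f := psi) (g := fun _ => 0)
    (fun q _ => analyticAt_psi q) (fun q _ => analyticAt_const) h1
  have := congrFun h2 ![1, 0, 0]
  simp [psi] at this

theorem dim_hypersurface_inter {V : Set (Fin 3 → ℂ)} : dim ℝ (hypersurface ∩ V) ≤ 5 :=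
  dim_le_of_interior_eq_empty (n := 5) finrank_real
    (subset_eq_empty (interior_mono inter_subset_left) interior_hypersurface)

theorem dimAt_hypersurface {c : Fin 3 → ℂ} (h0 : c 0 = 0) (h1 : c 1 = 0) (h2 : (c 2).re = 0) :
    dimAt ℝ hypersurface c = 5 ∧ dim ℝ hypersurface = 5 := by
  have hle : dim ℝ hypersurface ≤ 5 := by
    simpa using dim_hypersurface_inter (V := univ)
  have hge : (5 : WithBot ℕ∞) ≤ dimAt ℝ hypersurface c := by
    refine le_dimAt (d := 5) ?_
    have ht : Tendsto (fun t : ℝ => (![0, t, c 2] : Fin 3 → ℂ)) (𝓝[≠] 0) (𝓝 c) := by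
      have hc : Continuous fun t : ℝ => (![0, t, c 2] : Fin 3 → ℂ) := by
        refine continuous_pi fun i => ?_
        fin_cases i <;> simp <;> fun_prop
      have h3 : (![0, ((0 : ℝ) : ℂ), c 2] : Fin 3 → ℂ) = c := by
        ext i
        fin_cases i <;> simp [h0, h1]
      have := hc.tendsto 0
      rw [h3] at this
      exact this.mono_left nhdsWithin_le_nhds
    refine ht.frequently (Eventually.frequently ?_)
    filter_upwards [self_mem_nhdsWithin] with t ht
    refine isRegularAt_of_fderiv_psi ?_ ?_
    · simp [hypersurface, psi, h2]
    · simpa using ht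
  exact ⟨((dimAt_le_dim _ _).trans hle).antisymm hge, hle.antisymm (hge.trans (dimAt_le_dim _ _))⟩

theorem interior_complexHypersurface : interior complexHypersurface = ∅ := by
  by_contra hne
  obtain ⟨p, hp⟩ := nonempty_iff_ne_empty.2 hne
  have h1 : complexPsi =ᶠ[𝓝 p] fun _ => 0 := by
    filter_upwards [isOpen_interior.mem_nhds hp] with q hq
    have : q ∈ complexHypersurface := interior_subset hq
    exact this
  have h2 := AnalyticOnNhd.eq_of_eventuallyEq (f := complexPsi) (g := fun _ => 0)
    (analyticOnNhd_complexPsi univ) (fun q _ => analyticAt_const) h1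
  have := congrFun h2 (![1, 0, 0], ![1, 0, 0])
  norm_num [complexPsi] at this

theorem dimAt_complexHypersurface {c : Fin 3 → ℂ} (h0 : c 0 = 0) (h1 : c 1 = 0)
    (h2 : (c 2).re = 0) :
    dimAt ℂ complexHypersurface (iota c) = 5 ∧ dim ℂ complexHypersurface = 5 := by
  have hle : dim ℂ complexHypersurface ≤ 5 :=
    dim_le_of_interior_eq_empty (n := 5) finrank_complex interior_complexHypersurface
  have hge : (5 : WithBot ℕ∞) ≤ dimAt ℂ complexHypersurface (iota c) := by
    refine le_dimAt (d := 5) ?_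
    have ht : Tendsto (fun t : ℝ => iota (![0, t, c 2] : Fin 3 → ℂ)) (𝓝[≠] 0) (𝓝 (iota c)) := by
      have hc : Continuous fun t : ℝ => iota (![0, t, c 2] : Fin 3 → ℂ) := by
        refine continuous_iota.comp (continuous_pi fun i => ?_)
        fin_cases i <;> simp <;> fun_prop
      have h3 : (![0, ((0 : ℝ) : ℂ), c 2] : Fin 3 → ℂ) = c := by
        ext i
        fin_cases i <;> simp [h0, h1]
      have := hc.tendsto 0
      rw [h3] at this
      exact this.mono_left nhdsWithin_le_nhds
    refine ht.frequently (Eventually.frequently ?_)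
    filter_upwards [self_mem_nhdsWithin] with t ht
    set p : Fin 3 → ℂ := ![0, t, c 2] with hp
    have hpX : complexPsi (iota p) = 0 := by
      rw [complexPsi_iota]
      simp [psi, hp, h2]
    refine isRegularAt_of_fderiv_ne_zero (by rw [finrank_complex])
      (analyticOnNhd_complexPsi univ _ (mem_univ _)) hpX (fun hd => ?_)
      (Eventually.of_forall fun _ => Iff.rfl)
    -- The differential is tested in the direction of the unbarred `ξ`, along which `complexPsi` is
    -- linear with slope `t⁴ / 2`.
    have hline : HasDerivAt (fun z : ℂ => complexPsi (iota p + z • (![0, 0, 1], 0))) 0 0 := by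
      have hf := (analyticOnNhd_complexPsi univ _ (mem_univ (iota p))).differentiableAt.hasFDerivAt
      rw [hd] at hf
      have hl : HasDerivAt (fun z : ℂ => iota p + z • ((![0, 0, 1], 0) : (Fin 3 → ℂ) × (Fin 3 → ℂ)))
          (![0, 0, 1], 0) 0 := by
        simpa using ((hasDerivAt_id (0 : ℂ)).smul_const
          ((![0, 0, 1], 0) : (Fin 3 → ℂ) × (Fin 3 → ℂ))).const_add (iota p)
      have := HasFDerivAt.comp_hasDerivAt (0 : ℂ) (by simpa using hf) hl
      exact this
    have hexpl : (fun z : ℂ => complexPsi (iota p + z • (![0, 0, 1], 0)))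
        = fun z => z * ((t : ℂ) ^ 4 / 2) := by
      funext z
      have h3 : c 2 + (starRingEnd ℂ) (c 2) = 0 := by rw [Complex.add_conj, h2]; simp
      simp [complexPsi, iota, hp]
      linear_combination (t : ℂ) ^ 4 / 2 * h3
    rw [hexpl] at hline
    have h4 := ((hasDerivAt_id (0 : ℂ)).mul_const ((t : ℂ) ^ 4 / 2)).unique hline
    simp at h4
    exact ht h4
  exact ⟨((dimAt_le_dim _ _).trans hle).antisymm hge, hle.antisymm (hge.trans (dimAt_le_dim _ _))⟩

end RegularPoints

/-! ### The smooth branch at points with `x = 0`, `w = 0`, `s ≠ 0` -/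

section Branch

/-- The analytic branch of the complexified hypersurface through the points `x = 0`, `w = 0`,
`s ≠ 0`. -/
noncomputable def branch (q : (Fin 3 → ℂ) × (Fin 3 → ℂ)) : ℂ :=
  q.1 1 * q.2 1 + (q.1 0 + q.2 0) * (q.1 2 + q.2 2) / 2
    * (1 + (1 - 4 * (q.1 0 + q.2 0) * (q.1 0 * q.2 0) / (q.1 2 + q.2 2) ^ 3) ^ (1 / 2 : ℂ))

/-- The quantity under the square root in `branch`. -/
noncomputable def radicand (p : Fin 3 → ℂ) : ℝ :=
  1 - (p 0).re * Complex.normSq (p 0) / (p 2).re ^ 3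

theorem branch_iota {p : Fin 3 → ℂ} (h : 0 ≤ radicand p) :
    branch (iota p) = ((Complex.normSq (p 1) + 2 * (p 0).re * (p 2).re
      * (1 + Real.sqrt (radicand p)) : ℝ) : ℂ) := by
  have h1 : ∀ z : ℂ, z + star z = ((2 * z.re : ℝ) : ℂ) := fun z => Complex.add_conj z
  have h2 : ∀ z : ℂ, z * star z = (Complex.normSq z : ℂ) := fun z => Complex.mul_conj z
  have h3 : 1 - 4 * ((2 * (p 0).re : ℝ) : ℂ) * (Complex.normSq (p 0) : ℂ)
      / (((2 * (p 2).re : ℝ) : ℂ)) ^ 3 = (radicand p : ℂ) := by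
    rw [radicand]
    push_cast
    rw [mul_pow, show (2 : ℂ) ^ 3 = 8 by norm_num, ← mul_div_mul_left _ (((p 2).re : ℂ) ^ 3)
      (show (8 : ℂ) ≠ 0 by norm_num)]
    ring
  simp only [branch, iota, Pi.star_apply, h1, h2, h3]
  rw [Real.sqrt_eq_rpow, show (1 / 2 : ℂ) = ((1 / 2 : ℝ) : ℂ) by push_cast; rfl,
    ← Complex.ofReal_cpow h]
  push_cast
  ring

theorem analyticAt_branch {q : (Fin 3 → ℂ) × (Fin 3 → ℂ)} (h0 : q.1 0 + q.2 0 = 0)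
    (h2 : q.1 2 + q.2 2 ≠ 0) : AnalyticAt ℂ branch q := by
  have h1 : ∀ i, AnalyticAt ℂ (fun q : (Fin 3 → ℂ) × (Fin 3 → ℂ) => q.1 i) q := fun i =>
    ((ContinuousLinearMap.proj i).comp (ContinuousLinearMap.fst ℂ (Fin 3 → ℂ) (Fin 3 → ℂ))
      ).analyticAt q
  have h1' : ∀ i, AnalyticAt ℂ (fun q : (Fin 3 → ℂ) × (Fin 3 → ℂ) => q.2 i) q := fun i =>
    ((ContinuousLinearMap.proj i).comp (ContinuousLinearMap.snd ℂ (Fin 3 → ℂ) (Fin 3 → ℂ))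
      ).analyticAt q
  have hden : AnalyticAt ℂ (fun q : (Fin 3 → ℂ) × (Fin 3 → ℂ) => (q.1 2 + q.2 2) ^ 3) q :=
    ((h1 2).add (h1' 2)).pow 3
  have hrad : AnalyticAt ℂ (fun q : (Fin 3 → ℂ) × (Fin 3 → ℂ) =>
      1 - 4 * (q.1 0 + q.2 0) * (q.1 0 * q.2 0) / (q.1 2 + q.2 2) ^ 3) q :=
    analyticAt_const.sub (((analyticAt_const.mul ((h1 0).add (h1' 0))).mul
      ((h1 0).mul (h1' 0))).div hden (pow_ne_zero 3 h2))
  have hcpow := hrad.cpow (analyticAt_const (v := (1 / 2 : ℂ))) (by simp [h0])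
  exact ((h1 1).mul (h1' 1)).add (((((h1 0).add (h1' 0)).mul ((h1 2).add (h1' 2))).mul
    (analyticAt_const (v := (2 : ℂ)⁻¹))).mul (analyticAt_const.add hcpow))

theorem analyticAt_branch_iota {p : Fin 3 → ℂ} (h0 : (p 0).re = 0) (h2 : (p 2).re ≠ 0) :
    AnalyticAt ℂ branch (iota p) := by
  have h1 : ∀ z : ℂ, z + star z = ((2 * z.re : ℝ) : ℂ) := fun z => Complex.add_conj z
  refine analyticAt_branch ?_ ?_
  · simp only [iota, Pi.star_apply, h1, h0, mul_zero, Complex.ofReal_zero]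
  · simp only [iota, Pi.star_apply, h1]
    exact Complex.ofReal_ne_zero.2 (mul_ne_zero two_ne_zero h2)

theorem eventually_radicand_pos {p : Fin 3 → ℂ} (h0 : (p 0).re = 0) (h2 : (p 2).re ≠ 0) :
    ∀ᶠ q in 𝓝 p, 0 < radicand q ∧ (q 2).re ≠ 0 := by
  have hc : ContinuousAt radicand p := by
    unfold radicand
    have : Continuous fun p : Fin 3 → ℂ => Complex.normSq (p 0) :=
      Complex.continuous_normSq.comp (continuous_apply 0)
    have h3 : ContinuousAt (fun p : Fin 3 → ℂ => (p 2).re ^ 3) p :=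
      ((analyticAt_re 2 p).pow 3).continuousAt
    have h4 := (analyticAt_re 0 p).continuousAt
    exact continuousAt_const.sub (ContinuousAt.div (h4.mul this.continuousAt) h3 (pow_ne_zero 3 h2))
  have h1 : 0 < radicand p := by simp [radicand, h0]
  have hc2 : ContinuousAt (fun p : Fin 3 → ℂ => (p 2).re) p := (analyticAt_re 2 p).continuousAt
  exact (continuousAt_const.eventually_lt hc h1).and (hc2.eventually_ne h2)

/-- Solving `ψ = 0` as a quadratic in `W` gives two factors. The conjugate factor contributes
nothing new: `2xs(1 - S)` times the positive number `(1 + S) s²` is `2 x² |z|²`, so that factor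
vanishes only for `W = x = 0`, where the branch vanishes too. -/
theorem psi_eq_zero_iff_branch {p : Fin 3 → ℂ} (h : 0 ≤ radicand p) (h2 : (p 2).re ≠ 0) :
    psi p = 0 ↔ Complex.normSq (p 1) + 2 * (p 0).re * (p 2).re
      * (1 + Real.sqrt (radicand p)) = 0 := by
  set S := Real.sqrt (radicand p) with hS
  have hS0 : 0 ≤ S := Real.sqrt_nonneg _
  have hS2 : S ^ 2 * (p 2).re ^ 3 = (p 2).re ^ 3 - (p 0).re * Complex.normSq (p 0) := by
    rw [hS, Real.sq_sqrt h, radicand]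
    field_simp
  have hfac : psi p * (p 2).re = (p 2).re ^ 2
      * (Complex.normSq (p 1) + 2 * (p 0).re * (p 2).re * (1 + S))
      * (Complex.normSq (p 1) + 2 * (p 0).re * (p 2).re * (1 - S)) := by
    rw [psi]
    linear_combination (4 * (p 0).re ^ 2 * (p 2).re) * hS2
  constructor
  · intro hp
    rw [hp, zero_mul] at hfac
    rcases mul_eq_zero.1 hfac.symm with h3 | h3
    · exact (mul_eq_zero.1 h3).resolve_left (pow_ne_zero 2 h2)
    · have hW := Complex.normSq_nonneg (p 1)
      have hZ := Complex.normSq_nonneg (p 0)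
      have h4 : (2 * (p 0).re * (p 2).re * (1 - S)) * ((1 + S) * (p 2).re ^ 2)
          = 2 * (p 0).re ^ 2 * Complex.normSq (p 0) := by
        linear_combination (-2 * (p 0).re) * hS2
      have hpos : 0 < (1 + S) * (p 2).re ^ 2 := by positivity
      have h5 : Complex.normSq (p 1) * ((1 + S) * (p 2).re ^ 2)
          + 2 * (p 0).re ^ 2 * Complex.normSq (p 0) = 0 := by
        linear_combination ((1 + S) * (p 2).re ^ 2) * h3 - h4
      have h6 : 0 ≤ Complex.normSq (p 1) * ((1 + S) * (p 2).re ^ 2) := by positivity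
      have h7 : 0 ≤ (p 0).re ^ 2 * Complex.normSq (p 0) := by positivity
      have h8 : Complex.normSq (p 1) = 0 :=
        (mul_eq_zero.1 (by linarith : Complex.normSq (p 1) * ((1 + S) * (p 2).re ^ 2) = 0)
          ).resolve_right hpos.ne'
      have h9 : (p 0).re = 0 := by
        rcases mul_eq_zero.1 (by linarith : (p 0).re ^ 2 * Complex.normSq (p 0) = 0) with h10 | h10
        · exact pow_eq_zero_iff (two_ne_zero) |>.1 h10
        · rw [Complex.normSq_eq_zero.1 h10, Complex.zero_re]
      rw [h8, h9]
      ring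
  · intro h3
    rw [h3, mul_zero, zero_mul] at hfac
    exact (mul_eq_zero.1 hfac).resolve_right h2

theorem exists_branch {p : Fin 3 → ℂ} (h0 : (p 0).re = 0) (h1 : p 1 = 0) (h2 : (p 2).re ≠ 0) :
    ∃ φ : (Fin 3 → ℂ) → ℝ, AnalyticAt ℝ φ p ∧ φ p = 0 ∧ fderiv ℝ φ p ≠ 0 ∧
      (∀ᶠ q in 𝓝 p, q ∈ hypersurface ↔ φ q = 0) ∧ ∀ᶠ q in 𝓝 p, branch (iota q) = φ q := by
  have hpos := eventually_radicand_pos h0 h2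
  have hφ : ∀ q, 0 < radicand q ∧ (q 2).re ≠ 0 → (branch (iota q)).re
      = Complex.normSq (q 1) + 2 * (q 0).re * (q 2).re * (1 + Real.sqrt (radicand q)) :=
    fun q hq => by rw [branch_iota hq.1.le, Complex.ofReal_re]
  have hp0 : (branch (iota p)).re = 0 := by
    rw [hφ p hpos.self_of_nhds, h0, h1]
    simp
  have han : AnalyticAt ℝ (fun q => (branch (iota q)).re) p := by
    have hi : AnalyticAt ℝ (iota (n := 3)) p := by
      refine analyticAt_id.prod (analyticAt_pi_iff.2 fun i => ?_)
      exact ((Complex.conjCLE.toContinuousLinearMap).comp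
        (ContinuousLinearMap.proj (R := ℝ) (φ := fun _ : Fin 3 => ℂ) i)).analyticAt p
    exact (Complex.reCLM.analyticAt _).fun_comp
      (((analyticAt_branch_iota h0 h2).restrictScalars (𝕜 := ℝ)).fun_comp hi)
  refine ⟨fun q => (branch (iota q)).re, han, hp0, fun hd => ?_, ?_, ?_⟩
  · have hl : HasDerivAt (fun t : ℝ => p + t • (![1, 0, 0] : Fin 3 → ℂ)) ![1, 0, 0] 0 := by
      simpa using ((hasDerivAt_id (0 : ℝ)).smul_const (![1, 0, 0] : Fin 3 → ℂ)).const_add p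
    have hf := han.differentiableAt.hasFDerivAt
    rw [hd] at hf
    have hline := HasFDerivAt.comp_hasDerivAt (0 : ℝ) (by simpa using hf) hl
    have hslope := hline.tendsto_slope
    rw [zero_apply] at hslope
    -- No derivative of the square root is needed: the difference quotient in the `x` direction is
    -- exactly `2s(1 + S)`, of absolute value at least `2|s|`.
    have hnear : ∀ᶠ t in 𝓝[≠] (0 : ℝ), 2 * |(p 2).re| ≤
        |slope ((fun q => (branch (iota q)).re) ∘ fun t : ℝ => p + t • (![1, 0, 0] : Fin 3 → ℂ)) 0 t| := by
      have ht : Tendsto (fun t : ℝ => p + t • (![1, 0, 0] : Fin 3 → ℂ)) (𝓝[≠] 0) (𝓝 p) := by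
        have := hl.continuousAt.tendsto
        simp only [zero_smul, add_zero] at this
        exact this.mono_left nhdsWithin_le_nhds
      filter_upwards [ht.eventually hpos, self_mem_nhdsWithin] with t h3 ht0
      have ht0' : t ≠ 0 := ht0
      have hS0 := Real.sqrt_nonneg (radicand (p + t • (![1, 0, 0] : Fin 3 → ℂ)))
      rw [slope_def_field, Function.comp_apply, Function.comp_apply, hφ _ h3, zero_smul, add_zero,
        hp0]
      generalize Real.sqrt (radicand (p + t • (![1, 0, 0] : Fin 3 → ℂ))) = S at hS0
      have h4 : (Complex.normSq ((p + t • (![1, 0, 0] : Fin 3 → ℂ)) 1)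
          + 2 * ((p + t • (![1, 0, 0] : Fin 3 → ℂ)) 0).re
            * ((p + t • (![1, 0, 0] : Fin 3 → ℂ)) 2).re * (1 + S) - 0) / (t - 0)
          = 2 * (p 2).re * (1 + S) := by
        simp [h0, h1]
        field_simp
      rw [h4, abs_mul, abs_mul, abs_of_nonneg (by linarith : 0 ≤ 1 + S), abs_two]
      have := abs_nonneg (p 2).re
      nlinarith
    have := ge_of_tendsto hslope.abs hnear
    rw [abs_zero] at this
    have h5 := abs_pos.2 h2
    linarith
  · filter_upwards [hpos] with q hq
    rw [hφ q hq]
    exact psi_eq_zero_iff_branch hq.1.le hq.2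
  · filter_upwards [hpos] with q hq
    rw [branch_iota hq.1.le, Complex.ofReal_re]

end Branch

/-! ### The singular set -/

section SingularPoints

/-- The point `(x, u, s)` of `ℝ³ ⊆ ℂ³`. -/
noncomputable def realPoint (x u s : ℝ) : Fin 3 → ℂ := ![x, u, s]

theorem norm_realPoint_le {x u s r : ℝ} (hr : 0 ≤ r) (hx : |x| ≤ r) (hu : |u| ≤ r) (hs : |s| ≤ r) :
    ‖realPoint x u s‖ ≤ r := by
  rw [pi_norm_le_iff_of_nonneg hr]
  intro i
  fin_cases i <;> simpa [realPoint]

theorem fderiv_apply_eq_zero_of_line {f : (Fin 3 → ℂ) → ℝ} {p e : Fin 3 → ℂ}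
    (hf : AnalyticAt ℝ f p) (hfX : ∀ᶠ q in 𝓝 p, q ∈ hypersurface → f q = 0)
    (he : ∀ t : ℝ, p + t • e ∈ hypersurface) : fderiv ℝ f p e = 0 := by
  have hl : HasDerivAt (fun t : ℝ => p + t • e) e 0 := by
    simpa using ((hasDerivAt_id (0 : ℝ)).smul_const e).const_add p
  have hline := HasFDerivAt.comp_hasDerivAt (0 : ℝ)
    (by simpa using hf.differentiableAt.hasFDerivAt) hl
  have ht : Tendsto (fun t : ℝ => p + t • e) (𝓝 0) (𝓝 p) := by
    simpa using hl.continuousAt.tendsto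
  have h0 : (f ∘ fun t : ℝ => p + t • e) =ᶠ[𝓝 0] fun _ => 0 := by
    filter_upwards [ht.eventually hfX] with t h
    exact h (he t)
  exact hline.unique ((hasDerivAt_const (0 : ℝ) (0 : ℝ)).congr_of_eventuallyEq h0)

/-- A second-order symmetric difference is quadratically small. -/
theorem exists_symm_diff_le {f : (Fin 3 → ℂ) → ℝ} {p : Fin 3 → ℂ} (hf : AnalyticAt ℝ f p) :
    ∃ C δ : ℝ, 0 < C ∧ 0 < δ ∧ ∀ s : ℝ, 0 < s → s < δ →
      |f (p + realPoint 0 s s) + f (p + realPoint 0 (-s) s) - 2 * f (p + realPoint 0 0 s)|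
        ≤ C * s ^ 2 := by
  obtain ⟨K, N, hN, hK⟩ := (hf.fderiv.contDiffAt (n := 1)).exists_lipschitzOnWith
  obtain ⟨δ, hδ, hδN⟩ := Metric.mem_nhds_iff.1 (inter_mem hN hf.eventually_analyticAt)
  refine ⟨2 * K + 1, δ, by positivity, hδ, fun s hs hsδ => ?_⟩
  set e : Fin 3 → ℂ := realPoint 0 1 0 with he
  have hadd : ∀ u, p + realPoint 0 u s = p + realPoint 0 0 s + u • e := by
    intro u
    ext i
    simp only [Pi.add_apply, Pi.smul_apply]
    fin_cases i <;> simp [he, realPoint]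
  have hmem : ∀ u, |u| ≤ s → p + realPoint 0 0 s + u • e ∈ Metric.ball p δ := by
    intro u hu
    rw [← hadd, mem_ball_iff_norm, add_sub_cancel_left]
    refine (norm_realPoint_le hs.le ?_ hu ?_).trans_lt hsδ
    · simpa using hs.le
    · rw [abs_of_pos hs]
  set q := p + realPoint 0 0 s with hq
  have hderiv : ∀ u ∈ Icc (0 : ℝ) s, HasDerivWithinAt (fun u : ℝ => f (q + u • e) + f (q + (-u) • e))
      (fderiv ℝ f (q + u • e) e - fderiv ℝ f (q + (-u) • e) e) (Icc 0 s) u := by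
    intro u hu
    have h1 : HasDerivAt (fun u : ℝ => q + u • e) e u := by
      simpa using ((hasDerivAt_id u).smul_const e).const_add q
    have h2 : HasDerivAt (fun u : ℝ => q + (-u) • e) (-e) u := by
      simpa using ((hasDerivAt_id u).neg.smul_const e).const_add q
    have ha : |u| ≤ s := by rw [abs_of_nonneg hu.1]; exact hu.2
    have h3 := ((hδN (hmem u ha)).2.differentiableAt.hasFDerivAt.comp_hasDerivAt u h1)
    have h4 := ((hδN (hmem (-u) (by rwa [abs_neg]))).2.differentiableAt.hasFDerivAt.comp_hasDerivAt
      u h2)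
    have h5 := (h3.add h4).hasDerivWithinAt (s := Icc 0 s)
    rw [map_neg, ← sub_eq_add_neg] at h5
    exact h5
  have he1 : ‖e‖ ≤ 1 := norm_realPoint_le zero_le_one (by simp) (by simp) (by simp)
  have hbound : ∀ u ∈ Icc (0 : ℝ) s,
      ‖fderiv ℝ f (q + u • e) e - fderiv ℝ f (q + (-u) • e) e‖ ≤ 2 * K * s := by
    intro u hu
    have ha : |u| ≤ s := by rw [abs_of_nonneg hu.1]; exact hu.2
    have h1 := hK.norm_sub_le (hδN (hmem u ha)).1 (hδN (hmem (-u) (by rwa [abs_neg]))).1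
    have h2 : q + u • e - (q + (-u) • e) = (2 * u) • e := by module
    rw [h2, norm_smul, Real.norm_of_nonneg (by linarith [hu.1])] at h1
    rw [← sub_apply]
    calc _ ≤ ‖fderiv ℝ f (q + u • e) - fderiv ℝ f (q + (-u) • e)‖ * ‖e‖ :=
          ContinuousLinearMap.le_opNorm _ _
      _ ≤ (K * (2 * u * ‖e‖)) * ‖e‖ := by gcongr
      _ ≤ (K * (2 * s * 1)) * 1 := by
          have := hu.1
          have := hu.2
          gcongr
      _ = 2 * K * s := by ring
  have := (convex_Icc (0 : ℝ) s).norm_image_sub_le_of_norm_hasDerivWithin_le hderiv hbound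
    (left_mem_Icc.2 hs.le) (right_mem_Icc.2 hs.le)
  rw [Real.norm_eq_abs, sub_zero, Real.norm_of_nonneg hs.le] at this
  rw [hadd, hadd]
  calc _ = |f (q + s • e) + f (q + -s • e) - (f (q + (0 : ℝ) • e) + f (q + (-0 : ℝ) • e))| := by
        congr 1
        simp
        ring
    _ ≤ 2 * K * s * s := this
    _ ≤ (2 * K + 1) * s ^ 2 := by nlinarith [sq_nonneg s]

theorem exists_psi_root {p : Fin 3 → ℂ} (h0 : (p 0).re = 0) (h1 : p 1 = 0) (h2 : (p 2).re = 0)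
    {s : ℝ} (hs : 0 < s) : ∃ x, |x| ≤ s ∧
      s ^ 5 + 4 * x * s ^ 4 + 4 * x ^ 3 * (x ^ 2 + (p 0).im ^ 2) = 0 ∧
      p + realPoint x s s ∈ hypersurface ∧ p + realPoint x (-s) s ∈ hypersurface := by
  have hcont : Continuous fun x : ℝ =>
      s ^ 5 + 4 * x * s ^ 4 + 4 * x ^ 3 * (x ^ 2 + (p 0).im ^ 2) := by fun_prop
  -- At `x = -s / 4` the first two terms cancel and the rest is nonpositive.
  have hmem : (0 : ℝ) ∈ Icc (s ^ 5 + 4 * (-s / 4) * s ^ 4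
      + 4 * (-s / 4) ^ 3 * ((-s / 4) ^ 2 + (p 0).im ^ 2))
      (s ^ 5 + 4 * 0 * s ^ 4 + 4 * 0 ^ 3 * (0 ^ 2 + (p 0).im ^ 2)) := by
    constructor
    · have : 0 ≤ s ^ 3 * ((-s / 4) ^ 2 + (p 0).im ^ 2) := by positivity
      nlinarith
    · have : 0 ≤ s ^ 5 := by positivity
      linarith
  obtain ⟨x, hx, hx0⟩ := intermediate_value_Icc (by linarith : -s / 4 ≤ 0) hcont.continuousOn hmem
  have hpsi : ∀ u : ℝ, u ^ 2 = s ^ 2 → psi (p + realPoint x u s) = 0 := by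
    intro u hu
    simp only [psi, realPoint, Complex.normSq_apply]
    simp [h0, h1, h2]
    linear_combination hx0 + ((u ^ 2 + s ^ 2) * s + 4 * x * s ^ 2) * hu
  refine ⟨x, ?_, hx0, hpsi s rfl, hpsi (-s) (by ring)⟩
  rw [abs_le]
  constructor <;> linarith [hx.1, hx.2]

/-- A regular point would give `g` vanishing on X with `dg ≠ 0`, and lines in X leave only `a =
∂g/∂x` nonzero. For small `s > 0` the points of X with `w = ±s`, `Re ξ - Re (p 2) = s` share the
same `x`, because ψ depends on `w` through `W`. A second difference in `w` gives `|x| |a| ≤ C s²`,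
while the equation `s⁵ + 4xs⁴ + 4x³(x² + y²) = 0` would then make `s⁵ = O(s⁶)`. -/
theorem not_isRegularAt {p : Fin 3 → ℂ} (h0 : (p 0).re = 0) (h1 : p 1 = 0) (h2 : (p 2).re = 0)
    (d : ℕ) : ¬IsRegularAt ℝ hypersurface d p := by
  intro hreg
  have hd : d < 6 := by
    by_contra hlt
    exact (hreg.interior_nonempty (by rw [finrank_real]; omega)).ne_empty interior_hypersurface
  obtain ⟨hp, k, V, f, hk, hV, hpV, hf, hsurj, hX⟩ := hreg
  rw [finrank_real] at hk
  obtain ⟨v, hv⟩ := hsurj p hpV fun _ => 1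
  set i : Fin k := ⟨0, by omega⟩ with hi
  set g : (Fin 3 → ℂ) → ℝ := fun q => f q i with hg
  have hga : AnalyticAt ℝ g p := analyticAt_pi_iff.1 (hf p hpV) i
  have hgX : ∀ᶠ q in 𝓝 p, q ∈ hypersurface → g q = 0 := by
    filter_upwards [hV.mem_nhds hpV] with q hq hqX
    have : q ∈ hypersurface ∩ V := ⟨hqX, hq⟩
    rw [hX] at this
    exact congrFun this.2 i
  have hgv : fderiv ℝ g p v = 1 := by
    have : fderiv ℝ g p v = fderiv ℝ f p v i := by
      have := (hasFDerivAt_pi'.1 (hf p hpV).differentiableAt.hasFDerivAt i).fderiv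
      rw [hg, this]
      rfl
    rw [this, hv]
  set e : Fin 3 → ℂ := realPoint 1 0 0 with he
  have hkill : ∀ e' : Fin 3 → ℂ, (∀ t : ℝ, p + t • e' ∈ hypersurface) → fderiv ℝ g p e' = 0 :=
    fun e' h => fderiv_apply_eq_zero_of_line hga hgX h
  have ha0 : fderiv ℝ g p e ≠ 0 := by
    intro ha
    -- All directions other than `e` are tangent to lines contained in X, so `a = 0` would make the
    -- differential vanish.
    have hdec : v = (v 0).re • e + ((v 0).im • ![Complex.I, 0, 0] + (![0, v 1, 0] + ![0, 0, v 2])) := by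
      ext j
      fin_cases j <;> simp [he, realPoint, Complex.re_add_im]
    rw [hdec, map_add, map_add, map_add, map_smul, map_smul, ha,
      hkill ![Complex.I, 0, 0] fun t => ?_, hkill ![0, v 1, 0] fun t => ?_,
      hkill ![0, 0, v 2] fun t => ?_] at hgv
    · simp at hgv
    all_goals
      change psi _ = 0
      simp only [psi, Pi.add_apply, Pi.smul_apply]
      simp [h0, h1, h2]
  set a := fderiv ℝ g p e with haD
  have ha : 0 < |a| := abs_pos.2 ha0
  obtain ⟨C, δ, hC, hδ, hsymm⟩ := exists_symm_diff_le hga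
  have hstrict := (hga.hasStrictFDerivAt).isLittleO.def (half_pos ha)
  obtain ⟨δ₁, hδ₁, hδ₁s⟩ := Metric.eventually_nhds_iff_ball.1 hstrict
  obtain ⟨δ₂, hδ₂, hδ₂X⟩ := Metric.eventually_nhds_iff_ball.1 hgX
  set B := C / |a| with hB
  have hB0 : 0 < B := div_pos hC ha
  -- With `|x| ≤ B s²` and `|x| ≤ 1`, the equation of X gives `s⁵ ≤ M s⁶`; `s` is taken below `1 /
  -- M`.
  set M := 4 * B + 4 * B ^ 3 * (1 + (p 0).im ^ 2) with hM
  have hM0 : 0 < M := by positivity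
  obtain ⟨s, hs0, hs⟩ : ∃ s : ℝ, 0 < s ∧ s < min (min δ (min δ₁ δ₂)) (min 1 (1 / M)) :=
    exists_between (by positivity)
  simp only [lt_min_iff] at hs
  obtain ⟨⟨hsδ, hsδ₁, hsδ₂⟩, hs1, hsM⟩ := hs
  obtain ⟨x, hxs, hroot, hmem₁, hmem₂⟩ := exists_psi_root h0 h1 h2 hs0
  have hball : ∀ {r x u : ℝ}, s < r → |x| ≤ s → |u| ≤ s → p + realPoint x u s ∈ Metric.ball p r := by
    intro r x u hr hx hu
    rw [mem_ball_iff_norm, add_sub_cancel_left]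
    exact (norm_realPoint_le hs0.le hx hu (abs_of_pos hs0).le).trans_lt hr
  have hss : |s| ≤ s := (abs_of_pos hs0).le
  have hss' : |-s| ≤ s := by rwa [abs_neg]
  have h00 : |(0 : ℝ)| ≤ s := by simpa using hs0.le
  have hg1 := hδ₂X _ (hball hsδ₂ hxs hss) hmem₁
  have hg2 := hδ₂X _ (hball hsδ₂ hxs hss') hmem₂
  have hg3 : g (p + realPoint 0 0 s) = 0 := by
    refine hδ₂X _ (hball hsδ₂ h00 h00) ?_
    change psi _ = 0
    simp only [psi, Pi.add_apply, realPoint]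
    simp [h0, h1]
  have hest : ∀ u, |u| ≤ s → |g (p + realPoint x u s) - g (p + realPoint 0 u s) - x * a|
      ≤ |a| / 2 * |x| := by
    intro u hu
    have h3 := hδ₁s (p + realPoint x u s, p + realPoint 0 u s) (by
      rw [← ball_prod_same]
      exact ⟨hball hsδ₁ hxs hu, hball hsδ₁ h00 hu⟩)
    have h4 : p + realPoint x u s - (p + realPoint 0 u s) = x • e := by
      ext j
      fin_cases j <;> simp [he, realPoint]
    have h5 : ‖x • e‖ ≤ |x| := by
      rw [norm_smul, Real.norm_eq_abs]
      have : ‖e‖ ≤ 1 := norm_realPoint_le zero_le_one (by simp) (by simp) (by simp)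
      nlinarith [abs_nonneg x]
    simp only [h4, map_smul, smul_eq_mul] at h3
    exact h3.trans (mul_le_mul_of_nonneg_left h5 (half_pos ha).le)
  have e1 := hest s hss
  have e2 := hest (-s) hss'
  have e3 := hsymm s hs0 hsδ
  rw [hg1] at e1
  rw [hg2] at e2
  rw [hg3] at e3
  -- By `e1` and `e2` both values `g (0, ±s, s)` are within `|xa| / 2` of `-xa`; having the same
  -- sign, they add up in the second difference instead of cancelling.
  have hxC : |x| * |a| ≤ C * s ^ 2 := by
    rw [← abs_mul]
    rw [abs_le] at e1 e2 e3
    have h3 : |a| / 2 * |x| = |x * a| / 2 := by rw [abs_mul]; ring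
    rw [h3] at e1 e2
    rcases abs_cases (x * a) with ⟨h4, h5⟩ | ⟨h4, h5⟩ <;> rw [h4] at e1 e2 ⊢ <;>
      linarith [e1.1, e1.2, e2.1, e2.2, e3.1, e3.2]
  have hxB : |x| ≤ B * s ^ 2 := by
    rw [hB, div_mul_eq_mul_div, le_div_iff₀ ha]
    exact hxC
  have hx1 : x ^ 2 ≤ 1 := by
    rw [← sq_abs]
    have := abs_nonneg x
    nlinarith
  have h3 : s ^ 5 ≤ 4 * |x| * s ^ 4 + 4 * |x| ^ 3 * (1 + (p 0).im ^ 2) := by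
    have h4 : -x ≤ |x| := neg_le_abs x
    have h5 : -x ^ 3 ≤ |x| ^ 3 := by
      rw [← abs_pow]
      exact neg_le_abs _
    have h6 : s ^ 5 = 4 * (-x) * s ^ 4 + 4 * (-x ^ 3) * (x ^ 2 + (p 0).im ^ 2) := by
      linear_combination hroot
    rw [h6]
    have h7 : 4 * (-x ^ 3) * (x ^ 2 + (p 0).im ^ 2) ≤ 4 * |x| ^ 3 * (x ^ 2 + (p 0).im ^ 2) := by
      gcongr
    have h8 : 4 * |x| ^ 3 * (x ^ 2 + (p 0).im ^ 2) ≤ 4 * |x| ^ 3 * (1 + (p 0).im ^ 2) := by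
      gcongr
    have h9 : 4 * (-x) * s ^ 4 ≤ 4 * |x| * s ^ 4 := by gcongr
    linarith
  have h4 : s ^ 5 ≤ 4 * (B * s ^ 2) * s ^ 4 + 4 * (B * s ^ 2) ^ 3 * (1 + (p 0).im ^ 2) := by
    refine h3.trans ?_
    gcongr
  have h5 : s ^ 5 ≤ s ^ 5 * (s * M) := by
    refine h4.trans (le_of_eq ?_)
    rw [hM]
    ring
  have h6 : s * M < 1 := (lt_div_iff₀ hM0).1 hsM
  have h7 : 0 < s ^ 5 := by positivity
  nlinarith

theorem isRegularAt_of_branch {p : Fin 3 → ℂ} (h0 : (p 0).re = 0) (h1 : p 1 = 0)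
    (h2 : (p 2).re ≠ 0) : IsRegularAt ℝ hypersurface 5 p := by
  obtain ⟨φ, hφ, hφ0, hφd, hφX, -⟩ := exists_branch h0 h1 h2
  exact isRegularAt_of_fderiv_ne_zero (by rw [finrank_real]) hφ hφ0 hφd hφX

theorem singularSet_hypersurface :
    singularSet ℝ hypersurface = {p | (p 0).re = 0 ∧ p 1 = 0 ∧ (p 2).re = 0} := by
  ext p
  constructor
  · rintro ⟨hp, hreg⟩
    by_contra hc
    by_cases h : (p 0).re = 0 ∧ p 1 = 0
    · exact hreg ⟨5, isRegularAt_of_branch h.1 h.2 fun h2 => hc ⟨h.1, h.2, h2⟩⟩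
    · exact hreg ⟨5, isRegularAt_of_fderiv_psi hp h⟩
  · rintro ⟨h0, h1, h2⟩
    exact ⟨psi_eq_zero_of_fderiv h0 h1, fun ⟨d, hd⟩ => not_isRegularAt h0 h1 h2 d hd⟩

end SingularPoints

/-! ### Segre-degenerate points, absolute and relative -/

section SegreDegenerate

theorem isGood_univ {c : Fin 3 → ℂ} (h0 : c 0 = 0) (h1 : c 1 = 0) (h2 : (c 2).re = 0) :
    IsGood univ hypersurface c := by
  obtain ⟨hdim, hdim'⟩ := dimAt_hypersurface h0 h1 h2
  obtain ⟨hdimC, hdimC'⟩ := dimAt_complexHypersurface h0 h1 h2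
  have hirr : ∀ {C}, IsIrreducibleComponent ℂ (doubled univ) (complexification univ hypersurface) C
      ↔ C = complexHypersurface := by
    intro C
    rw [complexification_univ, doubled_univ]
    exact isIrreducibleComponent_iff
  refine ⟨?_, psi_eq_zero_of_fderiv (by simp [h0]) h1, ?_, by rw [hdim, hdim'], ?_, ?_, ?_, ?_, ?_,
    ?_, ?_, ?_⟩
  · have := isSubvariety_zero_set isOpen_univ (f := psi) fun p _ => analyticAt_psi p
    rwa [inter_univ] at this
  · exact isConnected_univ
  · rw [complexification_univ, hdimC, hdim']
  · rw [complexification_univ, hdimC', hdim']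
  · refine ⟨1, fun q _ => psi q, fun q _ => complexPsi q, fun p _ => ?_, fun q hq => ?_,
      fun z _ _ => complexPsi_iota z, ?_, generatesIdealAt_psi h0 h1 h2⟩
    · exact analyticAt_pi_iff.2 fun _ => analyticAt_psi p
    · exact analyticAt_pi_iff.2 fun _ => analyticOnNhd_complexPsi _ q hq
    · ext z
      simp [hypersurface, funext_iff]
  · rw [complexification_univ]
    ext q
    constructor
    · rintro ⟨hq, p, rfl⟩
      exact ⟨p, iota_mem_complexHypersurface.1 hq, rfl⟩
    · rintro ⟨p, hp, rfl⟩
      exact ⟨iota_mem_complexHypersurface.2 hp, p, rfl⟩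
  · rw [complexification_univ]
    exact isGermComplexification_complexHypersurface h0 h1 h2
  · intro C hC
    rw [hirr] at hC
    rw [hC, complexification_univ]
    exact isGermComponent_complexHypersurface h0 h1 h2
  · intro C C' hC hC' _
    rw [hirr] at hC hC'
    rw [hC, hC']
  · intro D hD
    refine ⟨complexHypersurface, hirr.2 rfl, ?_⟩
    rw [complexification_univ] at hD
    exact hD.2.2 _ (isIrreducibleGerm_complexHypersurface h0 h1 h2) hD.2.1 (EventuallyLE.refl _ _)

theorem interior_inter_nonempty_of_le_dimAt {S V : Set (Fin 3 → ℂ)} {p : Fin 3 → ℂ}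
    (h : (3 : ℕ) ≤ dimAt ℂ S p) (hV : V ∈ 𝓝 p) : (interior (S ∩ V)).Nonempty := by
  obtain ⟨d, q, hd, hq⟩ := exists_isRegularAt_of_le_dim (h.trans (iInf₂_le V hV))
  exact hq.interior_nonempty (by simpa using hd)

theorem complexPsi_eq_zero_of_axis {p : Fin 3 → ℂ} (h0 : p 0 = 0) (h1 : p 1 = 0) (z : Fin 3 → ℂ) :
    complexPsi (z, star p) = 0 := by
  simp [complexPsi, h0, h1]

/-- A slice with interior points is all of ℂ³, so its equation can be evaluated at convenient
points. -/
theorem eq_zero_of_interior_slice {p : Fin 3 → ℂ}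
    (h : (interior {z | complexPsi (z, star p) = 0}).Nonempty) : p 0 = 0 ∧ p 1 = 0 := by
  obtain ⟨z₀, hz₀⟩ := h
  have han : AnalyticOnNhd ℂ (fun z => complexPsi (z, star p)) univ := fun z _ =>
    (analyticOnNhd_complexPsi univ _ (mem_univ _)).comp₂ analyticAt_id analyticAt_const
  have hz : ∀ z, complexPsi (z, star p) = 0 := fun z =>
    han.eqOn_of_preconnected_of_eventuallyEq analyticOnNhd_const isPreconnected_univ (mem_univ z₀)
      (by
        filter_upwards [isOpen_interior.mem_nhds hz₀] with z hz
        exact interior_subset (s := {z | complexPsi (z, star p) = 0}) hz) (mem_univ z)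
  have h0 : p 0 = 0 := by
    by_contra hne
    have ha : star (p 0) ≠ 0 := star_ne_zero.2 hne
    -- With `w = 0` and `p 0 ≠ 0` the equation reads `z = -star (p 0)`, impossible for both `z = 1`
    -- and `z = 2`.
    have e1 := hz ![1, 0, 0]
    have e2 := hz ![2, 0, 0]
    simp [complexPsi, hne] at e1 e2
    have : (1 : ℂ) = 0 := by linear_combination e2 - e1
    exact one_ne_zero this
  refine ⟨h0, ?_⟩
  -- The third entry makes the complexified `Re ξ` equal to `1 / 2`, leaving `star (p 1) ^ 2 / 2 =
  -- 0`.
  have e1 := hz ![0, 1, 1 - star (p 2)]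
  simpa [complexPsi, h0] using e1

theorem le_dimAt_slice_iff {p : Fin 3 → ℂ} :
    (3 : ℕ) ≤ dimAt ℂ {z | complexPsi (z, star p) = 0} p ↔ p 0 = 0 ∧ p 1 = 0 := by
  constructor
  · intro h
    have := interior_inter_nonempty_of_le_dimAt h univ_mem
    rw [inter_univ] at this
    exact eq_zero_of_interior_slice this
  · rintro ⟨h0, h1⟩
    have : {z | complexPsi (z, star p) = 0} = univ :=
      eq_univ_of_forall fun z => complexPsi_eq_zero_of_axis h0 h1 z
    rw [this]
    refine le_dimAt (Eventually.frequently (Eventually.of_forall fun q => ?_))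
    exact ⟨mem_univ q, 0, univ, fun _ => 0, by simp, isOpen_univ, mem_univ q,
      analyticOnNhd_const, fun _ _ _ => ⟨0, Subsingleton.elim _ _⟩, by ext; simp⟩

theorem interior_setOf_apply_zero_eq_zero : interior {z : Fin 3 → ℂ | z 0 = 0} = ∅ := by
  by_contra hne
  obtain ⟨z, hz⟩ := nonempty_iff_ne_empty.2 hne
  have ho : IsOpen ((fun z : Fin 3 → ℂ => z 0) '' interior {z : Fin 3 → ℂ | z 0 = 0}) :=
    isOpenMap_eval 0 _ isOpen_interior
  have hsub : (fun z : Fin 3 → ℂ => z 0) '' interior {z : Fin 3 → ℂ | z 0 = 0} ⊆ {0} := by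
    rintro _ ⟨y, hy, rfl⟩
    exact interior_subset (s := {z : Fin 3 → ℂ | z 0 = 0}) hy
  have := ho.subset_interior_iff.2 hsub
  rw [interior_singleton] at this
  exact this ⟨z, hz, rfl⟩

theorem tendsto_slice {n : ℕ} (p : Fin n → ℂ) :
    Tendsto (fun z => (z, star p)) (𝓝 p) (𝓝 (iota p)) :=
  (by fun_prop : Continuous fun z : Fin n → ℂ => (z, star p)).tendsto p

/-- Goodness at `p` makes the complexification represent the smallest complex germ containing X, and
`{branch = 0}` is one such germ. -/
theorem eventually_branch_eq_zero {U : Set (Fin 3 → ℂ)} {p : Fin 3 → ℂ} (h0 : (p 0).re = 0)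
    (h1 : p 1 = 0) (h2 : (p 2).re ≠ 0) (hU : IsGood U (hypersurface ∩ U) p) :
    ∀ᶠ z in 𝓝 p, z ∈ segreVariety U (hypersurface ∩ U) p → branch (z, star p) = 0 := by
  obtain ⟨φ, -, -, -, hφX, hφ⟩ := exists_branch h0 h1 h2
  have hle : complexification U (hypersurface ∩ U) ≤ᶠ[𝓝 (iota p)] {q | branch q = 0} := by
    refine hU.germ_eq.2.2 _ (isSubvarietyGerm_zero_set (isOpen_analyticAt ℂ branch)
      (fun q hq => hq) (analyticAt_branch_iota h0 h2)) ?_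
    have hfst : Tendsto Prod.fst (𝓝 (iota p)) (𝓝 p) := continuous_fst.tendsto (iota p)
    filter_upwards [hfst.eventually (hφX.and hφ)]
    rintro _ ⟨hqX, hq⟩ ⟨q, hq', rfl⟩
    change branch (iota q) = 0
    rw [show branch (iota q) = φ q from hq, show φ q = 0 from hqX.1 hq'.1, Complex.ofReal_zero]
  filter_upwards [(tendsto_slice p).eventually hle] with z hz hzS
  exact hz hzS.2

/-- For `p 0 = p 1 = 0` the radicand is 1 and the branch restricts to `z₀ (z₂ + star (p 2))`. The
second factor is nonzero near `p`, so the Segre germ lies in `z₀ = 0`. -/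
theorem not_le_dimAt_segreVariety {U : Set (Fin 3 → ℂ)} {p : Fin 3 → ℂ} (h0 : p 0 = 0)
    (h1 : p 1 = 0) (h2 : (p 2).re ≠ 0) (hU : IsGood U (hypersurface ∩ U) p) :
    ¬(3 : ℕ) ≤ dimAt ℂ (segreVariety U (hypersurface ∩ U) p) p := by
  intro h
  have hne : ∀ᶠ z : Fin 3 → ℂ in 𝓝 p, z 2 + star (p 2) ≠ 0 := by
    have hc : Continuous fun z : Fin 3 → ℂ => z 2 + star (p 2) := by fun_prop
    refine hc.continuousAt.eventually_ne ?_
    rw [show p 2 + star (p 2) = ((2 * (p 2).re : ℝ) : ℂ) from Complex.add_conj _]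
    exact Complex.ofReal_ne_zero.2 (mul_ne_zero two_ne_zero h2)
  refine (interior_inter_nonempty_of_le_dimAt h
    ((eventually_branch_eq_zero (by simp [h0]) h1 h2 hU).and hne)).ne_empty ?_
  rw [← subset_empty_iff, ← interior_setOf_apply_zero_eq_zero]
  refine interior_mono ?_
  rintro z ⟨hz, hb, hz2⟩
  have := hb hz
  have : z 0 * (z 2 + star (p 2)) = 0 := by simpa [branch, h0, h1] using this
  exact (mul_eq_zero.1 this).resolve_right hz2

theorem segreDegenerate_hypersurface :
    segreDegenerate univ hypersurface 3 = {p | p 0 = 0 ∧ p 1 = 0 ∧ (p 2).re = 0} := by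
  ext p
  constructor
  · rintro ⟨-, U, -, hU, h⟩
    have h01 : p 0 = 0 ∧ p 1 = 0 := by
      obtain ⟨z, hz⟩ := interior_inter_nonempty_of_le_dimAt h univ_mem
      exact eq_zero_of_interior_slice ⟨z, interior_mono
        (fun y (hy : y ∈ segreVariety U (hypersurface ∩ U) p ∩ univ) =>
          (complexification_subset hU.subvariety.1 hy.1.2).1) hz⟩
    refine ⟨h01.1, h01.2, ?_⟩
    by_contra h2
    exact not_le_dimAt_segreVariety h01.1 h01.2 h2 hU h
  · rintro ⟨h0, h1, h2⟩
    refine ⟨mem_univ p, univ, Subset.rfl, ?_, ?_⟩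
    · rw [inter_univ]
      exact isGood_univ h0 h1 h2
    · rw [inter_univ]
      have : segreVariety univ hypersurface p = {z | complexPsi (z, star p) = 0} := by
        ext z
        simp [segreVariety, complexification_univ, complexHypersurface]
      rw [this]
      exact le_dimAt_slice_iff.2 ⟨h0, h1⟩

/-- Goodness at 0 identifies the complexification with the full cone near `iota 0`, so for all `p`
near 0 the Segre germ is the slice of `complexPsi` at `p`. -/
theorem relSegreDegenerate_eventuallyEq {U : Set (Fin 3 → ℂ)}
    (hU : IsGood U (hypersurface ∩ U) 0) :
    relSegreDegenerate U (hypersurface ∩ U) 3 =ᶠ[𝓝 0] {p : Fin 3 → ℂ | p 0 = 0 ∧ p 1 = 0} := by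
  have hU0 : U ∈ 𝓝 (0 : Fin 3 → ℂ) := hU.subvariety.1.mem_nhds hU.mem.2
  have hA := hU.germ_eq.eventuallyEq hU0 rfl rfl rfl
  have hι : Tendsto iota (𝓝 (0 : Fin 3 → ℂ)) (𝓝 (iota 0)) := continuous_iota.tendsto 0
  filter_upwards [hU0, hι.eventually (eventually_eventually_nhds.2 hA)] with p hp hAp
  have hS : segreVariety U (hypersurface ∩ U) p =ᶠ[𝓝 p] {z | complexPsi (z, star p) = 0} := by
    filter_upwards [hU.subvariety.1.mem_nhds hp, (tendsto_slice p).eventually hAp] with z hz h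
    exact propext ⟨fun h' => (iff_of_eq h).1 h'.2, fun h' => ⟨hz, (iff_of_eq h).2 h'⟩⟩
  refine propext ⟨fun h => ?_, fun h => ⟨hp, ?_⟩⟩
  · exact le_dimAt_slice_iff.1 ((dimAt_congr (𝕜 := ℂ) hS) ▸ h.2)
  · rw [dimAt_congr hS]
    exact le_dimAt_slice_iff.2 h

theorem tendsto_realPoint : Tendsto (fun t : ℝ => realPoint 0 0 t) (𝓝[≠] 0) (𝓝 0) := by
  have hc : Continuous fun t : ℝ => realPoint 0 0 t := by
    refine continuous_pi fun i => ?_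
    fin_cases i <;> simp [realPoint] <;> fun_prop
  have h0 : realPoint 0 0 0 = 0 := by
    ext i
    fin_cases i <;> simp [realPoint]
  have := hc.tendsto 0
  rw [h0] at this
  exact this.mono_left nhdsWithin_le_nhds

theorem relSegreDegenerate_inter_regularSet {U : Set (Fin 3 → ℂ)}
    (hU : IsGood U (hypersurface ∩ U) 0) :
    (relSegreDegenerate U (hypersurface ∩ U) 3 ∩ regularSet ℝ hypersurface).Nonempty := by
  obtain ⟨t, h, ht0⟩ := ((tendsto_realPoint.eventually (relSegreDegenerate_eventuallyEq hU)).and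
    self_mem_nhdsWithin).exists
  refine ⟨realPoint 0 0 t, (iff_of_eq h).2 ⟨by simp [realPoint], by simp [realPoint]⟩, 5,
    isRegularAt_of_branch (by simp [realPoint]) (by simp [realPoint]) ?_⟩
  simpa [realPoint] using ht0

end SegreDegenerate

/-! ### Differentials, noncoherence, and dimensions of the coordinate planes -/

section Conclusion

theorem isIrreducibleGerm_hypersurface : IsIrreducibleGerm ℝ hypersurface 0 :=
  (isConeAt_hypersurface rfl rfl rfl).isIrreducibleGerm isPrimeCone_hypersurface
    (isSubvarietyGerm_zero_set isOpen_univ (fun p _ => analyticAt_psi p) (mem_univ _))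
    (psi_eq_zero_of_fderiv (by simp) rfl)

theorem fderiv_mul_of_eq_zero {a g : (Fin 3 → ℂ) → ℝ} {p : Fin 3 → ℂ} (ha : DifferentiableAt ℝ a p)
    (hg : DifferentiableAt ℝ g p) (h0 : g p = 0) : fderiv ℝ (fun q => a q * g q) p
      = a p • fderiv ℝ g p := by
  have := (ha.hasFDerivAt.mul hg.hasFDerivAt).fderiv
  rw [h0, zero_smul, add_zero] at this
  exact this

theorem eventually_fderiv_eq {f Q : (Fin 3 → ℂ) → ℝ} (hQ : AnalyticAt ℝ Q 0)
    (h : ∀ᶠ p in 𝓝 0, f p = Q p * psi p) :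
    ∀ᶠ p in 𝓝 0, p ∈ hypersurface → fderiv ℝ f p = Q p • fderiv ℝ psi p := by
  filter_upwards [eventually_eventually_nhds.2 h, hQ.eventually_analyticAt] with p hp hQp hpX
  rw [EventuallyEq.fderiv_eq (f₁ := f) (f := fun q => Q q * psi q) hp]
  exact fderiv_mul_of_eq_zero hQp.differentiableAt (analyticAt_psi p).differentiableAt hpX

theorem eventually_fderiv_eq_zero {f : (Fin 3 → ℂ) → ℝ} (hf : MemIdealAt hypersurface 0 f) :
    ∀ᶠ p : Fin 3 → ℂ in 𝓝 0, (p 0).re = 0 ∧ p 1 = 0 → fderiv ℝ f p = 0 := by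
  obtain ⟨Q, hQ, hfQ⟩ := exists_eq_mul_psi hf
  filter_upwards [eventually_fderiv_eq hQ hfQ] with p hp h
  rw [hp (psi_eq_zero_of_fderiv h.1 h.2), (fderiv_psi_eq_zero_iff p).2 h, smul_zero]

/-- If `a 0 = 0`, then `1 - b a` is nonzero near 0, so ψ would vanish on a neighbourhood. -/
theorem ne_zero_of_psi_eq_mul {a b : (Fin 3 → ℂ) → ℝ} (ha : AnalyticAt ℝ a 0)
    (hb : AnalyticAt ℝ b 0) (h : ∀ᶠ p in 𝓝 0, psi p = b p * (a p * psi p)) : a 0 ≠ 0 := by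
  intro ha0
  have hc : ContinuousAt (fun p => b p * a p) 0 := hb.continuousAt.mul ha.continuousAt
  have hne : ∀ᶠ p in 𝓝 0, b p * a p ≠ 1 := hc.eventually_ne (by simp [ha0])
  have hmem : hypersurface ∈ 𝓝 (0 : Fin 3 → ℂ) := by
    filter_upwards [h, hne] with p hp hp1
    have : (1 - b p * a p) * psi p = 0 := by linear_combination hp
    exact (mul_eq_zero.1 this).resolve_left (sub_ne_zero.2 hp1.symm)
  have := mem_interior_iff_mem_nhds.2 hmem
  rw [interior_hypersurface] at this
  exact this

theorem fderiv_eq_zero_inter_eventuallyEq {f : (Fin 3 → ℂ) → ℝ}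
    (hf : GeneratesIdealAt (fun q (_ : Fin 1) => f q) hypersurface 0) :
    ({p | fderiv ℝ f p = 0} ∩ hypersurface : Set _) =ᶠ[𝓝 0]
      {p : Fin 3 → ℂ | (p 0).re = 0 ∧ p 1 = 0} := by
  obtain ⟨Q, hQ, hfQ⟩ := exists_eq_mul_psi (hf.1 0)
  obtain ⟨b, hb, hfb⟩ := hf.2 psi ⟨analyticAt_psi 0, Eventually.of_forall fun q hq => hq⟩
  have hQ0 : Q 0 ≠ 0 := ne_zero_of_psi_eq_mul hQ (hb 0) (by
    filter_upwards [hfQ, hfb] with p h1 h2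
    rw [Fin.sum_univ_one, h1] at h2
    exact h2)
  filter_upwards [eventually_fderiv_eq hQ hfQ, hQ.continuousAt.eventually_ne hQ0] with p hp hQp
  refine propext ⟨fun h => (fderiv_psi_eq_zero_iff p).1 ?_, fun h => ?_⟩
  · have h1 : fderiv ℝ f p = 0 := h.1
    rw [hp h.2] at h1
    exact (smul_eq_zero.1 h1).resolve_left hQp
  · have hpX : p ∈ hypersurface := psi_eq_zero_of_fderiv h.1 h.2
    refine ⟨?_, hpX⟩
    change fderiv ℝ f p = 0
    rw [hp hpX, (fderiv_psi_eq_zero_iff p).2 h, smul_zero]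

/-- Generators near 0 lie in the ideal at 0, so their differentials vanish on `x = 0`, `w = 0`. At
points `(0, 0, t)` near 0 with `t ≠ 0`, everything they generate then has zero differential, but the
branch does not. -/
theorem not_isCoherent_hypersurface : ¬IsCoherent univ hypersurface := by
  intro h
  obtain ⟨V, hV, h0V, -, k, f, hf, hgen⟩ := h 0 (mem_univ 0)
  have hker : ∀ᶠ p : Fin 3 → ℂ in 𝓝 0, ∀ i, (p 0).re = 0 ∧ p 1 = 0 →
      fderiv ℝ (fun q => f q i) p = 0 :=
    eventually_all.2 fun i => eventually_fderiv_eq_zero ((hgen 0 h0V).1 i)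
  obtain ⟨t, ⟨hker, htV⟩, ht0⟩ := ((tendsto_realPoint.eventually
    (hker.and (hV.mem_nhds h0V))).and self_mem_nhdsWithin).exists
  set p := realPoint 0 0 t with hp
  have h0 : (p 0).re = 0 := by simp [hp, realPoint]
  have h1 : p 1 = 0 := by simp [hp, realPoint]
  obtain ⟨φ, hφ, hφ0, hφd, hφX, -⟩ := exists_branch h0 h1 (by simpa [hp, realPoint] using ht0)
  obtain ⟨a, ha, hφa⟩ := (hgen p htV).2 φ ⟨hφ, hφX.mono fun q hq => hq.1⟩
  refine hφd ?_
  rw [EventuallyEq.fderiv_eq (f₁ := φ) (f := fun q => ∑ i, a i q * f q i) hφa,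
    fderiv_fun_sum (A := fun i q => a i q * f q i) fun i _ => (ha i).differentiableAt.mul ((hgen p htV).1 i).1.differentiableAt]
  refine Finset.sum_eq_zero fun i _ => ?_
  rw [fderiv_mul_of_eq_zero (ha i).differentiableAt ((hgen p htV).1 i).1.differentiableAt
    (((hgen p htV).1 i).2.self_of_nhds (psi_eq_zero_of_fderiv h0 h1)), hker i ⟨h0, h1⟩, smul_zero]

theorem dim_plane {k d : ℕ} (T : (Fin 3 → ℂ) →L[ℝ] Fin k → ℝ) (hT : Function.Surjective T)
    (hd : d + k = 6) {S : Set (Fin 3 → ℂ)} (hS : ∀ p, p ∈ S ↔ T p = 0) :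
    dim ℝ S = d ∧ dimAt ℝ S 0 = d := by
  obtain rfl : S = {q | T q = 0} := ext hS
  exact dim_ker T hT (by rw [finrank_real, hd])

/-- The real and imaginary parts of the coordinates of a point of `ℂ³`. -/
noncomputable def realCoord (i : Fin 3 × Fin 2) : (Fin 3 → ℂ) →L[ℝ] ℝ :=
  (if i.2 = 0 then Complex.reCLM else Complex.imCLM).comp (ContinuousLinearMap.proj i.1)

theorem surjective_realCoord {k : ℕ} {c : Fin k → Fin 3 × Fin 2} (hc : Function.Injective c) :
    Function.Surjective (ContinuousLinearMap.pi fun j => realCoord (c j)) := by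
  intro y
  refine ⟨fun i => ⟨Function.extend c y 0 (i, 0), Function.extend c y 0 (i, 1)⟩, ?_⟩
  ext j
  rw [← hc.extend_apply y 0 j]
  rcases hj : c j with ⟨i, l⟩
  fin_cases l <;> simp [realCoord, hj]

theorem dim_coordinate_plane {k d : ℕ} {c : Fin k → Fin 3 × Fin 2} (hc : Function.Injective c)
    (hd : d + k = 6) {S : Set (Fin 3 → ℂ)} (hS : ∀ p, p ∈ S ↔ ∀ j, realCoord (c j) p = 0) :
    dim ℝ S = d ∧ dimAt ℝ S 0 = d :=
  dim_plane _ (surjective_realCoord hc) hd fun p => by rw [hS, funext_iff]; rfl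

theorem dim_three_plane : dim ℝ {p : Fin 3 → ℂ | (p 0).re = 0 ∧ p 1 = 0} = 3 ∧
    dimAt ℝ {p : Fin 3 → ℂ | (p 0).re = 0 ∧ p 1 = 0} 0 = 3 :=
  dim_coordinate_plane (c := ![(0, 0), (1, 0), (1, 1)]) (by decide) rfl fun p => by
    simp [Fin.forall_fin_succ, realCoord, Complex.ext_iff]

theorem dim_two_plane : dim ℝ {p : Fin 3 → ℂ | (p 0).re = 0 ∧ p 1 = 0 ∧ (p 2).re = 0} = 2 :=
  (dim_coordinate_plane (c := ![(0, 0), (1, 0), (1, 1), (2, 0)]) (by decide) rfl fun p => by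
    simp [Fin.forall_fin_succ, realCoord, Complex.ext_iff, and_assoc]).1

theorem dim_line : dim ℝ {p : Fin 3 → ℂ | p 0 = 0 ∧ p 1 = 0 ∧ (p 2).re = 0} = 1 :=
  (dim_coordinate_plane (c := ![(0, 0), (0, 1), (1, 0), (1, 1), (2, 0)]) (by decide) rfl fun p => by
    simp [Fin.forall_fin_succ, realCoord, Complex.ext_iff, and_assoc]).1

/-- A holomorphic function vanishing on the imaginary axis near 0 vanishes on a complex disc of the
`ξ`-axis, which contains the point `ξ = r / 2` off the line. -/
theorem not_isSubvariety_line :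
    ¬IsSubvariety ℂ univ {p : Fin 3 → ℂ | p 0 = 0 ∧ p 1 = 0 ∧ (p 2).re = 0} := by
  rintro ⟨-, -, h⟩
  obtain ⟨V, hV, h0V, -, F, hF, hX⟩ := h 0 (mem_univ 0)
  set γ : ℂ → Fin 3 → ℂ := fun z => z • ![0, 0, 1] with hγ
  have hγ0 : γ 0 = 0 := zero_smul ℂ _
  have hγa : AnalyticAt ℂ γ 0 := analyticAt_id.smul analyticAt_const
  have hγV : ∀ᶠ z in 𝓝 0, γ z ∈ V := hγa.continuousAt.eventually_mem (by
    rw [hγ0]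
    exact hV.mem_nhds h0V)
  obtain ⟨r, hr, hball⟩ := Metric.eventually_nhds_iff_ball.1 hγV
  have hFγ : ∀ f ∈ F, ∀ z ∈ Metric.ball (0 : ℂ) r, f (γ z) = 0 := by
    intro f hf
    have han : AnalyticOnNhd ℂ (fun z => f (γ z)) (Metric.ball 0 r) := fun z hz =>
      (hF f hf _ (hball z hz)).comp (analyticAt_id.smul analyticAt_const)
    refine han.eqOn_zero_of_preconnected_of_frequently_eq_zero
      (convex_ball _ _).isPreconnected (Metric.mem_ball_self hr) ?_
    have ht : Tendsto (fun t : ℝ => (t : ℂ) * Complex.I) (𝓝[≠] 0) (𝓝[≠] 0) := by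
      refine tendsto_nhdsWithin_iff.2 ⟨?_, ?_⟩
      · have hc : Continuous fun t : ℝ => (t : ℂ) * Complex.I := by fun_prop
        have := hc.tendsto 0
        simp only [Complex.ofReal_zero, zero_mul] at this
        exact this.mono_left nhdsWithin_le_nhds
      · filter_upwards [self_mem_nhdsWithin] with t ht
        simpa using ht
    refine ht.frequently (Eventually.frequently ?_)
    filter_upwards [ht.eventually (nhdsWithin_le_nhds (Metric.ball_mem_nhds _ hr))] with t ht
    have : γ (t * Complex.I) ∈ {p : Fin 3 → ℂ | p 0 = 0 ∧ p 1 = 0 ∧ (p 2).re = 0} ∩ V :=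
      ⟨by simp [hγ], hball _ ht⟩
    rw [hX] at this
    exact this.2 f hf
  have hmem : ((r / 2 : ℝ) : ℂ) ∈ Metric.ball (0 : ℂ) r := by
    rw [mem_ball_zero_iff, Complex.norm_real, Real.norm_of_nonneg (by positivity)]
    linarith
  have : γ (r / 2 : ℝ) ∈ {p : Fin 3 → ℂ | p 0 = 0 ∧ p 1 = 0 ∧ (p 2).re = 0} ∩ V := by
    rw [hX]
    exact ⟨hball _ hmem, fun f hf => hFγ f hf _ hmem⟩
  have h2 := this.1.2.2
  simp [hγ] at h2
  exact hr.ne' h2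

end Conclusion

end SegreExample

open SegreExample in
theorem mainTheorem8 :
    -- `X` is a noncoherent real-analytic hypersurface, irreducible at the origin
    IsSubvariety ℝ univ hypersurface ∧
    dim ℝ hypersurface = 5 ∧
    IsIrreducibleGerm ℝ hypersurface 0 ∧
    ¬ IsCoherent univ hypersurface ∧
    -- the singular set
    singularSet ℝ hypersurface = {p | (p 0).re = 0 ∧ p 1 = 0 ∧ (p 2).re = 0} ∧
    dim ℝ (singularSet ℝ hypersurface) = 2 ∧
    -- vanishing of differentials
    GeneratesIdealAt (fun q (_ : Fin 1) => psi q) hypersurface 0 ∧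
    {p | fderiv ℝ psi p = 0} = {p | (p 0).re = 0 ∧ p 1 = 0} ∧
    {p | fderiv ℝ psi p = 0} ⊆ hypersurface ∧
    dim ℝ {p | fderiv ℝ psi p = 0} = 3 ∧
    (∀ f : (Fin 3 → ℂ) → ℝ, MemIdealAt hypersurface 0 f →
      {p | (p 0).re = 0 ∧ p 1 = 0} ≤ᶠ[𝓝 0] ({p | fderiv ℝ f p = 0} ∩ hypersurface : Set _) ∧
      (GeneratesIdealAt (fun q (_ : Fin 1) => f q) hypersurface 0 →
        dimAt ℝ ({p | fderiv ℝ f p = 0} ∩ hypersurface) 0 = 3)) ∧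
    -- the set of Segre-degenerate points is a real line
    segreDegenerate univ hypersurface 3 = {p | p 0 = 0 ∧ p 1 = 0 ∧ (p 2).re = 0} ∧
    dim ℝ (segreDegenerate univ hypersurface 3) = 1 ∧
    ¬ IsSubvariety ℂ univ (segreDegenerate univ hypersurface 3) ∧
    -- the set of Segre-degenerate points relative to a good neighborhood of the origin
    (∀ U : Set (Fin 3 → ℂ), IsGood U (hypersurface ∩ U) 0 →
      relSegreDegenerate U (hypersurface ∩ U) 3 =ᶠ[𝓝 0] {p : Fin 3 → ℂ | p 0 = 0 ∧ p 1 = 0} ∧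
      (relSegreDegenerate U (hypersurface ∩ U) 3 ∩ regularSet ℝ hypersurface).Nonempty) := by
  have hset : {p | fderiv ℝ psi p = 0} = {p | (p 0).re = 0 ∧ p 1 = 0} := ext fderiv_psi_eq_zero_iff
  refine ⟨(isGood_univ (c := 0) rfl rfl rfl).subvariety, (dimAt_hypersurface (c := 0) rfl rfl rfl).2,
    isIrreducibleGerm_hypersurface, not_isCoherent_hypersurface, singularSet_hypersurface, ?_,
    generatesIdealAt_psi rfl rfl rfl, hset, ?_, ?_, fun f hf => ⟨?_, fun hgen => ?_⟩,
    segreDegenerate_hypersurface, ?_, ?_, fun U hU =>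
      ⟨relSegreDegenerate_eventuallyEq hU, relSegreDegenerate_inter_regularSet hU⟩⟩
  · rw [singularSet_hypersurface]
    exact dim_two_plane
  · rw [hset]
    exact fun p hp => psi_eq_zero_of_fderiv hp.1 hp.2
  · rw [hset]
    exact dim_three_plane.1
  · filter_upwards [eventually_fderiv_eq_zero hf] with p hp h
    exact ⟨hp h, psi_eq_zero_of_fderiv h.1 h.2⟩
  · rw [dimAt_congr (fderiv_eq_zero_inter_eventuallyEq hgen)]
    exact dim_three_plane.2
  · rw [segreDegenerate_hypersurface]
    exact dim_line
  · rw [segreDegenerate_hypersurface]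
    exact not_isSubvariety_line
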